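/- **Conventions.** A $*$-test graph in variables $(x_j)_{j\in J}$ is a finite connected directed multigraph (loops allowed) $T=(V,E)$ whose edges are labelled by symbols $x_j$ or $x_j^*$; a $*$-graph monomial is a $*$-test graph with a marked input and a marked output, and an $n*$-graph monomial is one with $n$ marked vertices. All are considered up to isomorphism. A *space of traffics* is a unital complex $*$-algebra $\mathcal A$ with a tracial state $\Phi$ (linear, $\Phi(1)=1$, $\Phi(ab)=\Phi(ba)$, $\Phi(a^*a)\ge 0$), in which one can substitute elements for the edge labels of every $*$-graph monomial, $(t,\mathbf a)\mapsto t(\mathbf a)\in\mathcal A$, such that: substitution is compatible with substitution of monomials into monomials (associativity) and linear in the element placed on any edge of exponent $1$; on a directed path from the input to the output it gives the product of the labels; an edge labelled by the unit of $\mathcal A$ may be removed after gluing its two ends; and $t(\mathbf a)^*=t^*(\mathbf a)$, where $t^*$ is obtained by reversing the edges and exchanging $x_j$ with $x_j^*$ and the input with the output. Moreover there is a traffic state $\tau$, assigning a number $\tau[T(\mathbf a)]$ to every $*$-test graph $T$ and every family $\mathbf a$ of elements of $\mathcal A$, with $\Phi(t(\mathbf a))=\tau[T(\mathbf a)]$ when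 $T$ is obtained from $t$ by gluing the input to the output, and which is non-negative: for $n\ge1$, $n*$-graph monomials $t_1,\dots,t_m$ and $z\in\mathbb C^m$, $\sum_{k,l}\overline{z_k}z_l\,\tau[T(t_k^*,t_l)(\mathbf a)]\ge0$, where $T(t,t')$ is obtained by gluing the $i$-th marked vertices of $t$ and $t'$ for each $i$, and here $t^*$ keeps the order of the marked vertices. The *distribution of traffics* of a family $\mathbf a$ is $T\mapsto\tau[T(\mathbf a)]$. The injective version $\tau^0$ of $\tau$ is determined by $\tau[T(\mathbf a)]=\sum_{\pi}\tau^0[T^\pi(\mathbf a)]$, the sum being over the partitions $\pi$ of the vertex set and $T^\pi$ being obtained by gluing the vertices in each block. Families $\mathbf a_1,\dots,\mathbf a_p$ in $\mathcal A$ are *traffic-free* if, for every $*$-test graph $T$ in disjoint families of variables $\mathbf x_1,\dots,\mathbf x_p$, $$\tau^0[T(\mathbf a_1,\dots,\mathbf a_p)]=\begin{cases}\prod_{\tilde T}\tau^0[\tilde T(\mathbf a_{i_{\tilde T}})]&\text{if }T\text{ is a free product},\\0&\text{otherwise,}\end{cases}$$ where $\tilde T$ runs over the maximal connected subgraphs of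 $T$ with at least one edge and all labels in a single family $\mathbf x_{i_{\tilde T}}$, and $T$ is a free product if it has no edge or if the bipartite graph whose vertices are the $\tilde T$'s and the vertices of $T$ common to several $\tilde T$'s (with adjacency given by membership) is a tree. They are *$*$-free* if $\Phi(P_1(\mathbf a_{i_1})\cdots P_n(\mathbf a_{i_n}))=0$ for all $n\ge 1$, all indices with $i_1\ne i_2\neq\cdots\ne i_n$ and all $*$-polynomials with $\Phi(P_k(\mathbf a_{i_k}))=0$ for every $k$. A (complex) *Haar unitary traffic* is an element $u$ with $u^*u=uu^*=1$ such that, for every $*$-test graph $T$ in one variable, $$\tau[T(u)]=\lim_{N\to\infty}\mathbb E\Big[\frac1N\sum_{\phi:V\to\{1,\dots,N\}}\ \prod_{e=(v,w)\in E}U_N^{\varepsilon(e)}\big(\phi(v),\phi(w)\big)\Big],$$ where $U_N$ is Haar distributed on the group of $N\times N$ unitary matrices and $\varepsilon(e)\in\{1,*\}$ is the exponent carried by $e$. A family $\mathbf a=(a_j)_{j\in J}$ is *freely unitarily invariant* if it has the same distribution of traffics as $u\mathbf a'u^*=(ua'_ju^*)_{j\in J}$, where, in some space of traffics, $\mathbf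 a'$ has the same distribution of traffics as $\mathbf a$ and $u$ is a Haar unitary traffic, traffic-free from $\mathbf a'$. **Proposition.** Let $\mathbf a$ and $\mathbf b$ be arbitrary families of elements of a space of traffics $\mathcal A$. 1. If $u\in\mathcal A$ is a Haar unitary traffic that is traffic-free from the joint family $(\mathbf a,\mathbf b)$, then $u\mathbf a u^*$ and $\mathbf b$ are traffic-free, and they are $*$-free. 2. If $\mathbf a$ and $\mathbf b$ are traffic-free and at least one of them is freely unitarily invariant, then $\mathbf a$ and $\mathbf b$ are $*$-free. -/

import Mathlib

open MeasureTheory Filter Topology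
open scoped ComplexOrder

universe u v w x

noncomputable section

/-! ### Star-graphs -/

/-- A finite `*`-graph in the variables `x_j`, `j : J`: a finite directed multigraph (loops and
multiple edges allowed) whose edge `e` carries the label `x_{lab e}` if `adj e = false` and
`x_{lab e}^*` if `adj e = true`. -/
structure StarGraph (J : Type u) where
  V : Type
  E : Type
  finV : Finite V
  finE : Finite E
  src : E → V
  tgt : E → V
  lab : E → J
  adj : E → Bool

/-- A finite `*`-graph with an input and an output. Connected ones are `*`-graph monomials. -/
structure BiGraph (J : Type u) extends StarGraph J where
  inp : V
  out : V

/-- A finite `*`-graph with `n` marked vertices. Connected ones are `n*`-graph monomials. -/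
structure NGraph (J : Type u) (n : ℕ) extends StarGraph J where
  mark : Fin n → V

attribute [instance] StarGraph.finV StarGraph.finE

namespace StarGraph

variable {J : Type u} {K : Type v}

/-- Connectedness of the underlying undirected graph (in particular, there is a vertex).
A `*`-test graph is a connected finite `*`-graph. -/
def Connected (T : StarGraph J) : Prop :=
  (SimpleGraph.fromRel fun v w : T.V => ∃ e, T.src e = v ∧ T.tgt e = w).Connected

/-- Replace the labels of the edges. -/
def relabel (T : StarGraph J) (l : T.E → K) : StarGraph K where
  V := T.V
  E := T.E
  finV := T.finV
  finE := T.finE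
  src := T.src
  tgt := T.tgt
  lab := l
  adj := T.adj

/-- Replace the variable `x_j` by `f j`. -/
def map (f : J → K) (T : StarGraph J) : StarGraph K := T.relabel fun e => f (T.lab e)

/-- Reverse all the edges and exchange the labels `x_j` and `x_j^*`. -/
def reverse (T : StarGraph J) : StarGraph J where
  V := T.V
  E := T.E
  finV := T.finV
  finE := T.finE
  src := T.tgt
  tgt := T.src
  lab := T.lab
  adj := fun e => !T.adj e

/-- Identify the vertices related by (the equivalence relation generated by) `r`. -/
def glue (T : StarGraph J) (r : T.V → T.V → Prop) : StarGraph J where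
  V := Quot r
  E := T.E
  finV := inferInstance
  finE := T.finE
  src := fun e => Quot.mk r (T.src e)
  tgt := fun e => Quot.mk r (T.tgt e)
  lab := T.lab
  adj := T.adj

/-- The graph `T^π`: the vertices in a same block of the partition `π` are identified. -/
def quotient (T : StarGraph J) (π : Setoid T.V) : StarGraph J := T.glue fun v w => π v w

/-- Isomorphism of `*`-graphs. -/
def Isomorphic (T T' : StarGraph J) : Prop :=
  ∃ (f : T.V ≃ T'.V) (φ : T.E ≃ T'.E), ∀ e,
    T'.src (φ e) = f (T.src e) ∧ T'.tgt (φ e) = f (T.tgt e) ∧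
    T'.lab (φ e) = T.lab e ∧ T'.adj (φ e) = T.adj e

/-! #### Monochromatic components and free products

The variables are split into families by a colouring `c : J → ι`: the family of index `i` consists
of the `x_j` with `c j = i`. -/

variable {ι : Type w}

/-- `v` is an end of `e`. -/
def Incident (T : StarGraph J) (e : T.E) (v : T.V) : Prop := T.src e = v ∨ T.tgt e = v

/-- The two edges are labelled in a same family and have a common end. -/
def Touch (T : StarGraph J) (c : J → ι) (e e' : T.E) : Prop :=
  c (T.lab e) = c (T.lab e') ∧ ∃ v, T.Incident e v ∧ T.Incident e' v

/-- The connected components of `T` labelled with variables in a same family, described by their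
sets of edges: the classes of the equivalence relation generated by `Touch`. -/
def Comp (T : StarGraph J) (c : J → ι) : Type := Quot (T.Touch c)

/-- `v` is a vertex of the component `k`. -/
def HasVertex (T : StarGraph J) (c : J → ι) (k : T.Comp c) (v : T.V) : Prop :=
  ∃ e, (Quot.mk _ e : T.Comp c) = k ∧ T.Incident e v

/-- The component `k`, as a `*`-graph. -/
def compGraph (T : StarGraph J) (c : J → ι) (k : T.Comp c) : StarGraph J where
  V := {v : T.V // T.HasVertex c k v}
  E := {e : T.E // (Quot.mk _ e : T.Comp c) = k}
  finV := inferInstance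
  finE := inferInstance
  src := fun e => ⟨T.src e.1, e.1, e.2, Or.inl rfl⟩
  tgt := fun e => ⟨T.tgt e.1, e.1, e.2, Or.inr rfl⟩
  lab := fun e => T.lab e.1
  adj := fun e => T.adj e.1

/-- The vertices of `T` that are common to several components. -/
def Shared (T : StarGraph J) (c : J → ι) : Type :=
  {v : T.V // ∃ k k' : T.Comp c, k ≠ k' ∧ T.HasVertex c k v ∧ T.HasVertex c k' v}

/-- The undirected bipartite graph of the components and of the vertices common to several
components, adjacency being membership. -/
def barGraph (T : StarGraph J) (c : J → ι) : SimpleGraph (T.Comp c ⊕ T.Shared c) :=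
  SimpleGraph.fromRel fun p q => ∃ k v, p = Sum.inl k ∧ q = Sum.inr v ∧ T.HasVertex c k v.1

/-- `T` is a free product in the families of variables given by `c`. A graph without edges has no
component and is a (trivial) free product. -/
def IsFreeProduct (T : StarGraph J) (c : J → ι) : Prop :=
  IsEmpty T.E ∨ (T.barGraph c).IsTree

/-- The (non-normalized) trace of a `*`-graph in `N × N` matrices. -/
def matrixTrace {N : ℕ} (T : StarGraph J) (M : J → Matrix (Fin N) (Fin N) ℂ) : ℂ :=
  ∑ᶠ φ : T.V → Fin N, ∏ᶠ e : T.E,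
    (match T.adj e with
      | false => M (T.lab e)
      | true => (M (T.lab e)).conjTranspose) (φ (T.src e)) (φ (T.tgt e))

end StarGraph

namespace BiGraph

variable {J : Type u} {K : Type v}

/-- Replace the labels of the edges. -/
def relabel (t : BiGraph J) (l : t.E → K) : BiGraph K where
  toStarGraph := t.toStarGraph.relabel l
  inp := t.inp
  out := t.out

/-- Replace the variable `x_j` by `f j`. -/
def map (f : J → K) (t : BiGraph J) : BiGraph K := t.relabel fun e => f (t.lab e)

/-- The adjoint `t^*`: edges reversed, labels `x_j`, `x_j^*` exchanged, input and output
exchanged. -/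
def adjoint (t : BiGraph J) : BiGraph J where
  toStarGraph := t.toStarGraph.reverse
  inp := t.out
  out := t.inp

/-- `t` or `t^*`, according to the exponent. -/
def exponent (t : BiGraph J) : Bool → BiGraph J
  | false => t
  | true => t.adjoint

/-- Isomorphism of bi-rooted `*`-graphs. -/
def Isomorphic (t t' : BiGraph J) : Prop :=
  ∃ (f : t.V ≃ t'.V) (φ : t.E ≃ t'.E), f t.inp = t'.inp ∧ f t.out = t'.out ∧ ∀ e,
    t'.src (φ e) = f (t.src e) ∧ t'.tgt (φ e) = f (t.tgt e) ∧
    t'.lab (φ e) = t.lab e ∧ t'.adj (φ e) = t.adj e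

/-- The `*`-graph obtained by identifying the input and the output. -/
def close (t : BiGraph J) : StarGraph J :=
  t.toStarGraph.glue fun v w => v = t.inp ∧ w = t.out

/-- The `*`-graph monomial of a word in the `x_j`, `x_j^*`: a directed path from the input to the
output whose successive edges are labelled by the letters. -/
def path (l : List (J × Bool)) : BiGraph J where
  V := Fin (l.length + 1)
  E := Fin l.length
  finV := inferInstance
  finE := inferInstance
  src := fun i => i.castSucc
  tgt := fun i => i.succ
  lab := fun i => (l.get i).1
  adj := fun i => (l.get i).2
  inp := 0
  out := Fin.last _

/-- Identify the two ends of the edge `e` and remove `e`. -/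
def contract (t : BiGraph J) (e : t.E) : BiGraph J where
  V := Quot fun v w => v = t.src e ∧ w = t.tgt e
  E := {e' : t.E // e' ≠ e}
  finV := inferInstance
  finE := inferInstance
  src := fun e' => Quot.mk _ (t.src e'.1)
  tgt := fun e' => Quot.mk _ (t.tgt e'.1)
  lab := fun e' => t.lab e'.1
  adj := fun e' => t.adj e'.1
  inp := Quot.mk _ t.inp
  out := Quot.mk _ t.out

/-- Substitution: each edge `e` of `t` is replaced by the bi-rooted graph `s e` (by its adjoint if
`e` carries an exponent `*`), whose input and output are glued to the source and the target of
`e`. -/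
def subst (t : BiGraph J) (s : t.E → BiGraph K) : BiGraph K where
  V := Quot fun p q : t.V ⊕ (Σ e, ((s e).exponent (t.adj e)).V) =>
    ∃ e, (p = Sum.inl (t.src e) ∧ q = Sum.inr ⟨e, ((s e).exponent (t.adj e)).inp⟩) ∨
         (p = Sum.inl (t.tgt e) ∧ q = Sum.inr ⟨e, ((s e).exponent (t.adj e)).out⟩)
  E := Σ e, ((s e).exponent (t.adj e)).E
  finV := inferInstance
  finE := inferInstance
  src := fun p => Quot.mk _ (Sum.inr ⟨p.1, ((s p.1).exponent (t.adj p.1)).src p.2⟩)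
  tgt := fun p => Quot.mk _ (Sum.inr ⟨p.1, ((s p.1).exponent (t.adj p.1)).tgt p.2⟩)
  lab := fun p => ((s p.1).exponent (t.adj p.1)).lab p.2
  adj := fun p => ((s p.1).exponent (t.adj p.1)).adj p.2
  inp := Quot.mk _ (Sum.inl t.inp)
  out := Quot.mk _ (Sum.inl t.out)

end BiGraph

namespace NGraph

variable {J : Type u} {n : ℕ}

/-- The adjoint of an `n*`-graph monomial (the order of the marked vertices is kept). -/
def adjoint (t : NGraph J n) : NGraph J n where
  toStarGraph := t.toStarGraph.reverse
  mark := t.mark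

/-- The graph `T(t, t')`, obtained by gluing the `i`-th marked vertices of `t` and `t'`. -/
def merge (t t' : NGraph J n) : StarGraph J where
  V := Quot fun p q : t.V ⊕ t'.V => ∃ i, p = Sum.inl (t.mark i) ∧ q = Sum.inr (t'.mark i)
  E := t.E ⊕ t'.E
  finV := inferInstance
  finE := inferInstance
  src := Sum.elim (fun e => Quot.mk _ (Sum.inl (t.src e))) fun e => Quot.mk _ (Sum.inr (t'.src e))
  tgt := Sum.elim (fun e => Quot.mk _ (Sum.inl (t.tgt e))) fun e => Quot.mk _ (Sum.inr (t'.tgt e))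
  lab := Sum.elim t.lab t'.lab
  adj := Sum.elim t.adj t'.adj

end NGraph

/-! ### Spaces of traffics -/

section Traffics

/-- `a` or `a^*`, according to the exponent. -/
def starPow {A : Type u} [Star A] (a : A) : Bool → A
  | false => a
  | true => star a

open Classical in
/-- A structure of space of traffics on a unital complex `*`-algebra `A`. The element `t(a)`
obtained by substituting a family `a : J → A` to the variables of a `*`-graph monomial `t` is
`eval (t.map a)`, and the number `τ[T(a)]` is `τ (T.map a)`; thus the primitive operations are
those on graphs whose edges are labelled by elements of `A`. Only the values on connected graphs
matter: no axiom involves the values of `eval` and `τ` on other graphs. -/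
structure TrafficSpace (A : Type u) [Ring A] [StarRing A] [Algebra ℂ A] [StarModule ℂ A] where
  /-- the tracial state -/
  Φ : A →ₗ[ℂ] ℂ
  /-- substitution in `*`-graph monomials -/
  eval : BiGraph A → A
  /-- the traffic state -/
  τ : StarGraph A → ℂ
  unity : Φ 1 = 1
  traciality : ∀ a b : A, Φ (a * b) = Φ (b * a)
  positivity : ∀ a : A, 0 ≤ Φ (star a * a)
  /-- graphs are considered up to isomorphism -/
  eval_iso : ∀ t t' : BiGraph A, t.Connected → t.Isomorphic t' → eval t = eval t'
  τ_iso : ∀ T T' : StarGraph A, T.Connected → T.Isomorphic T' → τ T = τ T'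
  associativity : ∀ (t : BiGraph A) (s : t.E → BiGraph A), t.Connected →
    (∀ e, (s e).Connected) → eval (t.relabel fun e => eval (s e)) = eval (t.subst s)
  linearity_add : ∀ (t : BiGraph A) (e : t.E), t.Connected → t.adj e = false → ∀ a b : A,
    eval (t.relabel (Function.update t.lab e (a + b))) =
      eval (t.relabel (Function.update t.lab e a)) + eval (t.relabel (Function.update t.lab e b))
  linearity_smul : ∀ (t : BiGraph A) (e : t.E), t.Connected → t.adj e = false → ∀ (z : ℂ) (a : A),
    eval (t.relabel (Function.update t.lab e (z • a))) =
      z • eval (t.relabel (Function.update t.lab e a))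
  /-- compatibility with the `*`-algebra structure -/
  compatibility : ∀ l : List (A × Bool),
    eval (BiGraph.path l) = (l.map fun p => starPow p.1 p.2).prod
  /-- role of the unit of `A` -/
  eval_one : ∀ (t : BiGraph A) (e : t.E), t.Connected → t.lab e = 1 →
    eval t = eval (t.contract e)
  involutivity : ∀ t : BiGraph A, t.Connected → star (eval t) = eval t.adjoint
  /-- the tracial state is given by the traffic state -/
  state : ∀ t : BiGraph A, t.Connected → Φ (eval t) = τ t.close
  /-- non-negativity of the traffic state, on the `n*`-graph polynomial `∑ i, z i • t i` -/
  nonneg : ∀ (n : ℕ), 1 ≤ n → ∀ (m : ℕ) (z : Fin m → ℂ) (t : Fin m → NGraph A n),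
    (∀ i, (t i).Connected) →
      0 ≤ ∑ i, ∑ j, star (z i) * z j * τ ((t i).adjoint.merge (t j))

/-- There are finitely many partitions of a finite set. -/
theorem finite_setoid (V : Type) [Finite V] : Finite (Setoid V) :=
  Finite.of_injective (fun (r : Setoid V) (x y : V) => r x y) fun _ _ h =>
    Setoid.ext fun x y => iff_of_eq (congrFun (congrFun h x) y)

open Classical in
/-- The Möbius function `μ(⊥, π)` of the lattice of partitions of `V`, `⊥` being the partition into
singletons. -/
def partitionMoebius (V : Type) [Finite V] (π : Setoid V) : ℂ :=
  haveI := finite_setoid V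
  letI : Fintype (Setoid V) := Fintype.ofFinite _
  letI : LocallyFiniteOrder (Setoid V) := Fintype.toLocallyFiniteOrder
  IncidenceAlgebra.mu ℂ ⊥ π

/-- `*`-polynomials in the non commutative indeterminates `x_j`, `x_j^*`. -/
abbrev StarPoly (J : Type u) : Type u := FreeAlgebra ℂ (J × Bool)

/-- Evaluation `P(a)` of a `*`-polynomial. -/
def StarPoly.eval {J : Type v} {A : Type u} [Ring A] [StarRing A] [Algebra ℂ A]
    (a : J → A) : StarPoly J →ₐ[ℂ] A :=
  FreeAlgebra.lift ℂ fun p : J × Bool => starPow (a p.1) p.2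

/-- The family `u a u^* = (u a_j u^*)_j`. -/
def conjFamily {J : Type v} {A : Type u} [Ring A] [StarRing A] (y : A) (a : J → A) : J → A :=
  fun j => y * a j * star y

/-! ### Haar measure on the unitary group -/

theorem unitaryGroup_compactSpace (N : ℕ) : CompactSpace (Matrix.unitaryGroup (Fin N) ℂ) := by
  refine isCompact_iff_compactSpace.mp ?_
  have hK : IsCompact (Set.pi Set.univ fun _ : Fin N => Set.pi Set.univ fun _ : Fin N =>
      Metric.closedBall (0 : ℂ) 1) :=
    isCompact_univ_pi fun _ => isCompact_univ_pi fun _ => isCompact_closedBall _ _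
  refine IsCompact.of_isClosed_subset hK ?_ ?_
  · have : ((Matrix.unitaryGroup (Fin N) ℂ : Set (Matrix (Fin N) (Fin N) ℂ))) =
        {M | star M * M = 1} ∩ {M | M * star M = 1} := by
      ext M; exact Iff.rfl
    rw [this]
    exact (isClosed_eq (by fun_prop) continuous_const).inter
      (isClosed_eq (by fun_prop) continuous_const)
  · intro M hM i _ j _
    rw [mem_closedBall_zero_iff]
    exact entry_norm_bound_of_unitary hM i j

/-- The expectation of `f(U_N)`, `U_N` being distributed according to the Haar probability measure
on the group of `N × N` unitary matrices. -/
def haarExpectation (N : ℕ) (f : Matrix.unitaryGroup (Fin N) ℂ → ℂ) : ℂ :=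
  letI : MeasurableSpace (Matrix.unitaryGroup (Fin N) ℂ) := borel _
  haveI : BorelSpace (Matrix.unitaryGroup (Fin N) ℂ) := ⟨rfl⟩
  haveI := unitaryGroup_compactSpace N
  ∫ U, f U ∂(Measure.haarMeasure (⊤ : TopologicalSpace.PositiveCompacts
    (Matrix.unitaryGroup (Fin N) ℂ)))

namespace TrafficSpace

variable {A : Type u} [Ring A] [StarRing A] [Algebra ℂ A] [StarModule ℂ A]

/-- The injective version `τ⁰` of the traffic state, i.e. the Möbius inverse of the relation
`τ[T] = ∑_π τ⁰[T^π]`. -/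
def τ₀ (S : TrafficSpace A) (T : StarGraph A) : ℂ :=
  ∑ᶠ π : Setoid T.V, partitionMoebius T.V π * S.τ (T.quotient π)

/-- Two families of traffics, possibly in different spaces, have the same distribution of
traffics. -/
def SameDistribution {B : Type w} [Ring B] [StarRing B] [Algebra ℂ B] [StarModule ℂ B]
    {J : Type v} (S : TrafficSpace A) (a : J → A) (S' : TrafficSpace B) (b : J → B) : Prop :=
  ∀ T : StarGraph J, T.Connected → S.τ (T.map a) = S'.τ (T.map b)

open Classical in
/-- Traffic-freeness of the families `(a_j)_{c j = i}`, `i : ι`. -/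
def TrafficFree (S : TrafficSpace A) {J : Type v} {ι : Type w} (a : J → A) (c : J → ι) : Prop :=
  ∀ T : StarGraph J, T.Connected →
    S.τ₀ (T.map a) =
      if T.IsFreeProduct c then ∏ᶠ k : T.Comp c, S.τ₀ ((T.compGraph c k).map a) else 0

/-- `*`-freeness of the families `(a_j)_{c j = i}`, `i : ι`. -/
def StarFree (S : TrafficSpace A) {J : Type v} {ι : Type w} (a : J → A) (c : J → ι) : Prop :=
  ∀ (n : ℕ), 1 ≤ n → ∀ i : Fin n → ι,
    (∀ (k : ℕ) (hk : k + 1 < n), i ⟨k, Nat.lt_of_succ_lt hk⟩ ≠ i ⟨k + 1, hk⟩) →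
    ∀ P : (k : Fin n) → StarPoly {j : J // c j = i k},
      (∀ k, S.Φ (StarPoly.eval (fun j => a j.1) (P k)) = 0) →
      S.Φ (List.ofFn fun k => StarPoly.eval (fun j => a j.1) (P k)).prod = 0

/-- Traffic-freeness of two families. -/
def TrafficFreePair (S : TrafficSpace A) {J : Type v} {K : Type w} (a : J → A) (b : K → A) :
    Prop :=
  S.TrafficFree (Sum.elim a b) (Sum.isLeft (α := J) (β := K))

/-- `*`-freeness of two families. -/
def StarFreePair (S : TrafficSpace A) {J : Type v} {K : Type w} (a : J → A) (b : K → A) :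
    Prop :=
  S.StarFree (Sum.elim a b) (Sum.isLeft (α := J) (β := K))

/-- A (complex) Haar unitary traffic: a unitary traffic which is the limit in distribution of
traffics of a Haar distributed `N × N` unitary matrix as `N → ∞`. -/
def IsHaarUnitary (S : TrafficSpace A) (y : A) : Prop :=
  star y * y = 1 ∧ y * star y = 1 ∧
  ∀ T : StarGraph Unit, T.Connected →
    Tendsto (fun N : ℕ => haarExpectation N fun U => (N : ℂ)⁻¹ * T.matrixTrace fun _ => U.1)
      atTop (𝓝 (S.τ (T.map fun _ => y)))

/-- `a` is freely unitarily invariant: it has the same distribution of traffics as `u a u^*`, where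
`u` is a Haar unitary traffic, traffic-free from `a`. Only the distribution of `a` is involved, and
`u` may live in a larger space: it is taken in some space of traffics with a family `a'` that has
the same distribution as `a`. -/
def FreelyUnitarilyInvariant.{u', v', w'} {A : Type u'} [Ring A] [StarRing A] [Algebra ℂ A]
    [StarModule ℂ A] (S : TrafficSpace A) {J : Type v'} (a : J → A) : Prop :=
  ∃ (B : Type w') (_ : Ring B) (_ : StarRing B) (_ : Algebra ℂ B) (_ : StarModule ℂ B)
    (S' : TrafficSpace B) (a' : J → B) (y : B),
    S.SameDistribution a S' a' ∧ S'.IsHaarUnitary y ∧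
    S'.TrafficFreePair (fun _ : Unit => y) a' ∧
    S.SameDistribution a S' (conjFamily y a')

end TrafficSpace

end Traffics

end

/-! Everything reduces to counting vertices, edges and connected components. Colour the edges of a
connected graph on `V` with two colours, and count the components of each colour, isolated vertices
included. The rank, i.e. the number of vertices minus the number of components, is subadditive, so
the two counts add up to at most `|V| + 1`; equality is exactly the tree condition defining free
products (`isFreeProduct_iff`). Extend τ⁰ multiplicatively to disconnected graphs (`Mtau`) and
absorb exponents in the labels (`tau_eq_of_connected`). Traffic-freeness becomes the condition
`TFree` (`trafficFreePair_iff`), which passes to generated algebras (`TFree.adjoin`) by expanding a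
polynomial label edge by edge.

Three estimates are needed for a connected graph with nonzero τ⁰ in a Haar unitary; they take the
place of an exact computation of the moments. Every row and every column is met an even number of
times, since Haar measure is invariant under sign changes. One has `|E| + 2 ≤ 2|V|`, since a moment
of order `|E|` is `O(N^(-|E|/2))` (`card_edges_le_of_tau0_ne_zero`). Finally, if the bipartite graph
of rows `R` and columns `C` has `k` components, then `|V| ≥ |R| + |C| - k + 1`: the moment sees only
this bipartite graph, whose components can be chained into a connected graph with that many
vertices, and a nonzero limit with fewer vertices would make the limit for that graph infinite
(`card_add_le_of_tau0_ne_zero`).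

Traffic-freeness of `u a u*` and `b`: replace each edge labelled `u x u*` by a path of three edges.
Then τ⁰ is a sum over gluings that keep the old vertices distinct. Old vertices are rows of `u` and
new ones are columns; freeness of `u` and the third estimate imply that, in a nonzero term, no old
vertex is glued to a new one (`unglued_of_Mtau_ne_zero`). Each term then factors into a `u`-part, a
`b`-part and an `x`-part (`Mtau_tri`), and the counting conditions decouple (`TFree.conj`).

`*`-freeness: the same expansion, with the other two estimates, shows that a connected graph with
centered labels in the algebra of `u a u*` and with nonzero τ⁰ has even degrees and satisfies `|E| +
2 ≤ 2|V|` (`CenteredSparse`). The trace of an alternating centered product is the value of τ on a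
cycle, i.e. a sum of τ⁰ over the quotients of the cycle. In a nonzero term the sparse colour is
bounded by this estimate, and the other colour, which inherits even degrees, has no component
reduced to a single edge. With the tree condition this gives the second colour too many edges for an
alternating word (`Phi_prod_eq_zero`). `CenteredSparse` depends only on the distribution of
traffics, so it holds for every freely unitarily invariant family. -/

noncomputable section

open scoped Classical

set_option linter.unusedSectionVars false

/-! ### Möbius inversion on the lattice of partitions -/

instance instFintypeSetoid (V : Type) [Finite V] : Fintype (Setoid V) :=
  haveI := finite_setoid V
  Fintype.ofFinite _

instance instLocallyFiniteOrderSetoid (V : Type) [Finite V] : LocallyFiniteOrder (Setoid V) :=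
  Fintype.toLocallyFiniteOrder

/-- `partitionMoebius` builds its order instances locally; they are matched here with the global
ones, so that the general theory of incidence algebras applies. -/
theorem partitionMoebius_eq_mu (V : Type) [Finite V] (π : Setoid V) :
    partitionMoebius V π = IncidenceAlgebra.mu ℂ ⊥ π := by
  unfold partitionMoebius
  congr!

/-- The Möbius function is preserved by embeddings whose image is an upper set. -/
theorem mu_apply_of_upper_embedding {α β : Type*} [PartialOrder α] [LocallyFiniteOrder α]
    [PartialOrder β] [LocallyFiniteOrder β] (e : α → β) (he : ∀ a b, e a ≤ e b ↔ a ≤ b)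
    (hu : ∀ a y, e a ≤ y → ∃ b, e b = y) (a : α) :
    ∀ b, IncidenceAlgebra.mu ℂ (e a) (e b) = IncidenceAlgebra.mu ℂ a b := by
  have hinj : Function.Injective e := fun x y h =>
    le_antisymm ((he _ _).1 h.le) ((he _ _).1 h.ge)
  suffices H : ∀ n : ℕ, ∀ b, (Finset.Ico a b).card = n →
      IncidenceAlgebra.mu ℂ (e a) (e b) = IncidenceAlgebra.mu ℂ a b from fun b => H _ b rfl
  intro n
  induction n using Nat.strong_induction_on with
  | _ n ih =>
    intro b hb
    rw [IncidenceAlgebra.mu_apply, IncidenceAlgebra.mu_apply]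
    by_cases hab : a = b
    · simp [hab]
    · rw [if_neg hab, if_neg (fun h => hab (hinj h))]
      congr 1
      -- The upper-set hypothesis makes the image of an interval an interval, so both Möbius
      -- functions satisfy the same recursion.
      have himg : Finset.Ico (e a) (e b) = (Finset.Ico a b).image e := by
        ext y
        simp only [Finset.mem_Ico, Finset.mem_image]
        constructor
        · rintro ⟨h1, h2⟩
          obtain ⟨x, rfl⟩ := hu a y h1
          exact ⟨x, ⟨(he _ _).1 h1, lt_of_le_not_ge ((he _ _).1 h2.le)
            fun h => h2.not_ge ((he _ _).2 h)⟩, rfl⟩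
        · rintro ⟨x, ⟨h1, h2⟩, rfl⟩
          exact ⟨(he _ _).2 h1, lt_of_le_not_ge ((he _ _).2 h2.le)
            fun h => h2.not_ge ((he _ _).1 h)⟩
      rw [himg, Finset.sum_image fun x _ y _ h => hinj h]
      refine Finset.sum_congr rfl fun x hx => ih _ ?_ x rfl
      rw [← hb]
      rw [Finset.mem_Ico] at hx
      refine Finset.card_lt_card ⟨fun y hy => ?_, fun h => ?_⟩
      · rw [Finset.mem_Ico] at hy ⊢
        exact ⟨hy.1, hy.2.trans hx.2⟩
      · exact lt_irrefl x (Finset.mem_Ico.1 (h (Finset.mem_Ico.2 hx))).2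

/-- Möbius inversion on the lattice of partitions. -/
theorem sum_partitionMoebius_mul {V : Type} [Finite V] (h g : Setoid V → ℂ)
    (H : ∀ σ, h σ = ∑ π with σ ≤ π, g π) : ∑ π, partitionMoebius V π * h π = g ⊥ := by
  have h1 := IncidenceAlgebra.moebius_inversion_top (𝕜 := ℂ) g h (fun σ => by
    rw [H σ]; refine Finset.sum_congr ?_ fun _ _ => rfl
    ext; simp) ⊥
  rw [h1, Finset.Ici_bot]
  exact Finset.sum_congr rfl fun π _ => by rw [partitionMoebius_eq_mu]

theorem comap_le_comap_iff {V W : Type} {f : V → W} (hf : Function.Surjective f)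
    (ρ ρ' : Setoid W) : Setoid.comap f ρ ≤ Setoid.comap f ρ' ↔ ρ ≤ ρ' := by
  constructor
  · intro h x y hxy
    obtain ⟨v, rfl⟩ := hf x
    obtain ⟨v', rfl⟩ := hf y
    exact @h v v' hxy
  · intro h x y hxy
    exact h hxy

theorem exists_comap_eq {V W : Type} {f : V → W} (hf : Function.Surjective f)
    {σ : Setoid V} (hσ : Setoid.ker f ≤ σ) : ∃ ρ : Setoid W, Setoid.comap f ρ = σ := by
  refine ⟨Setoid.mapOfSurjective σ f hσ hf, ?_⟩
  ext x y
  constructor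
  · rintro ⟨a, b, h, ha, hb⟩
    exact σ.trans (σ.trans (hσ ha.symm) h) (hσ hb)
  · intro h
    exact ⟨x, y, h, rfl, rfl⟩

/-- `Setoid.comap f` identifies the partitions of `W` with the partitions of `V` above `Setoid.ker
f`, an upper set. Quotients of quotients can thus be indexed by partitions of the original vertex
set. -/
theorem partitionMoebius_eq_mu_ker {V W : Type} [Finite V] [Finite W] {f : V → W}
    (hf : Function.Surjective f) (ρ : Setoid W) :
    partitionMoebius W ρ = IncidenceAlgebra.mu ℂ (Setoid.ker f) (Setoid.comap f ρ) := by
  have hker : Setoid.ker f = Setoid.comap f ⊥ := by ext; rfl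
  rw [partitionMoebius_eq_mu, hker]
  refine (mu_apply_of_upper_embedding (Setoid.comap f) (comap_le_comap_iff hf) ?_ _ _).symm
  intro a y h
  refine exists_comap_eq hf (le_trans ?_ h)
  intro x y hxy
  rw [Setoid.ker_def] at hxy
  rw [Setoid.comap_rel, hxy]

/-- The `*`-graph with all exponents equal to `1`. -/
def plainGraph {A : Type u} {V E : Type} [Finite V] [Finite E] (s t : E → V) (l : E → A) :
    StarGraph A where
  V := V
  E := E
  finV := inferInstance
  finE := inferInstance
  src := s
  tgt := t
  lab := l
  adj := fun _ => false

/-! ### Connected components of multigraphs -/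

section Components

variable {V W E F : Type}

/-- The connected components of a graph (isolated vertices included). -/
def GComp (s t : E → V) : Type := Quot fun v w => ∃ e, s e = v ∧ t e = w

def GComp.mk (s t : E → V) (v : V) : GComp s t := Quot.mk _ v

theorem GComp.sound (s t : E → V) (e : E) : GComp.mk s t (s e) = GComp.mk s t (t e) :=
  Quot.sound ⟨e, rfl, rfl⟩

theorem GComp.mk_surjective (s t : E → V) : Function.Surjective (GComp.mk s t) :=
  Quot.mk_surjective

def GComp.lift {s t : E → V} (f : V → W) (h : ∀ e, f (s e) = f (t e)) : GComp s t → W :=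
  Quot.lift f (by rintro _ _ ⟨e, rfl, rfl⟩; exact h e)

@[simp] theorem GComp.lift_mk {s t : E → V} (f : V → W) (h : ∀ e, f (s e) = f (t e)) (v : V) :
    GComp.lift f h (GComp.mk s t v) = f v := rfl

/-- The induction principle for components. `f` may be proposition-valued, or a map to the
components of another graph. -/
theorem GComp.eq_of_mk_eq {s t : E → V} {v v' : V} (hv : GComp.mk s t v = GComp.mk s t v')
    (f : V → W) (h : ∀ e, f (s e) = f (t e)) : f v = f v' :=
  congrArg (GComp.lift f h) hv

instance [Finite V] (s t : E → V) : Finite (GComp s t) :=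
  Finite.of_surjective _ (GComp.mk_surjective s t)

instance [Finite V] (s t : E → V) : Fintype (GComp s t) := Fintype.ofFinite _

/-- The graph is connected and has a vertex. -/
def GConn (s t : E → V) : Prop := Nonempty V ∧ ∀ v w, GComp.mk s t v = GComp.mk s t w

theorem GConn.map {s t : E → V} (h : GConn s t) {f : V → W} (hf : Function.Surjective f) :
    GConn (f ∘ s) (f ∘ t) := by
  refine ⟨h.1.map f, fun x y => ?_⟩
  obtain ⟨v, rfl⟩ := hf x
  obtain ⟨v', rfl⟩ := hf y
  exact GComp.eq_of_mk_eq (h.2 v v') (fun v => GComp.mk (f ∘ s) (f ∘ t) (f v))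
    fun e => GComp.sound (f ∘ s) (f ∘ t) e

theorem GConn.comp_equiv {s t : E → V} (h : GConn s t) (φ : F ≃ E) : GConn (s ∘ φ) (t ∘ φ) := by
  refine ⟨h.1, fun x y => GComp.eq_of_mk_eq (h.2 x y) (GComp.mk (s ∘ φ) (t ∘ φ)) fun e => ?_⟩
  have := GComp.sound (s ∘ φ) (t ∘ φ) (φ.symm e)
  simpa using this

theorem GConn.const {s t : E → V} (h : GConn s t) (f : V → W) (hf : ∀ e, f (s e) = f (t e))
    (v v' : V) : f v = f v' := GComp.eq_of_mk_eq (h.2 v v') f hf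

theorem connected_iff_gconn {J : Type u} (T : StarGraph J) :
    T.Connected ↔ GConn T.src T.tgt := by
  unfold StarGraph.Connected
  rw [SimpleGraph.connected_iff]
  set G := SimpleGraph.fromRel fun v w : T.V => ∃ e, T.src e = v ∧ T.tgt e = w
  constructor
  · rintro ⟨h1, h2⟩
    refine ⟨h2, fun v w => ?_⟩
    obtain ⟨p⟩ := h1 v w
    induction p with
    | nil => rfl
    | cons hadj _ ih =>
      rw [← ih]
      rw [SimpleGraph.fromRel_adj] at hadj
      rcases hadj.2 with ⟨e, rfl, rfl⟩ | ⟨e, rfl, rfl⟩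
      · exact GComp.sound _ _ e
      · exact (GComp.sound _ _ e).symm
  · rintro ⟨h1, h2⟩
    refine ⟨fun v w => ?_, h1⟩
    have key := GComp.eq_of_mk_eq (h2 v w) (fun x => G.Reachable v x) (fun e => by
      by_cases he : T.src e = T.tgt e
      · rw [he]
      · have hadj : G.Adj (T.src e) (T.tgt e) := by
          rw [SimpleGraph.fromRel_adj]
          exact ⟨he, Or.inl ⟨e, rfl, rfl⟩⟩
        exact propext ⟨fun h => h.trans hadj.reachable, fun h => h.trans hadj.symm.reachable⟩)
    exact key.mp (SimpleGraph.Reachable.refl v)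

instance [Finite V] (σ : Setoid V) : Finite (Quotient σ) := Quotient.finite σ

def qmk (σ : Setoid V) : V → Quotient σ := Quotient.mk σ

theorem qmk_surjective (σ : Setoid V) : Function.Surjective (qmk σ) := Quotient.mk_surjective

theorem qmk_eq_iff {σ : Setoid V} {v w : V} : qmk σ v = qmk σ w ↔ σ v w := Quotient.eq

theorem ker_qmk (σ : Setoid V) : Setoid.ker (qmk σ) = σ := by
  ext v w; exact qmk_eq_iff

end Components

/-! ### The traffic state and its injective version on graphs without exponents -/

section PlainStates

variable {A : Type u} [Ring A] [StarRing A] [Algebra ℂ A] [StarModule ℂ A] (S : TrafficSpace A)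
variable {V W W' E F : Type} [Finite V] [Finite W] [Finite W'] [Finite E] [Finite F]

/-- All exponents are `1`; nothing is lost, since `tau_eq_of_connected` absorbs them in the labels.
Taking a quotient is then just composing `s` and `t` with a map. -/
def tau (s t : E → V) (l : E → A) : ℂ := S.τ (plainGraph s t l)

def tau0 (s t : E → V) (l : E → A) : ℂ := S.τ₀ (plainGraph s t l)

theorem tau0_def (s t : E → V) (l : E → A) :
    tau0 S s t l = ∑ π, partitionMoebius V π * tau S (qmk π ∘ s) (qmk π ∘ t) l :=
  finsum_eq_sum_of_fintype _

theorem tau_iso {s t : E → V} {l : E → A} (h : GConn s t) {s' t' : F → W} {l' : F → A}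
    (f : V ≃ W) (φ : E ≃ F) (hs : ∀ e, s' (φ e) = f (s e)) (ht : ∀ e, t' (φ e) = f (t e))
    (hl : ∀ e, l' (φ e) = l e) : tau S s t l = tau S s' t' l' :=
  S.τ_iso _ _ ((connected_iff_gconn _).2 h) ⟨f, φ, fun e => ⟨hs e, ht e, hl e, rfl⟩⟩

theorem tau_comp_equiv {s t : E → V} {l : E → A} (h : GConn s t) (φ : F ≃ E) :
    tau S (s ∘ φ) (t ∘ φ) (l ∘ φ) = tau S s t l :=
  (tau_iso S h (Equiv.refl V) φ.symm (by simp) (by simp) (by simp)).symm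

/-- Quotients occur in many guises (iterated quotients, fibres, explicit sums of types). Up to
isomorphism, only the kernel of the vertex map matters. -/
theorem tau_surj_congr {s t : E → V} {l : E → A} (h : GConn s t) {f : V → W} {f' : V → W'}
    (hf : Function.Surjective f) (hf' : Function.Surjective f')
    (hff' : ∀ v w, f v = f w ↔ f' v = f' w) :
    tau S (f ∘ s) (f ∘ t) l = tau S (f' ∘ s) (f' ∘ t) l := by
  have key : ∀ v, f' (Function.surjInv hf (f v)) = f' v := fun v =>
    (hff' _ _).1 (Function.surjInv_eq hf (f v))
  have hbij : Function.Bijective fun x => f' (Function.surjInv hf x) := by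
    constructor
    · intro x y hxy
      have := (hff' _ _).2 hxy
      rwa [Function.surjInv_eq hf, Function.surjInv_eq hf] at this
    · intro y
      obtain ⟨v, rfl⟩ := hf' y
      exact ⟨f v, key v⟩
  exact tau_iso S (h.map hf) (Equiv.ofBijective _ hbij) (Equiv.refl E) (fun e => (key _).symm)
    (fun e => (key _).symm) fun e => rfl

/-- Pulling partitions of `W` back to `V` expresses the injective traces of all quotients by means
of one fixed lattice. -/
theorem tau0_surj {s t : E → V} {l : E → A} (h : GConn s t) {f : V → W}
    (hf : Function.Surjective f) :
    tau0 S (f ∘ s) (f ∘ t) l = ∑ σ with Setoid.ker f ≤ σ,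
      IncidenceAlgebra.mu ℂ (Setoid.ker f) σ * tau S (qmk σ ∘ s) (qmk σ ∘ t) l := by
  rw [tau0_def]
  refine Finset.sum_bij (fun ρ _ => Setoid.comap f ρ) ?_ ?_ ?_ ?_
  · intro ρ _
    simp only [Finset.mem_filter, Finset.mem_univ, true_and]
    intro x y hxy
    rw [Setoid.ker_def] at hxy
    rw [Setoid.comap_rel, hxy]
  · intro ρ _ ρ' _ hρ
    exact le_antisymm ((comap_le_comap_iff hf _ _).1 hρ.le) ((comap_le_comap_iff hf _ _).1 hρ.ge)
  · intro σ hσ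
    simp only [Finset.mem_filter, Finset.mem_univ, true_and] at hσ
    obtain ⟨ρ, hρ⟩ := exists_comap_eq hf hσ
    exact ⟨ρ, Finset.mem_univ _, hρ⟩
  · intro ρ _
    rw [partitionMoebius_eq_mu_ker hf]
    congr 1
    refine tau_surj_congr S h (f := qmk ρ ∘ f) ((qmk_surjective ρ).comp hf) (qmk_surjective _) ?_
    intro v w
    rw [qmk_eq_iff, Function.comp, Function.comp, qmk_eq_iff]
    exact Iff.rfl

theorem tau0_surj_congr {s t : E → V} {l : E → A} (h : GConn s t) {f : V → W} {f' : V → W'}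
    (hf : Function.Surjective f) (hf' : Function.Surjective f')
    (hff' : ∀ v w, f v = f w ↔ f' v = f' w) :
    tau0 S (f ∘ s) (f ∘ t) l = tau0 S (f' ∘ s) (f' ∘ t) l := by
  rw [tau0_surj S h hf, tau0_surj S h hf']
  have : Setoid.ker f = Setoid.ker f' := by ext v w; exact hff' v w
  rw [this]

theorem tau0_comp_equiv {s t : E → V} {l : E → A} (h : GConn s t) (φ : F ≃ E) :
    tau0 S (s ∘ φ) (t ∘ φ) (l ∘ φ) = tau0 S s t l := by
  rw [tau0_def, tau0_def]
  refine Finset.sum_congr rfl fun π _ => ?_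
  congr 1
  exact tau_comp_equiv S (h.map (qmk_surjective π)) φ

theorem tau0_iso {s t : E → V} {l : E → A} (h : GConn s t) {s' t' : F → W} {l' : F → A}
    (f : V ≃ W) (φ : E ≃ F) (hs : ∀ e, s' (φ e) = f (s e)) (ht : ∀ e, t' (φ e) = f (t e))
    (hl : ∀ e, l' (φ e) = l e) : tau0 S s t l = tau0 S s' t' l' := by
  have h1 : tau0 S (id ∘ s) (id ∘ t) l = tau0 S (f ∘ s) (f ∘ t) l :=
    tau0_surj_congr S h Function.surjective_id f.surjective fun v w => by simp
  have h2 : tau0 S (s' ∘ φ) (t' ∘ φ) (l' ∘ φ) = tau0 S s' t' l' := by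
    refine tau0_comp_equiv S ?_ φ
    have := (h.map f.surjective).comp_equiv φ.symm
    convert this using 1 <;> funext e <;> simp [← hs, ← ht]
  rw [← h2]
  change tau0 S s t l = _ at h1
  rw [h1]
  congr 1
  · funext e; exact (hs e).symm
  · funext e; exact (ht e).symm
  · funext e; exact (hl e).symm

/-- The traffic state is the sum of its injective version over quotients. -/
theorem tau_surj_eq_sum {s t : E → V} {l : E → A} (h : GConn s t) {f : V → W}
    (hf : Function.Surjective f) :
    tau S (f ∘ s) (f ∘ t) l =
      ∑ σ with Setoid.ker f ≤ σ, tau0 S (qmk σ ∘ s) (qmk σ ∘ t) l := by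
  have h1 : ∀ σ : Setoid V, tau0 S (qmk σ ∘ s) (qmk σ ∘ t) l = ∑ π with σ ≤ π,
      IncidenceAlgebra.mu ℂ σ π * tau S (qmk π ∘ s) (qmk π ∘ t) l := by
    intro σ
    rw [tau0_surj S h (qmk_surjective σ), ker_qmk]
  simp_rw [h1]
  -- After the exchange, the coefficient of `π` is the sum of `μ(σ, π)` over the interval from
  -- `Setoid.ker f` to `π`, which vanishes unless this interval is a point.
  rw [Finset.sum_comm' (t' := Finset.univ.filter fun π => Setoid.ker f ≤ π)
    (s' := fun π => Finset.Icc (Setoid.ker f) π)]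
  · simp_rw [← Finset.sum_mul, IncidenceAlgebra.sum_Icc_mu_left]
    rw [Finset.sum_eq_single (Setoid.ker f)]
    · simp only [if_true, one_mul]
      refine tau_surj_congr S h hf (qmk_surjective _) fun v w => ?_
      rw [qmk_eq_iff, Setoid.ker_def]
    · intro π _ hne
      rw [if_neg (Ne.symm hne), zero_mul]
    · intro hn
      simp at hn
  · intro σ π
    simp only [Finset.mem_filter, Finset.mem_univ, true_and, Finset.mem_Icc]
    exact ⟨fun ⟨a, b⟩ => ⟨⟨a, b⟩, a.trans b⟩, fun ⟨⟨a, b⟩, _⟩ => ⟨a, b⟩⟩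

end PlainStates


/-! ### Substitution, products and linearity on labelled graphs -/

section Substitution

variable {A : Type u} [Ring A] [StarRing A] [Algebra ℂ A] [StarModule ℂ A] (S : TrafficSpace A)

theorem gconn_path (n : ℕ) : GConn (Fin.castSucc : Fin n → Fin (n + 1)) Fin.succ := by
  have h : ∀ i : Fin (n + 1), GComp.mk (Fin.castSucc : Fin n → Fin (n + 1)) Fin.succ i =
      GComp.mk _ _ 0 := by
    intro i
    induction i using Fin.induction with
    | zero => rfl
    | succ i ih => rw [← ih]; exact (GComp.sound _ _ i).symm
  exact ⟨⟨0⟩, fun v w => (h v).trans (h w).symm⟩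

theorem path_connected {J : Type u} (l : List (J × Bool)) : (BiGraph.path l).Connected :=
  (connected_iff_gconn _).2 (gconn_path l.length)

theorem isomorphic_close {J : Type u} (t : BiGraph J) (h : t.inp = t.out) :
    t.toStarGraph.Isomorphic t.close := by
  refine ⟨⟨Quot.mk _, Quot.lift id ?_, fun v => rfl, ?_⟩, Equiv.refl _, fun e => ⟨rfl, rfl, rfl, rfl⟩⟩
  · rintro _ _ ⟨rfl, rfl⟩; exact h
  · rintro ⟨v⟩; rfl

/-- When input and output coincide, closing the monomial glues nothing. Rooting a connected graph
twice at the same vertex thus transfers the axioms on `eval` to `τ`. -/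
theorem Phi_eval_eq_tau (t : BiGraph A) (ht : t.Connected) (h : t.inp = t.out) :
    S.Φ (S.eval t) = S.τ t.toStarGraph := by
  rw [S.state t ht]
  exact (S.τ_iso _ _ ht (isomorphic_close t h)).symm

theorem StarGraph.Isomorphic.connected {J : Type u} {T T' : StarGraph J} (h : T.Isomorphic T')
    (hT : T.Connected) : T'.Connected := by
  rw [connected_iff_gconn] at hT ⊢
  obtain ⟨f, φ, H⟩ := h
  have := (hT.map f.surjective).comp_equiv φ.symm
  convert this using 1 <;> funext e
  · simp [← (H _).1]
  · simp [← (H _).2.1]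

theorem StarGraph.Isomorphic.symm {J : Type u} {T T' : StarGraph J} (h : T.Isomorphic T') :
    T'.Isomorphic T := by
  obtain ⟨f, φ, H⟩ := h
  refine ⟨f.symm, φ.symm, fun e => ?_⟩
  have := H (φ.symm e)
  simp only [Equiv.apply_symm_apply] at this
  exact ⟨by rw [this.1, Equiv.symm_apply_apply], by rw [this.2.1, Equiv.symm_apply_apply],
    this.2.2.1.symm, this.2.2.2.symm⟩

/-- The graph obtained by drawing, for each `e`, a path labelled by the word `w e` through the
vertices `g e 0, g e 1, …`. -/
def pathsGraph {A : Type u} {V E : Type} [Finite V] [Finite E] (w : E → List (A × Bool))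
    (g : ∀ e, Fin ((w e).length + 1) → V) : StarGraph A where
  V := V
  E := Σ e, Fin (w e).length
  finV := inferInstance
  finE := inferInstance
  src := fun p => g p.1 p.2.castSucc
  tgt := fun p => g p.1 p.2.succ
  lab := fun p => ((w p.1).get p.2).1
  adj := fun p => ((w p.1).get p.2).2

/-- A graph whose labels are words has the same trace as the graph where each edge is replaced by
the path of the letters. -/
theorem tau_eq_pathsGraph {V E V' : Type} [Finite V] [Finite E] [Finite V'] {s t : E → V}
    (h : GConn s t) (w : E → List (A × Bool)) (f : V → V')
    (g : ∀ e, Fin ((w e).length + 1) → V') (hg0 : ∀ e, g e 0 = f (s e))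
    (hg1 : ∀ e, g e (Fin.last _) = f (t e))
    (hsurj : ∀ x, (∃ v, f v = x) ∨ ∃ e i, g e i = x)
    (huniv : ∀ (Z : Type) (a : V → Z) (b : ∀ e, Fin ((w e).length + 1) → Z),
      (∀ e, b e 0 = a (s e)) → (∀ e, b e (Fin.last _) = a (t e)) →
      ∃ k : V' → Z, (∀ v, k (f v) = a v) ∧ ∀ e i, k (g e i) = b e i) :
    tau S s t (fun e => ((w e).map fun p => starPow p.1 p.2).prod) =
      S.τ (pathsGraph w g) := by
  obtain ⟨v0⟩ := h.1
  -- The labels `0` are placeholders, overwritten by `relabel` and `subst`.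
  let t0 : BiGraph A := ⟨plainGraph s t (fun _ => 0), v0, v0⟩
  let r : t0.E → BiGraph A := fun e => BiGraph.path (w e)
  have hc0 : t0.Connected := (connected_iff_gconn _).2 h
  have h1 : S.Φ (S.eval (t0.relabel fun e => S.eval (r e))) =
      tau S s t (fun e => ((w e).map fun p => starPow p.1 p.2).prod) := by
    rw [Phi_eval_eq_tau S _ (by exact hc0) rfl]
    have : (fun e => S.eval (r e)) = (fun e => ((w e).map fun p => starPow p.1 p.2).prod) := by
      funext e; exact S.compatibility _
    rw [this]; rfl
  -- The hypothesis `huniv` says that `V'` is the pushout gluing the ends of the paths to the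
  -- vertices. It supplies the inverse of the canonical map from the vertices of the substituted
  -- graph.
  obtain ⟨k, hk1, hk2⟩ := huniv (t0.subst r).V (fun v => Quot.mk _ (Sum.inl v))
    (fun e i => Quot.mk _ (Sum.inr ⟨e, i⟩))
    (fun e => (Quot.sound ⟨e, Or.inl ⟨rfl, rfl⟩⟩ : _).symm)
    (fun e => (Quot.sound ⟨e, Or.inr ⟨rfl, rfl⟩⟩ : _).symm)
  have hiso : (t0.subst r).toStarGraph.Isomorphic (pathsGraph w g) := by
    refine ⟨⟨Quot.lift (Sum.elim f fun p => g p.1 p.2) ?_, k, ?_, ?_⟩, Equiv.refl _,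
      fun e => ⟨rfl, rfl, rfl, rfl⟩⟩
    · rintro _ _ ⟨e, ⟨rfl, rfl⟩ | ⟨rfl, rfl⟩⟩
      · exact (hg0 e).symm
      · exact (hg1 e).symm
    · rintro ⟨v | ⟨e, i⟩⟩
      · exact hk1 v
      · exact hk2 e i
    · intro x
      rcases hsurj x with ⟨v, rfl⟩ | ⟨e, i, rfl⟩
      · rw [hk1]; rfl
      · rw [hk2]; rfl
  have hconn : (pathsGraph w g).Connected := by
    rw [connected_iff_gconn]
    let s' : (Σ e, Fin (w e).length) → V' := fun p => g p.1 p.2.castSucc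
    let t' : (Σ e, Fin (w e).length) → V' := fun p => g p.1 p.2.succ
    change GConn s' t'
    have hpath : ∀ e i, GComp.mk s' t' (g e i) = GComp.mk s' t' (f (s e)) := by
      intro e i
      rw [← hg0]
      induction i using Fin.induction with
      | zero => rfl
      | succ i ih => rw [← ih]; exact (GComp.sound s' t' ⟨e, i⟩).symm
    have hf : ∀ v, GComp.mk s' t' (f v) = GComp.mk s' t' (f v0) := by
      intro v
      refine h.const (fun v => GComp.mk s' t' (f v)) (fun e => ?_) _ _
      rw [← hg1 e, hpath e]
    have hall : ∀ x, GComp.mk s' t' x = GComp.mk s' t' (f v0) := by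
      intro x
      rcases hsurj x with ⟨v, rfl⟩ | ⟨e, i, rfl⟩
      · exact hf v
      · rw [hpath e i, hf]
    exact ⟨⟨f v0⟩, fun v w => (hall v).trans (hall w).symm⟩
  rw [← h1, S.associativity t0 r hc0 fun e => path_connected _,
    Phi_eval_eq_tau S _ (hiso.symm.connected hconn) rfl]
  exact (S.τ_iso _ _ hconn hiso.symm).symm

/-- Exponents can be moved to the labels. -/
theorem tau_eq_of_connected (T : StarGraph A) (hT : T.Connected) :
    S.τ T = tau S T.src T.tgt (fun e => starPow (T.lab e) (T.adj e)) := by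
  have hc := (connected_iff_gconn _).1 hT
  have h1 := tau_eq_pathsGraph S hc (fun e => [(T.lab e, T.adj e)]) id
    (fun e => Fin.cases (T.src e) fun _ => T.tgt e) (fun e => rfl) (fun e => rfl)
    (fun x => Or.inl ⟨x, rfl⟩) (by
      intro Z a b h0 h1
      refine ⟨a, fun v => rfl, fun e i => ?_⟩
      induction i using Fin.cases with
      | zero => exact (h0 e).symm
      | succ i =>
        have : i.succ = Fin.last _ := by
          have := i.2
          simp only [List.length_cons, List.length_nil] at this
          ext; simp
        rw [this]
        exact (h1 e).symm)
  simp only [List.map_cons, List.map_nil, List.prod_cons, List.prod_nil, mul_one] at h1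
  rw [h1]
  let φ : T.E ≃ Σ e : T.E, Fin [(T.lab e, T.adj e)].length :=
    ⟨fun e => ⟨e, (0 : Fin 1)⟩, fun p => p.1, fun e => rfl, by
      rintro ⟨e, i⟩
      have : i = (0 : Fin 1) := Subsingleton.elim (α := Fin 1) _ _
      rw [this]⟩
  exact S.τ_iso _ _ hT ⟨Equiv.refl _, φ, fun e => ⟨rfl, rfl, rfl, rfl⟩⟩

variable {V V' V'' W E P E' F : Type} [Finite V] [Finite V'] [Finite V''] [Finite W] [Finite E]
  [Finite P] [Finite E'] [Finite F]

/-- Associativity for paths of two edges: each edge indexed by `P` acquires a middle vertex, again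
indexed by `P`. -/
theorem tau_split {sP tP : P → V} {s t : E → V} (x y : P → A) (l : E → A)
    (h : GConn (Sum.elim sP s) (Sum.elim tP t)) :
    tau S (Sum.elim sP s) (Sum.elim tP t) (Sum.elim (fun p => x p * y p) l) =
      tau S (Sum.elim (Sum.inl ∘ sP) (Sum.elim Sum.inr (Sum.inl ∘ s)) : P ⊕ (P ⊕ E) → V ⊕ P)
        (Sum.elim Sum.inr (Sum.elim (Sum.inl ∘ tP) (Sum.inl ∘ t)))
        (Sum.elim x (Sum.elim y l)) := by
  let w : P ⊕ E → List (A × Bool) :=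
    Sum.elim (fun p => [(x p, false), (y p, false)]) (fun e => [(l e, false)])
  let g : ∀ e, Fin ((w e).length + 1) → V ⊕ P := fun e => match e with
    | Sum.inl p => (![Sum.inl (sP p), Sum.inr p, Sum.inl (tP p)] : Fin 3 → V ⊕ P)
    | Sum.inr e => (![Sum.inl (s e), Sum.inl (t e)] : Fin 2 → V ⊕ P)
  have h1 := tau_eq_pathsGraph S h w Sum.inl g (by rintro (p | e) <;> rfl)
    (by rintro (p | e) <;> rfl)
    (by
      rintro (v | p)
      · exact Or.inl ⟨v, rfl⟩
      · exact Or.inr ⟨Sum.inl p, (1 : Fin 3), rfl⟩)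
    (by
      intro Z a b h0 h1
      refine ⟨Sum.elim a fun p => b (Sum.inl p) (1 : Fin 3), fun v => rfl, ?_⟩
      rintro (p | e) i
      · change Fin 3 at i
        fin_cases i
        · exact (h0 (Sum.inl p)).symm
        · rfl
        · exact (h1 (Sum.inl p)).symm
      · change Fin 2 at i
        fin_cases i
        · exact (h0 (Sum.inr e)).symm
        · exact (h1 (Sum.inr e)).symm)
  have h2 : (fun e => ((w e).map fun p => starPow p.1 p.2).prod) =
      Sum.elim (fun p => x p * y p) l := by
    funext e
    rcases e with p | e <;> simp [w, starPow]
  rw [h2] at h1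
  rw [h1]
  have hc : GConn (Sum.elim (Sum.inl ∘ sP) (Sum.elim Sum.inr (Sum.inl ∘ s)) : P ⊕ (P ⊕ E) → V ⊕ P)
      (Sum.elim Sum.inr (Sum.elim (Sum.inl ∘ tP) (Sum.inl ∘ t))) := by
    obtain ⟨v0⟩ := h.1
    set s' := (Sum.elim (Sum.inl ∘ sP) (Sum.elim Sum.inr (Sum.inl ∘ s)) : P ⊕ (P ⊕ E) → V ⊕ P)
    set t' := (Sum.elim Sum.inr (Sum.elim (Sum.inl ∘ tP) (Sum.inl ∘ t)) : P ⊕ (P ⊕ E) → V ⊕ P)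
    have hV : ∀ v, GComp.mk s' t' (Sum.inl v) = GComp.mk s' t' (Sum.inl v0) := by
      intro v
      refine h.const (fun v => GComp.mk s' t' (Sum.inl v)) ?_ v v0
      rintro (p | e)
      · exact (GComp.sound s' t' (Sum.inl p)).trans (GComp.sound s' t' (Sum.inr (Sum.inl p)))
      · exact GComp.sound s' t' (Sum.inr (Sum.inr e))
    have hall : ∀ z, GComp.mk s' t' z = GComp.mk s' t' (Sum.inl v0) := by
      rintro (v | p)
      · exact hV v
      · exact (GComp.sound s' t' (Sum.inl p)).symm.trans (hV _)
    exact ⟨⟨Sum.inl v0⟩, fun a b => (hall a).trans (hall b).symm⟩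
  symm
  let F : P ⊕ (P ⊕ E) → Σ e, Fin (w e).length := Sum.elim
    (fun p => ⟨Sum.inl p, (0 : Fin 2)⟩) (Sum.elim (fun p => ⟨Sum.inl p, (1 : Fin 2)⟩)
      (fun e => ⟨Sum.inr e, (0 : Fin 1)⟩))
  have hF : Function.Bijective F := by
    constructor
    · rintro (p | p | e) (p' | p' | e') h <;> cases h <;> rfl
    · rintro ⟨p | e, i⟩
      · change Fin 2 at i
        rcases Fin.exists_fin_two.1 ⟨i, rfl⟩ with h | h
        · exact ⟨Sum.inl p, by subst h; rfl⟩
        · exact ⟨Sum.inr (Sum.inl p), by subst h; rfl⟩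
      · change Fin 1 at i
        obtain rfl : i = (0 : Fin 1) := Subsingleton.elim _ _
        exact ⟨Sum.inr (Sum.inr e), rfl⟩
  refine S.τ_iso _ _ ((connected_iff_gconn _).2 hc) ⟨Equiv.refl _, Equiv.ofBijective F hF, ?_⟩
  rintro (p | p | e) <;> exact ⟨rfl, rfl, rfl, rfl⟩

/-- `Refines S f G G'`: all the quotients of the graph `G` have the same trace as the
corresponding quotients of `G'`, where `f` maps the vertices of `G` to those of `G'`. -/
def Refines (f : V → V') (s t : E → V) (l : E → A) (s' t' : E' → V') (l' : E' → A) : Prop :=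
  ∀ σ : Setoid V, ∃ (W : Type) (_ : Finite W) (g : V' → W), Function.Surjective g ∧
    (∀ ρ : Setoid V', Setoid.ker g ≤ ρ ↔ σ ≤ Setoid.comap f ρ) ∧
    tau S (qmk σ ∘ s) (qmk σ ∘ t) l = tau S (g ∘ s') (g ∘ t') l'

variable {S}

theorem Refines.comp {f : V → V'} {f' : V' → V''} {s t : E → V} {l : E → A} {s' t' : E' → V'}
    {l' : E' → A} {s'' t'' : F → V''} {l'' : F → A} (h' : GConn s' t')
    (H : Refines S f s t l s' t' l') (H' : Refines S f' s' t' l' s'' t'' l'') :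
    Refines S (f' ∘ f) s t l s'' t'' l'' := by
  intro σ
  obtain ⟨W, _, g, hg, hk, ht⟩ := H σ
  obtain ⟨W', _, g', hg', hk', ht'⟩ := H' (Setoid.ker g)
  refine ⟨W', inferInstance, g', hg', fun ρ => ?_, ?_⟩
  · rw [hk', hk]; exact Iff.rfl
  · rw [ht, ← ht']
    exact tau_surj_congr S h' hg (qmk_surjective _) fun v w => by rw [qmk_eq_iff, Setoid.ker_def]

theorem Refines.comp_equiv {f : V → V'} {s t : E → V} {l : E → A} {s' t' : E' → V'}
    {l' : E' → A} (h : GConn s t) (h' : GConn s' t')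
    (H : Refines S f s t l s' t' l') (φ : P ≃ E) (φ' : F ≃ E') :
    Refines S f (s ∘ φ) (t ∘ φ) (l ∘ φ) (s' ∘ φ') (t' ∘ φ') (l' ∘ φ') := by
  intro σ
  obtain ⟨W, _, g, hg, hk, ht⟩ := H σ
  refine ⟨W, inferInstance, g, hg, hk, ?_⟩
  rw [← Function.comp_assoc, ← Function.comp_assoc, ← Function.comp_assoc, ← Function.comp_assoc,
    tau_comp_equiv S (h.map (qmk_surjective σ)), tau_comp_equiv S (h'.map hg), ht]

/-- Group the partitions `ρ` of `V'` by their restriction `Setoid.comap f ρ` to `V`. Both sides then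
have the same sums over coarser partitions, and Möbius inversion at `⊥` selects the `ρ` that keep
the vertices coming from `V` distinct. -/
theorem Refines.tau0_eq {f : V → V'} {s t : E → V} {l : E → A} {s' t' : E' → V'}
    {l' : E' → A} (h' : GConn s' t') (H : Refines S f s t l s' t' l') :
    tau0 S s t l = ∑ ρ with Setoid.comap f ρ = ⊥, tau0 S (qmk ρ ∘ s') (qmk ρ ∘ t') l' := by
  rw [tau0_def]
  refine sum_partitionMoebius_mul (fun σ => tau S (qmk σ ∘ s) (qmk σ ∘ t) l)
    (fun σ => ∑ ρ with Setoid.comap f ρ = σ, tau0 S (qmk ρ ∘ s') (qmk ρ ∘ t') l') fun σ => ?_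
  obtain ⟨W, _, g, hg, hk, ht⟩ := H σ
  rw [ht, tau_surj_eq_sum S h' hg]
  rw [← Finset.sum_fiberwise_of_maps_to (s := Finset.univ.filter fun ρ => Setoid.ker g ≤ ρ)
    (t := Finset.univ.filter fun π => σ ≤ π) (g := Setoid.comap f)]
  · refine Finset.sum_congr rfl fun π hπ => Finset.sum_congr ?_ fun _ _ => rfl
    ext ρ
    simp only [Finset.mem_filter, Finset.mem_univ, true_and] at hπ ⊢
    rw [hk]
    exact ⟨fun h => h.2, fun h => ⟨h ▸ hπ, h⟩⟩
  · intro ρ hρ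
    simp only [Finset.mem_filter, Finset.mem_univ, true_and] at hρ ⊢
    exact (hk ρ).1 hρ

variable (S)

theorem gconn_split {f : V → V'} {n : P → V'} (hfn : Function.Bijective (Sum.elim f n))
    {sP tP : P → V} {s t : E → V} (h : GConn (Sum.elim sP s) (Sum.elim tP t)) :
    GConn (Sum.elim (f ∘ sP) (Sum.elim n (f ∘ s))) (Sum.elim n (Sum.elim (f ∘ tP) (f ∘ t))) := by
  obtain ⟨v0⟩ := h.1
  set s' := (Sum.elim (f ∘ sP) (Sum.elim n (f ∘ s)))
  set t' := (Sum.elim n (Sum.elim (f ∘ tP) (f ∘ t)))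
  have hV : ∀ v, GComp.mk s' t' (f v) = GComp.mk s' t' (f v0) := by
    intro v
    refine h.const (fun v => GComp.mk s' t' (f v)) ?_ v v0
    rintro (p | e)
    · exact (GComp.sound s' t' (Sum.inl p)).trans (GComp.sound s' t' (Sum.inr (Sum.inl p)))
    · exact GComp.sound s' t' (Sum.inr (Sum.inr e))
  have hall : ∀ z, GComp.mk s' t' z = GComp.mk s' t' (f v0) := by
    intro z
    obtain ⟨z, rfl⟩ := hfn.2 z
    rcases z with v | p
    · exact hV v
    · exact (GComp.sound s' t' (Sum.inl p)).symm.trans (hV _)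
  exact ⟨⟨f v0⟩, fun a b => (hall a).trans (hall b).symm⟩

/-- Splitting commutes with gluing old vertices by `σ`: the new vertices are left alone. This is the
smallest gluing whose restriction to the old vertices contains `σ`, as `Refines` demands. -/
theorem refines_split {f : V → V'} {n : P → V'} (hfn : Function.Bijective (Sum.elim f n))
    {sP tP : P → V} {s t : E → V} (x y : P → A) (l : E → A)
    (h : GConn (Sum.elim sP s) (Sum.elim tP t)) :
    Refines S f (Sum.elim sP s) (Sum.elim tP t) (Sum.elim (fun p => x p * y p) l)
      (Sum.elim (f ∘ sP) (Sum.elim n (f ∘ s))) (Sum.elim n (Sum.elim (f ∘ tP) (f ∘ t)))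
      (Sum.elim x (Sum.elim y l)) := by
  intro σ
  let e := Equiv.ofBijective _ hfn
  have hef : ∀ v, e.symm (f v) = Sum.inl v := fun v => e.symm_apply_eq.2 rfl
  have hen : ∀ p, e.symm (n p) = Sum.inr p := fun v => e.symm_apply_eq.2 rfl
  refine ⟨Quotient σ ⊕ P, inferInstance, Sum.map (qmk σ) id ∘ e.symm, ?_, ?_, ?_⟩
  · exact (Function.Surjective.sumMap (qmk_surjective σ) Function.surjective_id).comp
      e.symm.surjective
  · intro ρ
    constructor
    · intro H v w hvw
      refine H ?_
      rw [Setoid.ker_def]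
      simp only [Function.comp, hef, Sum.map_inl]
      rw [qmk_eq_iff.2 hvw]
    · intro H a b hab
      obtain ⟨a, rfl⟩ := hfn.2 a
      obtain ⟨b, rfl⟩ := hfn.2 b
      rw [Setoid.ker_def] at hab
      rcases a with a | a <;> rcases b with b | b <;>
        simp only [Function.comp, Sum.elim_inl, Sum.elim_inr, hef, hen, Sum.map_inl, Sum.map_inr,
          Sum.inl.injEq, Sum.inr.injEq, reduceCtorEq, id] at hab
      · exact H (qmk_eq_iff.1 hab)
      · subst hab; exact ρ.refl _
  · have := tau_split S (sP := qmk σ ∘ sP) (tP := qmk σ ∘ tP) (s := qmk σ ∘ s) (t := qmk σ ∘ t) x y l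
      (by simpa only [Sum.comp_elim] using h.map (qmk_surjective σ))
    simp only [Sum.comp_elim]
    rw [this]
    congr 1 <;> funext z <;> rcases z with p | p | e <;>
      simp [hef, hen]

theorem tau_add {s t : E → V} (h : GConn s t) {l l₁ l₂ : E → A} (e : E) (hl : l e = l₁ e + l₂ e)
    (h₁ : ∀ e' ≠ e, l₁ e' = l e') (h₂ : ∀ e' ≠ e, l₂ e' = l e') :
    tau S s t l = tau S s t l₁ + tau S s t l₂ := by
  obtain ⟨v0⟩ := h.1
  have hc : (plainGraph s t l).Connected := (connected_iff_gconn _).2 h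
  have H := congrArg S.Φ (S.linearity_add ⟨plainGraph s t l, v0, v0⟩ e hc rfl (l₁ e) (l₂ e))
  rw [map_add, Phi_eval_eq_tau S _ (by exact hc) rfl, Phi_eval_eq_tau S _ (by exact hc) rfl,
    Phi_eval_eq_tau S _ (by exact hc) rfl] at H
  have e0 : Function.update l e (l₁ e + l₂ e) = l := by rw [← hl, Function.update_eq_self]
  have e1 : Function.update l e (l₁ e) = l₁ := by
    funext e'; by_cases he : e' = e
    · subst he; simp
    · simp [he, h₁ e' he]
  have e2 : Function.update l e (l₂ e) = l₂ := by
    funext e'; by_cases he : e' = e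
    · subst he; simp
    · simp [he, h₂ e' he]
  have H' : tau S s t (Function.update l e (l₁ e + l₂ e)) =
    tau S s t (Function.update l e (l₁ e)) + tau S s t (Function.update l e (l₂ e)) := H
  rwa [e0, e1, e2] at H'

theorem tau_smul {s t : E → V} (h : GConn s t) {l l₁ : E → A} (e : E) (z : ℂ)
    (hl : l e = z • l₁ e) (h₁ : ∀ e' ≠ e, l₁ e' = l e') :
    tau S s t l = z * tau S s t l₁ := by
  obtain ⟨v0⟩ := h.1
  have hc : (plainGraph s t l).Connected := (connected_iff_gconn _).2 h
  have H := congrArg S.Φ (S.linearity_smul ⟨plainGraph s t l, v0, v0⟩ e hc rfl z (l₁ e))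
  rw [map_smul, Phi_eval_eq_tau S _ (by exact hc) rfl, Phi_eval_eq_tau S _ (by exact hc) rfl] at H
  have e0 : Function.update l e (z • l₁ e) = l := by rw [← hl, Function.update_eq_self]
  have e1 : Function.update l e (l₁ e) = l₁ := by
    funext e'; by_cases he : e' = e
    · subst he; simp
    · simp [he, h₁ e' he]
  have H' : tau S s t (Function.update l e (z • l₁ e)) =
    z * tau S s t (Function.update l e (l₁ e)) := H
  rwa [e0, e1] at H'

end Substitution

/-! ### Counting connected components -/

section Counting

variable {V V' W E E₁ E₂ F Q : Type} [Finite V] [Finite V'] [Finite W] [Finite E] [Finite E₁]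
  [Finite E₂] [Finite F] [Fintype Q]

/-- Number of connected components. -/
def ccard (s t : E → V) : ℕ := Nat.card (GComp s t)

/-- The functions constant along the edges form a space of dimension the number of components. A
union of edge sets corresponds to an intersection of such spaces, so subadditivity of the rank
becomes the dimension formula for a sum and an intersection. -/
theorem ccard_eq_finrank (s t : E → V) : ccard s t =
    Module.finrank ℚ (LinearMap.range (LinearMap.funLeft ℚ ℚ (GComp.mk s t))) := by
  rw [LinearMap.finrank_range_of_inj (LinearMap.funLeft_injective_of_surjective ℚ ℚ _
    (GComp.mk_surjective s t)), Module.finrank_fintype_fun_eq_card, ccard, Nat.card_eq_fintype_card]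

theorem mem_range_funLeft_iff (s t : E → V) (f : V → ℚ) :
    f ∈ LinearMap.range (LinearMap.funLeft ℚ ℚ (GComp.mk s t)) ↔ ∀ e, f (s e) = f (t e) := by
  constructor
  · rintro ⟨g, rfl⟩ e
    simp only [LinearMap.funLeft_apply]
    rw [GComp.sound]
  · intro h
    exact ⟨GComp.lift f h, funext fun v => rfl⟩

/-- Subadditivity of the rank. -/
theorem ccard_add_le (s₁ t₁ : E₁ → V) (s₂ t₂ : E₂ → V) :
    ccard s₁ t₁ + ccard s₂ t₂ ≤ Nat.card V + ccard (Sum.elim s₁ s₂) (Sum.elim t₁ t₂) := by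
  have : Fintype V := Fintype.ofFinite V
  rw [ccard_eq_finrank, ccard_eq_finrank, ccard_eq_finrank, ← Submodule.finrank_sup_add_finrank_inf_eq]
  refine add_le_add ?_ ?_
  · refine (Submodule.finrank_le _).trans ?_
    rw [Module.finrank_fintype_fun_eq_card, Nat.card_eq_fintype_card]
  · refine le_of_eq (congrArg (fun U : Submodule ℚ (V → ℚ) => Module.finrank ℚ U) ?_)
    ext f
    rw [Submodule.mem_inf, mem_range_funLeft_iff, mem_range_funLeft_iff, mem_range_funLeft_iff]
    simp

theorem ccard_eq_one {s t : E → V} (h : GConn s t) : ccard s t = 1 := by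
  rw [ccard, Nat.card_eq_one_iff_unique]
  obtain ⟨v⟩ := h.1
  refine ⟨⟨fun x y => ?_⟩, ⟨GComp.mk s t v⟩⟩
  obtain ⟨x, rfl⟩ := GComp.mk_surjective s t x
  obtain ⟨y, rfl⟩ := GComp.mk_surjective s t y
  exact h.2 x y

theorem gconn_of_ccard {s t : E → V} (h : ccard s t = 1) : GConn s t := by
  rw [ccard, Nat.card_eq_one_iff_unique] at h
  obtain ⟨h1, ⟨x⟩⟩ := h
  obtain ⟨x, rfl⟩ := GComp.mk_surjective s t x
  exact ⟨⟨x⟩, fun v w => Subsingleton.elim _ _⟩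

/-- A surjection on vertices compatible with the edges. -/
def GComp.map {s t : E → V} {s' t' : F → W} (f : V → W)
    (h : ∀ e, GComp.mk s' t' (f (s e)) = GComp.mk s' t' (f (t e))) : GComp s t → GComp s' t' :=
  GComp.lift (fun v => GComp.mk s' t' (f v)) h

theorem GComp.map_surjective {s t : E → V} {s' t' : F → W} {f : V → W}
    (h : ∀ e, GComp.mk s' t' (f (s e)) = GComp.mk s' t' (f (t e)))
    (hf : ∀ w, ∃ v, GComp.mk s' t' (f v) = GComp.mk s' t' w) :
    Function.Surjective (GComp.map f h : GComp s t → GComp s' t') := by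
  intro k
  obtain ⟨w, rfl⟩ := GComp.mk_surjective s' t' k
  obtain ⟨v, hv⟩ := hf w
  exact ⟨GComp.mk s t v, hv⟩

def gcompEquiv {s t : E → V} {s' t' : F → W} (f : V ≃ W) (φ : E ≃ F)
    (hs : ∀ e, s' (φ e) = f (s e)) (ht : ∀ e, t' (φ e) = f (t e)) : GComp s t ≃ GComp s' t' where
  toFun := GComp.lift (fun v => GComp.mk s' t' (f v)) fun e => by
    rw [← hs, ← ht]; exact GComp.sound s' t' (φ e)
  invFun := GComp.lift (fun v => GComp.mk s t (f.symm v)) fun e => by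
    obtain ⟨e, rfl⟩ := φ.surjective e
    rw [hs, ht, Equiv.symm_apply_apply, Equiv.symm_apply_apply]
    exact GComp.sound s t e
  left_inv := by
    intro k
    obtain ⟨v, rfl⟩ := GComp.mk_surjective s t k
    simp
  right_inv := by
    intro k
    obtain ⟨v, rfl⟩ := GComp.mk_surjective s' t' k
    simp

theorem ccard_iso {s t : E → V} {s' t' : F → W} (f : V ≃ W) (φ : E ≃ F)
    (hs : ∀ e, s' (φ e) = f (s e)) (ht : ∀ e, t' (φ e) = f (t e)) : ccard s t = ccard s' t' :=
  Nat.card_congr (gcompEquiv f φ hs ht)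

/-- Sources of the edges of the subgraph over `q`. -/
def fibS (p : V → Q) (s : E → V) (q : Q) : {e // p (s e) = q} → {v // p v = q} :=
  fun e => ⟨s e.1, e.2⟩

/-- Targets of the edges of the subgraph over `q`. -/
def fibT (p : V → Q) (s t : E → V) (hp : ∀ e, p (s e) = p (t e)) (q : Q) :
    {e // p (s e) = q} → {v // p v = q} :=
  fun e => ⟨t e.1, (hp e.1).symm.trans e.2⟩

theorem sigma_mk_eq {s t : E → V} (p : V → Q) (hp : ∀ e, p (s e) = p (t e)) {q : Q} {v : V}
    (hv : p v = q) : (⟨p v, GComp.mk (fibS p s (p v)) (fibT p s t hp (p v)) ⟨v, rfl⟩⟩ :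
      Σ q, GComp (fibS p s q) (fibT p s t hp q)) = ⟨q, GComp.mk _ _ ⟨v, hv⟩⟩ := by
  subst hv; rfl

/-- Since `p` is constant along the edges, each component lies over a single point of `Q`.
Multiplicative and additive invariants can therefore be computed fibre by fibre. -/
def compFib {s t : E → V} (p : V → Q) (hp : ∀ e, p (s e) = p (t e)) :
    GComp s t ≃ Σ q, GComp (fibS p s q) (fibT p s t hp q) where
  toFun := GComp.lift (fun v => ⟨p v, GComp.mk _ _ ⟨v, rfl⟩⟩) fun e => by
    rw [sigma_mk_eq p hp (hp e).symm]
    exact congrArg (Sigma.mk (p (s e)))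
      (GComp.sound (fibS p s (p (s e))) (fibT p s t hp (p (s e))) ⟨e, rfl⟩)
  invFun := fun z => GComp.lift (fun v => GComp.mk s t v.1) (fun e => GComp.sound s t e.1) z.2
  left_inv := by
    intro k
    obtain ⟨v, rfl⟩ := GComp.mk_surjective s t k
    rfl
  right_inv := by
    rintro ⟨q, k⟩
    obtain ⟨v, rfl⟩ := GComp.mk_surjective _ _ k
    exact sigma_mk_eq p hp v.2

theorem compFib_mk {s t : E → V} (p : V → Q) (hp : ∀ e, p (s e) = p (t e)) (v : V) :
    compFib p hp (GComp.mk s t v) = ⟨p v, GComp.mk _ _ ⟨v, rfl⟩⟩ := rfl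

theorem ccard_eq_sum_fib {s t : E → V} (p : V → Q) (hp : ∀ e, p (s e) = p (t e)) :
    ccard s t = ∑ q, ccard (fibS p s q) (fibT p s t hp q) := by
  rw [ccard, Nat.card_congr (compFib p hp), Nat.card_sigma]
  rfl

theorem card_eq_sum_fib (p : V → Q) : Nat.card V = ∑ q, Nat.card {v // p v = q} := by
  rw [← Nat.card_sigma, Nat.card_congr (Equiv.sigmaFiberEquiv p)]

theorem mk_eq_iff_fib {s t : E → V} (p : V → Q) (hp : ∀ e, p (s e) = p (t e)) (q : Q)
    (k : GComp (fibS p s q) (fibT p s t hp q)) (v : V) :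
    GComp.mk s t v = (compFib p hp).symm ⟨q, k⟩ ↔ ∃ h : p v = q, GComp.mk _ _ ⟨v, h⟩ = k := by
  rw [Equiv.eq_symm_apply, compFib_mk]
  constructor
  · intro h
    have h1 : p v = q := congrArg Sigma.fst h
    refine ⟨h1, ?_⟩
    rw [sigma_mk_eq p hp h1] at h
    exact eq_of_heq (Sigma.mk.inj h).2
  · rintro ⟨h, rfl⟩
    exact sigma_mk_eq p hp h

theorem gconn_fib (s t : E → V) (k : GComp s t) :
    GConn (fibS (GComp.mk s t) s k) (fibT (GComp.mk s t) s t (GComp.sound s t) k) := by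
  obtain ⟨v, hv⟩ := GComp.mk_surjective s t k
  refine ⟨⟨v, hv⟩, ?_⟩
  rintro ⟨a, ha⟩ ⟨b, hb⟩
  have h : compFib (GComp.mk s t) (GComp.sound s t) (GComp.mk s t a) =
      compFib (GComp.mk s t) (GComp.sound s t) (GComp.mk s t b) := by rw [ha, hb]
  rw [compFib_mk, compFib_mk, sigma_mk_eq _ _ ha, sigma_mk_eq _ _ hb] at h
  exact eq_of_heq (Sigma.mk.inj h).2

theorem ccard_of_isEmpty [IsEmpty E] (s t : E → V) : ccard s t = Nat.card V := by
  refine (Nat.card_congr (Equiv.ofBijective (GComp.mk s t) ⟨fun v w h => ?_, GComp.mk_surjective s t⟩)).symm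
  exact GComp.eq_of_mk_eq h id fun e => isEmptyElim e

/-- Isolated vertices do not contribute to the rank. -/
theorem ccard_injective {j : V → W} (hj : Function.Injective j) (s t : E → V) :
    ccard (j ∘ s) (j ∘ t) + Nat.card V = ccard s t + Nat.card W := by
  let p : W → Bool := fun w => decide (∃ v, j v = w)
  have hp : ∀ v, p (j v) = true := fun v => decide_eq_true ⟨v, rfl⟩
  have hps : ∀ e, p ((j ∘ s) e) = p ((j ∘ t) e) := fun e => by simp [hp]
  rw [ccard_eq_sum_fib p hps, card_eq_sum_fib p, Fintype.sum_bool, Fintype.sum_bool]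
  have : IsEmpty {e // p ((j ∘ s) e) = false} := ⟨fun e => by
    have := e.2; simp [hp] at this⟩
  have e1 : V ≃ {w // p w = true} := Equiv.ofBijective (fun v => ⟨j v, hp v⟩)
    ⟨fun v w h => hj (congrArg Subtype.val h), fun w => by
      obtain ⟨v, hv⟩ := of_decide_eq_true w.2
      exact ⟨v, Subtype.ext hv⟩⟩
  rw [ccard_of_isEmpty (fibS p (j ∘ s) false)]
  have h2 : ccard s t = ccard (fibS p (j ∘ s) true) (fibT p (j ∘ s) (j ∘ t) hps true) :=
    ccard_iso (Equiv.ofBijective (fun v => (⟨j v, hp v⟩ : {w // p w = true}))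
      ⟨fun v w h => hj (congrArg Subtype.val h), fun w => by
        obtain ⟨v, hv⟩ := of_decide_eq_true w.2
        exact ⟨v, Subtype.ext hv⟩⟩) ⟨fun e => ⟨e, hp _⟩, fun e => e.1, fun e => rfl, fun e => rfl⟩
      (fun e => rfl) (fun e => rfl)
  rw [← h2, ← Nat.card_congr e1]
  ring

end Counting

/-! ### Unit labels, and the multiplicative extension to disconnected graphs -/

section Multiplicative

variable {A : Type u} [Ring A] [StarRing A] [Algebra ℂ A] [StarModule ℂ A] (S : TrafficSpace A)
variable {V V' W E E' F Q : Type} [Finite V] [Finite V'] [Finite W] [Finite E] [Finite E']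
  [Finite F] [Fintype Q]

/-- By `hmin`, the map `f` glues nothing beyond what identifying `v` and `w` forces, so its image is
the contraction of the unit edge. -/
theorem tau_one {v w : V} {s t : E → V} (l : E → A)
    (h : GConn (Sum.elim (fun _ : Unit => v) s) (Sum.elim (fun _ : Unit => w) t))
    {f : V → W} (hf : Function.Surjective f) (hvw : f v = f w)
    (hmin : ∀ a b, f a = f b → ∀ ρ : Setoid V, ρ v w → ρ a b) :
    tau S (Sum.elim (fun _ : Unit => v) s) (Sum.elim (fun _ : Unit => w) t)
      (Sum.elim (fun _ : Unit => 1) l) = tau S (f ∘ s) (f ∘ t) l := by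
  let t0 : BiGraph A := ⟨plainGraph (Sum.elim (fun _ : Unit => v) s)
    (Sum.elim (fun _ : Unit => w) t) (Sum.elim (fun _ : Unit => 1) l), v, v⟩
  let e0 : t0.E := Sum.inl ()
  have hc0 : t0.Connected := (connected_iff_gconn _).2 h
  let κ : Setoid V := Relation.EqvGen.setoid fun a b => a = v ∧ b = w
  have hκ : ∀ a b, κ a b ↔ f a = f b := by
    intro a b
    constructor
    · intro hab
      have : κ ≤ Setoid.ker f := Setoid.eqvGen_le fun x y hxy => by
        rw [Setoid.ker_def, hxy.1, hxy.2, hvw]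
      exact this hab
    · intro hab
      exact hmin a b hab κ (Relation.EqvGen.rel _ _ ⟨rfl, rfl⟩)
  have hc1 : GConn (f ∘ s) (f ∘ t) := by
    refine ⟨h.1.map f, fun x y => ?_⟩
    obtain ⟨a, rfl⟩ := hf x
    obtain ⟨b, rfl⟩ := hf y
    refine h.const (fun a => GComp.mk (f ∘ s) (f ∘ t) (f a)) ?_ a b
    rintro (_ | e)
    · exact congrArg _ hvw
    · exact GComp.sound (f ∘ s) (f ∘ t) e
  have hiso : (plainGraph (f ∘ s) (f ∘ t) l).Isomorphic (t0.contract e0).toStarGraph := by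
    let g : (t0.contract e0).V → W := Quot.lift f (fun a b hab => by rw [hab.1, hab.2]; exact hvw)
    have hg : Function.Bijective g := by
      constructor
      · rintro ⟨a⟩ ⟨b⟩ hab
        exact Quot.eqvGen_sound ((hκ a b).2 hab)
      · intro x
        obtain ⟨a, rfl⟩ := hf x
        exact ⟨Quot.mk _ a, rfl⟩
    let φ : E → (t0.contract e0).E := fun e => ⟨Sum.inr e, Sum.inr_ne_inl⟩
    have hφ : Function.Bijective φ := by
      constructor
      · intro a b hab
        exact Sum.inr_injective (congrArg Subtype.val hab)
      · rintro ⟨_ | e, he⟩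
        · exact absurd rfl he
        · exact ⟨e, rfl⟩
    have hgs : ∀ a, (Equiv.ofBijective g hg).symm (f a) = Quot.mk _ a := fun a =>
      (Equiv.symm_apply_eq _).2 rfl
    exact ⟨(Equiv.ofBijective g hg).symm, Equiv.ofBijective φ hφ, fun e =>
      ⟨(hgs _).symm, (hgs _).symm, rfl, rfl⟩⟩
  have h1 := congrArg S.Φ (S.eval_one t0 e0 hc0 rfl)
  rw [Phi_eval_eq_tau S _ hc0 rfl, Phi_eval_eq_tau S _ (hiso.connected
    ((connected_iff_gconn _).2 hc1)) rfl] at h1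
  exact h1.trans (S.τ_iso _ _ ((connected_iff_gconn _).2 hc1) hiso).symm

theorem tau0_one_loop {v : V} {s t : E → V} (l : E → A)
    (h : GConn (Sum.elim (fun _ : Unit => v) s) (Sum.elim (fun _ : Unit => v) t)) :
    tau0 S (Sum.elim (fun _ : Unit => v) s) (Sum.elim (fun _ : Unit => v) t)
      (Sum.elim (fun _ : Unit => 1) l) = tau0 S s t l := by
  rw [tau0_def, tau0_def]
  refine Finset.sum_congr rfl fun π _ => congrArg _ ?_
  have hc := h.map (qmk_surjective π)
  rw [Sum.comp_elim, Sum.comp_elim] at hc ⊢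
  exact tau_one S (v := qmk π v) (w := qmk π v) l hc (f := id) Function.surjective_id rfl
    fun a b hab ρ _ => by cases hab; exact ρ.refl _

/-- The value of τ on the quotient by `σ` depends only on the join of `σ` with the partition `κ`
generated by `v ~ w`. Its Möbius inverse is therefore supported above `κ`, and `⊥` is not above `κ`
when `v ≠ w`. -/
theorem tau0_one_of_ne {v w : V} (hvw : v ≠ w) {s t : E → V} (l : E → A)
    (h : GConn (Sum.elim (fun _ : Unit => v) s) (Sum.elim (fun _ : Unit => w) t)) :
    tau0 S (Sum.elim (fun _ : Unit => v) s) (Sum.elim (fun _ : Unit => w) t)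
      (Sum.elim (fun _ : Unit => 1) l) = 0 := by
  set s' := Sum.elim (fun _ : Unit => v) s
  set t' := Sum.elim (fun _ : Unit => w) t
  set l' : Unit ⊕ E → A := Sum.elim (fun _ : Unit => 1) l
  let κ : Setoid V := Relation.EqvGen.setoid fun a b => a = v ∧ b = w
  have hκ : ∀ π : Setoid V, κ ≤ π ↔ π v w := by
    intro π
    constructor
    · intro H; exact H (Relation.EqvGen.rel _ _ ⟨rfl, rfl⟩)
    · intro H
      refine Setoid.eqvGen_le ?_
      rintro a b ⟨rfl, rfl⟩; exact H
  have hq : ∀ (σ : Setoid V), tau S (qmk σ ∘ s') (qmk σ ∘ t') l' =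
      tau S (qmk (σ ⊔ κ) ∘ s) (qmk (σ ⊔ κ) ∘ t) l := by
    intro σ
    have hc := h.map (qmk_surjective σ)
    have h1 : qmk σ ∘ s' = Sum.elim (fun _ : Unit => qmk σ v) (qmk σ ∘ s) := Sum.comp_elim _ _ _
    have h2 : qmk σ ∘ t' = Sum.elim (fun _ : Unit => qmk σ w) (qmk σ ∘ t) := Sum.comp_elim _ _ _
    rw [h1, h2] at hc ⊢
    let g : Quotient σ → Quotient (σ ⊔ κ) := Quotient.lift (qmk (σ ⊔ κ)) fun a b hab =>
      qmk_eq_iff.2 ((le_sup_left : σ ≤ σ ⊔ κ) hab)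
    refine tau_one S (f := g) l hc ?_ ?_ ?_
    · intro x
      obtain ⟨a, rfl⟩ := qmk_surjective _ x
      exact ⟨qmk σ a, rfl⟩
    · exact qmk_eq_iff.2 ((le_sup_right : κ ≤ σ ⊔ κ) (Relation.EqvGen.rel _ _ ⟨rfl, rfl⟩))
    · intro a b hab ρ hρ
      obtain ⟨a, rfl⟩ := qmk_surjective _ a
      obtain ⟨b, rfl⟩ := qmk_surjective _ b
      have h3 : (σ ⊔ κ) a b := qmk_eq_iff.1 hab
      have h4 : σ ⊔ κ ≤ Setoid.comap (qmk σ) ρ := by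
        refine sup_le ?_ ((hκ _).2 hρ)
        intro x y hxy
        rw [Setoid.comap_rel, qmk_eq_iff.2 hxy]
      exact h4 h3
  rw [tau0_def]
  rw [sum_partitionMoebius_mul (fun π => tau S (qmk π ∘ s') (qmk π ∘ t') l')
    (fun π => if κ ≤ π then tau0 S (qmk π ∘ s') (qmk π ∘ t') l' else 0)]
  · rw [if_neg]
    intro hle
    exact hvw ((hκ ⊥).1 hle)
  · intro σ
    have h1 : tau S (qmk σ ∘ s') (qmk σ ∘ t') l' =
        tau S (qmk (σ ⊔ κ) ∘ s') (qmk (σ ⊔ κ) ∘ t') l' := by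
      rw [hq σ, hq (σ ⊔ κ), sup_assoc, sup_idem]
    rw [h1, tau_surj_eq_sum S h (qmk_surjective _), ker_qmk, ← Finset.sum_filter, Finset.filter_filter]
    refine Finset.sum_congr ?_ fun _ _ => rfl
    ext π
    simp [sup_le_iff]

theorem tau0_add {s t : E → V} (h : GConn s t) {l l₁ l₂ : E → A} (e : E)
    (hl : l e = l₁ e + l₂ e) (h₁ : ∀ e' ≠ e, l₁ e' = l e') (h₂ : ∀ e' ≠ e, l₂ e' = l e') :
    tau0 S s t l = tau0 S s t l₁ + tau0 S s t l₂ := by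
  simp_rw [tau0_def, ← Finset.sum_add_distrib, ← mul_add,
    tau_add S (h.map (qmk_surjective _)) e hl h₁ h₂]

theorem tau0_smul {s t : E → V} (h : GConn s t) {l l₁ : E → A} (e : E) (z : ℂ)
    (hl : l e = z • l₁ e) (h₁ : ∀ e' ≠ e, l₁ e' = l e') :
    tau0 S s t l = z * tau0 S s t l₁ := by
  simp_rw [tau0_def, tau_smul S (h.map (qmk_surjective _)) e z hl h₁, Finset.mul_sum]
  exact Finset.sum_congr rfl fun _ _ => by ring

theorem tau0_eq_tau [Subsingleton V] {s t : E → V} (h : GConn s t) (l : E → A) :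
    tau0 S s t l = tau S s t l := by
  have hs : Subsingleton (Setoid V) := ⟨fun a b => by
    ext x y; rw [Subsingleton.elim x y]; exact ⟨fun _ => b.refl _, fun _ => a.refl _⟩⟩
  rw [tau0_def, Fintype.sum_subsingleton _ ⊥, partitionMoebius_eq_mu, IncidenceAlgebra.mu_self,
    one_mul]
  exact tau_surj_congr S h (f' := id) (qmk_surjective _) Function.surjective_id fun v w => by
    simp [Subsingleton.elim v w]

/-- The empty path evaluates to the empty product, and `Φ 1 = 1`. -/
theorem tau_point [IsEmpty E] {s t : E → V} (h : GConn s t) (l : E → A) : tau S s t l = 1 := by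
  have h1 := S.state (BiGraph.path []) (path_connected [])
  rw [S.compatibility] at h1
  simp only [List.map_nil, List.prod_nil, S.unity] at h1
  rw [h1]
  refine S.τ_iso _ _ ((connected_iff_gconn _).2 h) ?_
  refine StarGraph.Isomorphic.symm ?_
  obtain ⟨v0⟩ := h.1
  refine ⟨Equiv.ofBijective (fun _ => v0) ⟨?_, fun w => ⟨Quot.mk _ (0 : Fin 1), ?_⟩⟩,
    ⟨fun e => Fin.elim0 e, fun e => isEmptyElim (α := E) e, fun e => Fin.elim0 e,
      fun e => isEmptyElim (α := E) e⟩, fun e => Fin.elim0 e⟩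
  · rintro ⟨a⟩ ⟨b⟩ _
    rw [Subsingleton.elim (α := Fin 1) a b]
  · exact h.const id (fun e => isEmptyElim e) v0 w

theorem tau0_point [IsEmpty E] {s t : E → V} (h : GConn s t) (l : E → A) : tau0 S s t l = 1 := by
  have : Subsingleton V := ⟨fun a b => h.const id (fun e => isEmptyElim e) a b⟩
  rw [tau0_eq_tau S h, tau_point S h]

/-- The multiplicative extension of the injective traffic state to disconnected graphs. -/
def Mtau (s t : E → V) (l : E → A) : ℂ :=
  ∏ k : GComp s t, tau0 S (fibS (GComp.mk s t) s k) (fibT (GComp.mk s t) s t (GComp.sound s t) k)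
    (fun e => l e.1)

theorem Mtau_iso {s t : E → V} {l : E → A} {s' t' : F → W} {l' : F → A} (f : V ≃ W) (φ : E ≃ F)
    (hs : ∀ e, s' (φ e) = f (s e)) (ht : ∀ e, t' (φ e) = f (t e)) (hl : ∀ e, l' (φ e) = l e) :
    Mtau S s t l = Mtau S s' t' l' := by
  refine Fintype.prod_equiv (gcompEquiv f φ hs ht) _ _ fun k => ?_
  have hk : ∀ v, GComp.mk s t v = k ↔ GComp.mk s' t' (f v) = gcompEquiv f φ hs ht k := by
    intro v
    rw [← (gcompEquiv f φ hs ht).apply_eq_iff_eq]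
    exact Iff.rfl
  refine tau0_iso S (gconn_fib s t k) (f.subtypeEquiv hk)
    (φ.subtypeEquiv fun e => by rw [hk, hs]) ?_ ?_ ?_
  · intro e; exact Subtype.ext (hs e.1)
  · intro e; exact Subtype.ext (ht e.1)
  · intro e; exact hl e.1

theorem Mtau_eq_prod_fib {s t : E → V} (l : E → A) (p : V → Q) (hp : ∀ e, p (s e) = p (t e)) :
    Mtau S s t l = ∏ q, Mtau S (fibS p s q) (fibT p s t hp q) (fun e => l e.1) := by
  unfold Mtau
  rw [← (compFib p hp).symm.prod_comp, Fintype.prod_sigma]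
  refine Finset.prod_congr rfl fun q _ => Finset.prod_congr rfl fun k _ => ?_
  have hk := mk_eq_iff_fib p hp q k
  refine tau0_iso S (gconn_fib s t _)
    ⟨fun v => ⟨⟨v.1, ((hk v.1).1 v.2).1⟩, ((hk v.1).1 v.2).2⟩,
      fun v => ⟨v.1.1, (hk v.1.1).2 ⟨v.1.2, v.2⟩⟩, fun v => rfl, fun v => rfl⟩
    ⟨fun e => ⟨⟨e.1, ((hk (s e.1)).1 e.2).1⟩, ((hk (s e.1)).1 e.2).2⟩,
      fun e => ⟨e.1.1, (hk (s e.1.1)).2 ⟨e.1.2, e.2⟩⟩, fun e => rfl, fun e => rfl⟩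
    (fun e => rfl) (fun e => rfl) (fun e => rfl)

theorem Mtau_of_gconn {s t : E → V} (h : GConn s t) (l : E → A) :
    Mtau S s t l = tau0 S s t l := by
  obtain ⟨v0⟩ := h.1
  have huniq : ∀ k : GComp s t, k = GComp.mk s t v0 := fun k => by
    obtain ⟨v, rfl⟩ := GComp.mk_surjective s t k
    exact h.2 _ _
  have : Subsingleton (GComp s t) := ⟨fun a b => (huniq a).trans (huniq b).symm⟩
  rw [Mtau, Fintype.prod_subsingleton _ (GComp.mk s t v0)]
  exact tau0_iso S (gconn_fib s t _) ⟨Subtype.val, fun v => ⟨v, huniq _⟩, fun v => rfl, fun v => rfl⟩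
    ⟨Subtype.val, fun v => ⟨v, huniq _⟩, fun v => rfl, fun v => rfl⟩ (fun e => rfl) (fun e => rfl)
    (fun e => rfl)

theorem Mtau_of_isEmpty [IsEmpty E] (s t : E → V) (l : E → A) : Mtau S s t l = 1 :=
  Finset.prod_eq_one fun k _ => tau0_point S (gconn_fib s t k) _

/-- The vertices outside the image are isolated, and each contributes the value `1` of a point. -/
theorem Mtau_injective {j : V → W} (hj : Function.Injective j) (s t : E → V) (l : E → A) :
    Mtau S (j ∘ s) (j ∘ t) l = Mtau S s t l := by
  let p : W → Bool := fun w => decide (∃ v, j v = w)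
  have hp : ∀ v, p (j v) = true := fun v => decide_eq_true ⟨v, rfl⟩
  have hps : ∀ e, p ((j ∘ s) e) = p ((j ∘ t) e) := fun e => by simp [hp]
  rw [Mtau_eq_prod_fib S l p hps, Fintype.prod_bool]
  have : IsEmpty {e // p ((j ∘ s) e) = false} := ⟨fun e => by
    have := e.2; simp [hp] at this⟩
  rw [Mtau_of_isEmpty S (fibS p (j ∘ s) false), mul_one]
  symm
  exact Mtau_iso S (Equiv.ofBijective (fun v => (⟨j v, hp v⟩ : {w // p w = true}))
      ⟨fun v w h => hj (congrArg Subtype.val h), fun w => by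
        obtain ⟨v, hv⟩ := of_decide_eq_true w.2
        exact ⟨v, Subtype.ext hv⟩⟩) ⟨fun e => ⟨e, hp _⟩, fun e => e.1, fun e => rfl, fun e => rfl⟩
      (fun e => rfl) (fun e => rfl) (fun e => rfl)

theorem Mtau_eq_mul_erase (s t : E → V) (l : E → A) (k₀ : GComp s t) : Mtau S s t l =
      tau0 S (fibS (GComp.mk s t) s k₀) (fibT (GComp.mk s t) s t (GComp.sound s t) k₀)
        (fun e => l e.1) *
      ∏ k ∈ Finset.univ.erase k₀, tau0 S (fibS (GComp.mk s t) s k)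
        (fibT (GComp.mk s t) s t (GComp.sound s t) k) (fun e => l e.1) := by
  rw [Mtau, ← Finset.mul_prod_erase _ _ (Finset.mem_univ k₀)]

theorem prod_erase_congr (s t : E → V) {l l' : E → A} (e : E) (h : ∀ e' ≠ e, l e' = l' e') :
    ∏ k ∈ Finset.univ.erase (GComp.mk s t (s e)), tau0 S (fibS (GComp.mk s t) s k)
        (fibT (GComp.mk s t) s t (GComp.sound s t) k) (fun e => l e.1) =
    ∏ k ∈ Finset.univ.erase (GComp.mk s t (s e)), tau0 S (fibS (GComp.mk s t) s k)
        (fibT (GComp.mk s t) s t (GComp.sound s t) k) (fun e => l' e.1) := by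
  refine Finset.prod_congr rfl fun k hk => ?_
  congr 1
  funext e'
  refine h _ fun h' => ?_
  have h2 := e'.2
  rw [h'] at h2
  exact (Finset.mem_erase.1 hk).1 h2.symm

theorem Mtau_add (s t : E → V) {l l₁ l₂ : E → A} (e : E)
    (hl : l e = l₁ e + l₂ e) (h₁ : ∀ e' ≠ e, l₁ e' = l e') (h₂ : ∀ e' ≠ e, l₂ e' = l e') :
    Mtau S s t l = Mtau S s t l₁ + Mtau S s t l₂ := by
  rw [Mtau_eq_mul_erase S s t l (GComp.mk s t (s e)),
    Mtau_eq_mul_erase S s t l₁ (GComp.mk s t (s e)),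
    Mtau_eq_mul_erase S s t l₂ (GComp.mk s t (s e)), prod_erase_congr S s t e h₁,
    prod_erase_congr S s t e h₂, ← add_mul]
  congr 1
  exact tau0_add S (gconn_fib s t _) ⟨e, rfl⟩ hl (fun e' h => h₁ _ fun h' => h (Subtype.ext h'))
    (fun e' h => h₂ _ fun h' => h (Subtype.ext h'))

theorem Mtau_smul (s t : E → V) {l l₁ : E → A} (e : E) (z : ℂ)
    (hl : l e = z • l₁ e) (h₁ : ∀ e' ≠ e, l₁ e' = l e') :
    Mtau S s t l = z * Mtau S s t l₁ := by
  rw [Mtau_eq_mul_erase S s t l (GComp.mk s t (s e)),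
    Mtau_eq_mul_erase S s t l₁ (GComp.mk s t (s e)), prod_erase_congr S s t e h₁, ← mul_assoc]
  congr 1
  exact tau0_smul S (gconn_fib s t _) ⟨e, rfl⟩ z hl (fun e' h => h₁ _ fun h' => h (Subtype.ext h'))

/-- The restriction to a fibre of a map of vertices. -/
def fibMap (f : V → V') (p : V' → Q) (q : Q) : {v // p (f v) = q} → {v' // p v' = q} :=
  fun v => ⟨f v.1, v.2⟩

/-- On each component `Refines.tau0_eq` applies. Expanding the product over the components gives one
partition per component, that is, one partition of `V'` gluing no two components. -/
theorem Mtau_refines {f : V → V'} {s t : E → V} {l : E → A} {s' t' : E' → V'} {l' : E' → A}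
    (hf : ∀ e, GComp.mk s' t' (f (s e)) = GComp.mk s' t' (f (t e)))
    (hconn : ∀ k, GConn (fibS (fun v => GComp.mk s' t' (f v)) s k)
      (fibT (fun v => GComp.mk s' t' (f v)) s t hf k))
    (H : ∀ k, Refines S (fibMap f (GComp.mk s' t') k) (fibS (fun v => GComp.mk s' t' (f v)) s k)
      (fibT (fun v => GComp.mk s' t' (f v)) s t hf k) (fun e => l e.1)
      (fibS (GComp.mk s' t') s' k) (fibT (GComp.mk s' t') s' t' (GComp.sound s' t') k)
      (fun e => l' e.1)) :
    Mtau S s t l = ∑ ρ with Setoid.comap f ρ = ⊥ ∧ ρ ≤ Setoid.ker (GComp.mk s' t'),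
      Mtau S (qmk ρ ∘ s') (qmk ρ ∘ t') l' := by
  rw [Mtau_eq_prod_fib S l (fun v => GComp.mk s' t' (f v)) hf]
  have h1 : ∀ k, Mtau S (fibS (fun v => GComp.mk s' t' (f v)) s k)
      (fibT (fun v => GComp.mk s' t' (f v)) s t hf k) (fun e => l e.1) =
      ∑ ρ ∈ Finset.univ.filter (fun ρ => Setoid.comap (fibMap f (GComp.mk s' t') k) ρ = ⊥),
        tau0 S (qmk ρ ∘ fibS (GComp.mk s' t') s' k)
        (qmk ρ ∘ fibT (GComp.mk s' t') s' t' (GComp.sound s' t') k) (fun e => l' e.1) := by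
    intro k
    rw [Mtau_of_gconn S (hconn k), (H k).tau0_eq (gconn_fib s' t' k)]
  simp_rw [h1]
  rw [Finset.prod_univ_sum]
  symm
  refine Finset.sum_bij (fun ρ _ => fun k => Setoid.comap Subtype.val ρ) ?_ ?_ ?_ ?_
  · intro ρ hρ
    simp only [Finset.mem_filter, Finset.mem_univ, true_and] at hρ
    simp only [Fintype.mem_piFinset, Finset.mem_filter, Finset.mem_univ, true_and]
    intro k
    refine le_antisymm (fun a b hab => ?_) bot_le
    have : (Setoid.comap f ρ) a.1 b.1 := hab
    rw [hρ.1] at this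
    exact Subtype.ext this
  · intro ρ hρ ρ' hρ' heq
    simp only [Finset.mem_filter, Finset.mem_univ, true_and] at hρ hρ'
    have key : ∀ ρ₁ ρ₂ : Setoid V', ρ₁ ≤ Setoid.ker (GComp.mk s' t') →
        (fun k : GComp s' t' => Setoid.comap (Subtype.val : {v // GComp.mk s' t' v = k} → V') ρ₁) =
          (fun k => Setoid.comap Subtype.val ρ₂) → ρ₁ ≤ ρ₂ := by
      intro ρ₁ ρ₂ hle he a b hab
      have hab' : GComp.mk s' t' a = GComp.mk s' t' b := hle hab
      have h2 : (Setoid.comap (Subtype.val : {v // GComp.mk s' t' v = GComp.mk s' t' b} → V') ρ₁)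
        ⟨a, hab'⟩ ⟨b, rfl⟩ := hab
      rw [congrFun he (GComp.mk s' t' b)] at h2
      exact h2
    exact le_antisymm (key _ _ hρ.2 heq) (key _ _ hρ'.2 heq.symm)
  · intro r hr
    simp only [Fintype.mem_piFinset, Finset.mem_filter, Finset.mem_univ, true_and] at hr
    -- A family of partitions of the components is reassembled as the kernel of the map recording
    -- the component and the class inside it.
    let F : V' → Σ k, Quotient (r k) := fun v => ⟨GComp.mk s' t' v, qmk (r _) ⟨v, rfl⟩⟩
    have hF : ∀ k v (hv : GComp.mk s' t' v = k), F v = ⟨k, qmk (r k) ⟨v, hv⟩⟩ := by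
      intro k v hv; subst hv; rfl
    have hFF : ∀ k a b (ha : GComp.mk s' t' a = k) (hb : GComp.mk s' t' b = k),
        F a = F b ↔ r k ⟨a, ha⟩ ⟨b, hb⟩ := by
      intro k a b ha hb
      rw [hF k a ha, hF k b hb, ← qmk_eq_iff]
      constructor
      · intro h; exact eq_of_heq (Sigma.mk.inj h).2
      · intro h; rw [h]
    refine ⟨Setoid.ker F, ?_, ?_⟩
    · simp only [Finset.mem_filter, Finset.mem_univ, true_and]
      refine ⟨le_antisymm (fun a b hab => ?_) bot_le, fun a b hab => ?_⟩
      · have hab : F (f a) = F (f b) := hab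
        have hk : GComp.mk s' t' (f a) = GComp.mk s' t' (f b) := congrArg Sigma.fst hab
        have h2 := (hFF _ _ _ hk rfl).1 hab
        have h3 : (Setoid.comap (fibMap f (GComp.mk s' t') _) (r (GComp.mk s' t' (f b))))
          ⟨a, hk⟩ ⟨b, rfl⟩ := h2
        rw [hr] at h3
        exact congrArg Subtype.val h3
      · exact congrArg Sigma.fst (show F a = F b from hab)
    · funext k
      ext a b
      exact hFF k a.1 b.1 a.2 b.2
  · intro ρ hρ
    simp only [Finset.mem_filter, Finset.mem_univ, true_and] at hρ
    let p : Quotient ρ → GComp s' t' := Quotient.lift (GComp.mk s' t') fun a b hab => hρ.2 hab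
    have hp : ∀ e, p ((qmk ρ ∘ s') e) = p ((qmk ρ ∘ t') e) := fun e => GComp.sound s' t' e
    rw [Mtau_eq_prod_fib S l' p hp]
    refine Finset.prod_congr rfl fun k _ => ?_
    let g : {v // GComp.mk s' t' v = k} → {x // p x = k} := fun v => ⟨qmk ρ v.1, v.2⟩
    have hg : Function.Surjective g := by
      rintro ⟨x, hx⟩
      obtain ⟨v, rfl⟩ := qmk_surjective ρ x
      exact ⟨⟨v, hx⟩, rfl⟩
    have hc := (gconn_fib s' t' k)
    have h3 : Mtau S (g ∘ fibS (GComp.mk s' t') s' k)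
        (g ∘ fibT (GComp.mk s' t') s' t' (GComp.sound s' t') k) (fun e => l' e.1) = _ :=
      Mtau_of_gconn S (hc.map hg) _
    refine h3.trans ?_
    refine tau0_surj_congr S hc hg (qmk_surjective _) fun v w => ?_
    have h4 : g v = g w ↔ ρ v.1 w.1 :=
      ⟨fun h => (qmk_eq_iff (σ := ρ)).1 (congrArg Subtype.val h),
        fun h => Subtype.ext ((qmk_eq_iff (σ := ρ)).2 h)⟩
    exact h4.trans (qmk_eq_iff (σ := Setoid.comap Subtype.val ρ)).symm

end Multiplicative

/-! ### Splitting edges in disconnected graphs -/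

section Splitting

variable {A : Type u} [Ring A] [StarRing A] [Algebra ℂ A] [StarModule ℂ A] (S : TrafficSpace A)
variable {V V' W E E' E₁ E₂ F P Q : Type} [Finite V] [Finite V'] [Finite W] [Finite E] [Finite E']
  [Finite E₁] [Finite E₂] [Finite F] [Finite P] [Fintype Q]

theorem ccard_map_le (s t : E → V) {f : V → W} (hf : Function.Surjective f) :
    ccard (f ∘ s) (f ∘ t) ≤ ccard s t :=
  Nat.card_le_card_of_surjective
    (GComp.map f (fun e => GComp.sound (f ∘ s) (f ∘ t) e))
    (GComp.map_surjective _ fun w => by obtain ⟨v, rfl⟩ := hf w; exact ⟨v, rfl⟩)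

/-- Components are lost exactly when vertices of different components are glued. This trades
conditions on partitions for equalities of integers. -/
theorem ccard_map_eq_iff (s t : E → V) {f : V → W} (hf : Function.Surjective f) :
    ccard (f ∘ s) (f ∘ t) = ccard s t ↔ Setoid.ker f ≤ Setoid.ker (GComp.mk s t) := by
  let g : GComp s t → GComp (f ∘ s) (f ∘ t) :=
    GComp.map f (fun e => GComp.sound (f ∘ s) (f ∘ t) e)
  have hg : Function.Surjective g :=
    GComp.map_surjective _ fun w => by obtain ⟨v, rfl⟩ := hf w; exact ⟨v, rfl⟩
  constructor
  · intro h v w hvw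
    have hb : Function.Bijective g := (Nat.bijective_iff_surjective_and_card g).2 ⟨hg, h.symm⟩
    refine hb.1 ?_
    have hvw : f v = f w := hvw
    change GComp.mk _ _ (f v) = GComp.mk _ _ (f w)
    rw [hvw]
  · intro h
    refine (Nat.card_congr (Equiv.ofBijective g ⟨?_, hg⟩)).symm
    intro x y hxy
    obtain ⟨v, rfl⟩ := GComp.mk_surjective s t x
    obtain ⟨w, rfl⟩ := GComp.mk_surjective s t y
    let r : W → GComp s t := fun z => GComp.mk s t (Function.surjInv hf z)
    have hr : ∀ v, r (f v) = GComp.mk s t v := fun v => h (Function.surjInv_eq hf (f v))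
    have := GComp.eq_of_mk_eq (s := f ∘ s) (t := f ∘ t) hxy r fun e => by
      simp only [Function.comp, hr]; exact GComp.sound s t e
    rwa [hr, hr] at this

theorem gconn_fib_of_injective {f : V → V'} {s t : E → V} {s' t' : E' → V'}
    (hf : ∀ e, GComp.mk s' t' (f (s e)) = GComp.mk s' t' (f (t e)))
    (hinj : ∀ v w, GComp.mk s' t' (f v) = GComp.mk s' t' (f w) → GComp.mk s t v = GComp.mk s t w)
    (hsurj : ∀ k, ∃ v, GComp.mk s' t' (f v) = k) (k : GComp s' t') :
    GConn (fibS (fun v => GComp.mk s' t' (f v)) s k)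
      (fibT (fun v => GComp.mk s' t' (f v)) s t hf k) := by
  obtain ⟨v, hv⟩ := hsurj k
  refine ⟨⟨v, hv⟩, ?_⟩
  rintro ⟨a, ha⟩ ⟨b, hb⟩
  have h : compFib (fun v => GComp.mk s' t' (f v)) hf (GComp.mk s t a) =
      compFib (fun v => GComp.mk s' t' (f v)) hf (GComp.mk s t b) := by
    rw [hinj a b (ha.trans hb.symm)]
  rw [compFib_mk, compFib_mk, sigma_mk_eq (fun v => GComp.mk s' t' (f v)) hf ha,
    sigma_mk_eq (fun v => GComp.mk s' t' (f v)) hf hb] at h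
  exact eq_of_heq (Sigma.mk.inj h).2

section

variable {f : V → V'} {n : P → V'} {sP tP : P → V} {s t : E → V}

theorem split_mk_new (p : P) :
    GComp.mk (Sum.elim (f ∘ sP) (Sum.elim n (f ∘ s))) (Sum.elim n (Sum.elim (f ∘ tP) (f ∘ t))) (n p) =
    GComp.mk _ _ (f (sP p)) :=
  (GComp.sound (Sum.elim (f ∘ sP) (Sum.elim n (f ∘ s))) (Sum.elim n (Sum.elim (f ∘ tP) (f ∘ t)))
    (Sum.inl p)).symm

theorem split_compat (e : P ⊕ E) :
    GComp.mk (Sum.elim (f ∘ sP) (Sum.elim n (f ∘ s))) (Sum.elim n (Sum.elim (f ∘ tP) (f ∘ t)))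
      (f (Sum.elim sP s e)) = GComp.mk _ _ (f (Sum.elim tP t e)) := by
  rcases e with p | e
  · exact (split_mk_new p).symm.trans (GComp.sound (Sum.elim (f ∘ sP) (Sum.elim n (f ∘ s)))
      (Sum.elim n (Sum.elim (f ∘ tP) (f ∘ t))) (Sum.inr (Sum.inl p)))
  · exact GComp.sound (Sum.elim (f ∘ sP) (Sum.elim n (f ∘ s)))
      (Sum.elim n (Sum.elim (f ∘ tP) (f ∘ t))) (Sum.inr (Sum.inr e))

theorem split_mk_surjective (hfn : Function.Bijective (Sum.elim f n))
    (k : GComp (Sum.elim (f ∘ sP) (Sum.elim n (f ∘ s))) (Sum.elim n (Sum.elim (f ∘ tP) (f ∘ t)))) :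
    ∃ v, GComp.mk _ _ (f v) = k := by
  obtain ⟨z, rfl⟩ := GComp.mk_surjective _ _ k
  obtain ⟨v | p, rfl⟩ := hfn.2 z
  · exact ⟨v, rfl⟩
  · exact ⟨sP p, (split_mk_new p).symm⟩

theorem split_mk_injective (hfn : Function.Bijective (Sum.elim f n)) (v w : V)
    (h : GComp.mk (Sum.elim (f ∘ sP) (Sum.elim n (f ∘ s))) (Sum.elim n (Sum.elim (f ∘ tP) (f ∘ t)))
      (f v) = GComp.mk _ _ (f w)) :
    GComp.mk (Sum.elim sP s) (Sum.elim tP t) v = GComp.mk (Sum.elim sP s) (Sum.elim tP t) w := by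
  let e := Equiv.ofBijective _ hfn
  have hef : ∀ v, e.symm (f v) = Sum.inl v := fun v => e.symm_apply_eq.2 rfl
  have hen : ∀ p, e.symm (n p) = Sum.inr p := fun v => e.symm_apply_eq.2 rfl
  let r : V' → GComp (Sum.elim sP s) (Sum.elim tP t) := fun z =>
    Sum.elim (fun v => GComp.mk _ _ v) (fun p => GComp.mk _ _ (sP p)) (e.symm z)
  have hr : ∀ v, r (f v) = GComp.mk _ _ v := fun v => by simp [r, hef]
  have hrn : ∀ p, r (n p) = GComp.mk _ _ (sP p) := fun v => by simp [r, hen]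
  have h2 := GComp.eq_of_mk_eq h r (by
    rintro (p | p | e)
    · simp only [Sum.elim_inl, Function.comp, hr, hrn]
    · simp only [Sum.elim_inl, Sum.elim_inr, Function.comp, hr, hrn]
      exact GComp.sound (Sum.elim sP s) (Sum.elim tP t) (Sum.inl p)
    · simp only [Sum.elim_inr, Function.comp, hr]
      exact GComp.sound (Sum.elim sP s) (Sum.elim tP t) (Sum.inr e))
  rwa [hr, hr] at h2

theorem ccard_split (hfn : Function.Bijective (Sum.elim f n)) :
    ccard (Sum.elim (f ∘ sP) (Sum.elim n (f ∘ s))) (Sum.elim n (Sum.elim (f ∘ tP) (f ∘ t))) =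
    ccard (Sum.elim sP s) (Sum.elim tP t) := by
  refine (Nat.card_congr (Equiv.ofBijective (GComp.map f split_compat) ⟨?_, ?_⟩)).symm
  · intro x y hxy
    obtain ⟨v, rfl⟩ := GComp.mk_surjective _ _ x
    obtain ⟨w, rfl⟩ := GComp.mk_surjective _ _ y
    exact split_mk_injective hfn v w hxy
  · intro k
    obtain ⟨v, hv⟩ := split_mk_surjective hfn k
    exact ⟨GComp.mk _ _ v, hv⟩

/-- Splitting edges is compatible with the restriction to unions of components. -/
theorem fib_refines_split {f : V → V'} {n : P → V'} (hfn : Function.Bijective (Sum.elim f n))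
    {sP tP : P → V} {s t : E → V} (x y : P → A) (l : E → A) (p : V' → Q)
    (hp : ∀ e, p (f (Sum.elim sP s e)) = p (f (Sum.elim tP t e)))
    (hp' : ∀ e, p (Sum.elim (f ∘ sP) (Sum.elim n (f ∘ s)) e) =
      p (Sum.elim n (Sum.elim (f ∘ tP) (f ∘ t)) e)) (q : Q)
    (hc : GConn (fibS (fun v => p (f v)) (Sum.elim sP s) q) (fibT (fun v => p (f v)) _ _ hp q)) :
    Refines S (fibMap f p q) (fibS (fun v => p (f v)) (Sum.elim sP s) q)
      (fibT (fun v => p (f v)) _ _ hp q) (fun e => Sum.elim (fun p => x p * y p) l e.1)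
      (fibS p _ q) (fibT p _ _ hp' q) (fun e => Sum.elim x (Sum.elim y l) e.1) := by
  have hn : ∀ a, p (n a) = p (f (sP a)) := fun a => (hp' (Sum.inl a)).symm
  let nq : {a : P // p (f (sP a)) = q} → {v' // p v' = q} := fun a => ⟨n a.1, (hn a.1).trans a.2⟩
  have hfnq : Function.Bijective (Sum.elim (fibMap f p q) nq) := by
    constructor
    · rintro (a | a) (b | b) h
      · have h1 : f a.1 = f b.1 := congrArg Subtype.val h
        have h2 := @hfn.1 (Sum.inl a.1) (Sum.inl b.1) h1
        exact congrArg Sum.inl (Subtype.ext (Sum.inl_injective h2))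
      · have h1 : f a.1 = n b.1 := congrArg Subtype.val h
        exact absurd (@hfn.1 (Sum.inl a.1) (Sum.inr b.1) h1) (by simp)
      · have h1 : n a.1 = f b.1 := congrArg Subtype.val h
        exact absurd (@hfn.1 (Sum.inr a.1) (Sum.inl b.1) h1) (by simp)
      · have h1 : n a.1 = n b.1 := congrArg Subtype.val h
        have h2 := @hfn.1 (Sum.inr a.1) (Sum.inr b.1) h1
        exact congrArg Sum.inr (Subtype.ext (Sum.inr_injective h2))
    · rintro ⟨z, hz⟩
      obtain ⟨v | a, rfl⟩ := hfn.2 z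
      · exact ⟨Sum.inl ⟨v, hz⟩, rfl⟩
      · exact ⟨Sum.inr ⟨a, (hn a).symm.trans hz⟩, rfl⟩
  let sPq : {a : P // p (f (sP a)) = q} → {v // p (f v) = q} := fun a => ⟨sP a.1, a.2⟩
  let tPq : {a : P // p (f (sP a)) = q} → {v // p (f v) = q} :=
    fun a => ⟨tP a.1, (hp (Sum.inl a.1)).symm.trans a.2⟩
  let sq : {e : E // p (f (s e)) = q} → {v // p (f v) = q} := fun a => ⟨s a.1, a.2⟩
  let tq : {e : E // p (f (s e)) = q} → {v // p (f v) = q} :=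
    fun a => ⟨t a.1, (hp (Sum.inr a.1)).symm.trans a.2⟩
  let φ : {e : P ⊕ E // p (f (Sum.elim sP s e)) = q} ≃
      {a : P // p (f (sP a)) = q} ⊕ {e : E // p (f (s e)) = q} :=
    { toFun := fun e => match e with
        | ⟨Sum.inl a, h⟩ => Sum.inl ⟨a, h⟩
        | ⟨Sum.inr e, h⟩ => Sum.inr ⟨e, h⟩
      invFun := Sum.elim (fun a => ⟨Sum.inl a.1, a.2⟩) (fun e => ⟨Sum.inr e.1, e.2⟩)
      left_inv := by rintro ⟨a | e, h⟩ <;> rfl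
      right_inv := by rintro (a | e) <;> rfl }
  let φ' : {e : P ⊕ (P ⊕ E) // p (Sum.elim (f ∘ sP) (Sum.elim n (f ∘ s)) e) = q} ≃
      {a : P // p (f (sP a)) = q} ⊕ ({a : P // p (f (sP a)) = q} ⊕ {e : E // p (f (s e)) = q}) :=
    { toFun := fun e => match e with
        | ⟨Sum.inl a, h⟩ => Sum.inl ⟨a, h⟩
        | ⟨Sum.inr (Sum.inl a), h⟩ => Sum.inr (Sum.inl ⟨a, (hn a).symm.trans h⟩)
        | ⟨Sum.inr (Sum.inr e), h⟩ => Sum.inr (Sum.inr ⟨e, h⟩)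
      invFun := Sum.elim (fun a => ⟨Sum.inl a.1, a.2⟩)
        (Sum.elim (fun a => ⟨Sum.inr (Sum.inl a.1), (hn a.1).trans a.2⟩)
          (fun e => ⟨Sum.inr (Sum.inr e.1), e.2⟩))
      left_inv := by rintro ⟨a | a | e, h⟩ <;> rfl
      right_inv := by rintro (a | a | e) <;> rfl }
  have hcq : GConn (Sum.elim sPq sq) (Sum.elim tPq tq) := by
    have := hc.comp_equiv φ.symm
    convert this using 1 <;> funext e <;> rcases e with a | e <;> rfl
  have h1 := (refines_split S hfnq (fun a => x a.1) (fun a => y a.1) (fun e => l e.1) hcq).comp_equiv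
    hcq (gconn_split hfnq hcq) φ φ'
  convert h1 using 1
  · funext e; rcases e with ⟨a | e, h⟩ <;> rfl
  · funext e; rcases e with ⟨a | e, h⟩ <;> rfl
  · funext e; rcases e with ⟨a | e, h⟩ <;> rfl
  · funext e; rcases e with ⟨a | a | e, h⟩ <;> rfl
  · funext e; rcases e with ⟨a | a | e, h⟩ <;> rfl
  · funext e; rcases e with ⟨a | a | e, h⟩ <;> rfl

/-- The new vertex of a split edge belongs to the component of that edge, so components before and
after correspond and each can be refined separately. -/
theorem Mtau_split (hfn : Function.Bijective (Sum.elim f n)) (x y : P → A) (l : E → A) :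
    Mtau S (Sum.elim sP s) (Sum.elim tP t) (Sum.elim (fun p => x p * y p) l) =
      ∑ ρ with Setoid.comap f ρ = ⊥ ∧ ρ ≤ Setoid.ker (GComp.mk
        (Sum.elim (f ∘ sP) (Sum.elim n (f ∘ s))) (Sum.elim n (Sum.elim (f ∘ tP) (f ∘ t)))),
      Mtau S (qmk ρ ∘ Sum.elim (f ∘ sP) (Sum.elim n (f ∘ s)))
        (qmk ρ ∘ Sum.elim n (Sum.elim (f ∘ tP) (f ∘ t))) (Sum.elim x (Sum.elim y l)) := by
  have hc := gconn_fib_of_injective (f := f) split_compat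
    (split_mk_injective hfn (sP := sP) (tP := tP) (s := s) (t := t)) (split_mk_surjective hfn)
  exact Mtau_refines S split_compat hc fun k =>
    fib_refines_split S hfn x y l _ split_compat (GComp.sound _ _) k (hc k)

end

def fibSumEquiv {α β : Type} (r : α ⊕ β → Prop) : {e // r e} ≃ {a // r (Sum.inl a)} ⊕ {b // r (Sum.inr b)} where
  toFun := fun e => match e with
    | ⟨Sum.inl a, h⟩ => Sum.inl ⟨a, h⟩
    | ⟨Sum.inr e, h⟩ => Sum.inr ⟨e, h⟩
  invFun := Sum.elim (fun a => ⟨Sum.inl a.1, a.2⟩) (fun e => ⟨Sum.inr e.1, e.2⟩)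
  left_inv := by rintro ⟨a | e, h⟩ <;> rfl
  right_inv := by rintro (a | e) <;> rfl

theorem Mtau_one_of_ne {v w : V} (hvw : v ≠ w) {s t : E → V} (l : E → A) :
    Mtau S (Sum.elim (fun _ : Unit => v) s) (Sum.elim (fun _ : Unit => w) t)
      (Sum.elim (fun _ : Unit => 1) l) = 0 := by
  set s' := (Sum.elim (fun _ : Unit => v) s) with hs'
  set t' := (Sum.elim (fun _ : Unit => w) t) with ht'
  rw [Mtau_eq_mul_erase S _ _ _ (GComp.mk s' t' v)]
  refine mul_eq_zero_of_left ?_ _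
  have hw : GComp.mk s' t' w = GComp.mk s' t' v := (GComp.sound s' t' (Sum.inl ())).symm
  have hst : ∀ e, GComp.mk s' t' (s e) = GComp.mk s' t' (t e) :=
    fun e => GComp.sound s' t' (Sum.inr e)
  have hc := gconn_fib s' t' (GComp.mk s' t' v)
  let V0 := {a : V // GComp.mk s' t' a = GComp.mk s' t' v}
  let φ : {e : Unit ⊕ E // GComp.mk s' t' (s' e) = GComp.mk s' t' v} ≃
      Unit ⊕ {e : E // GComp.mk s' t' (s e) = GComp.mk s' t' v} :=
    (fibSumEquiv _).trans (Equiv.sumCongr ⟨fun _ => (), fun _ => ⟨(), rfl⟩, fun _ => rfl,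
      fun _ => rfl⟩ (Equiv.refl _))
  have hc' : GConn (Sum.elim (fun _ : Unit => (⟨v, rfl⟩ : V0)) fun e => ⟨s e.1, e.2⟩)
      (Sum.elim (fun _ : Unit => (⟨w, hw⟩ : V0)) fun e :
        {e : E // GComp.mk s' t' (s e) = GComp.mk s' t' v} => ⟨t e.1, (hst e.1).symm.trans e.2⟩) := by
    convert hc.comp_equiv φ.symm using 1 <;> funext e <;> rcases e with a | e <;> rfl
  rw [← tau0_one_of_ne S (v := (⟨v, rfl⟩ : V0)) (w := ⟨w, hw⟩) (fun h => hvw (congrArg Subtype.val h))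
    (fun e : {e : E // GComp.mk s' t' (s e) = GComp.mk s' t' v} => l e.1) hc',
    ← tau0_comp_equiv S hc' φ]
  congr 1 <;> funext e <;> rcases e with ⟨a | e, h⟩ <;> rfl

theorem loop_compat {v : V} {s t : E → V} (e : Unit ⊕ E) :
    GComp.mk s t (Sum.elim (fun _ : Unit => v) s e) =
      GComp.mk s t (Sum.elim (fun _ : Unit => v) t e) := by
  rcases e with _ | e
  · rfl
  · exact GComp.sound s t e

theorem loop_mk_iff {v : V} {s t : E → V} (a b : V) :
    GComp.mk (Sum.elim (fun _ : Unit => v) s) (Sum.elim (fun _ : Unit => v) t) a = GComp.mk _ _ b ↔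
      GComp.mk s t a = GComp.mk s t b := by
  constructor
  · intro h
    exact GComp.eq_of_mk_eq h (GComp.mk s t) loop_compat
  · intro h
    exact GComp.eq_of_mk_eq h (GComp.mk _ _) fun e => GComp.sound (Sum.elim (fun _ : Unit => v) s)
      (Sum.elim (fun _ : Unit => v) t) (Sum.inr e)

theorem ccard_loop (v : V) (s t : E → V) :
    ccard (Sum.elim (fun _ : Unit => v) s) (Sum.elim (fun _ : Unit => v) t) = ccard s t := by
  refine Nat.card_congr (Equiv.ofBijective
    (GComp.lift (GComp.mk s t) loop_compat) ⟨?_, ?_⟩)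
  · intro x y hxy
    obtain ⟨a, rfl⟩ := GComp.mk_surjective _ _ x
    obtain ⟨b, rfl⟩ := GComp.mk_surjective _ _ y
    exact (loop_mk_iff a b).2 hxy
  · intro k
    obtain ⟨a, rfl⟩ := GComp.mk_surjective _ _ k
    exact ⟨GComp.mk _ _ a, rfl⟩

theorem Mtau_one_loop (v : V) (s t : E → V) (l : E → A) :
    Mtau S (Sum.elim (fun _ : Unit => v) s) (Sum.elim (fun _ : Unit => v) t)
      (Sum.elim (fun _ : Unit => 1) l) = Mtau S s t l := by
  rw [Mtau_eq_prod_fib S _ (GComp.mk s t) loop_compat, Mtau]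
  refine Finset.prod_congr rfl fun k _ => ?_
  have hc := gconn_fib s t k
  let φ := fibSumEquiv fun e => GComp.mk s t (Sum.elim (fun _ : Unit => v) s e) = k
  by_cases hk : GComp.mk s t v = k
  · let V0 := {a : V // GComp.mk s t a = k}
    let φ' : {e : Unit ⊕ E // GComp.mk s t (Sum.elim (fun _ : Unit => v) s e) = k} ≃
      Unit ⊕ {e : E // GComp.mk s t (s e) = k} :=
      φ.trans (Equiv.sumCongr ⟨fun _ => (), fun _ => ⟨(), hk⟩, fun _ => rfl, fun _ => rfl⟩
        (Equiv.refl _))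
    have hc' : GConn (Sum.elim (fun _ : Unit => (⟨v, hk⟩ : V0)) (fibS (GComp.mk s t) s k))
        (Sum.elim (fun _ : Unit => (⟨v, hk⟩ : V0)) (fibT (GComp.mk s t) s t (GComp.sound s t) k)) :=
      gconn_of_ccard (by rw [ccard_loop, ccard_eq_one hc])
    rw [← tau0_one_loop S _ hc', ← Mtau_of_gconn S hc']
    refine Mtau_iso S (Equiv.refl _) φ' ?_ ?_ ?_ <;> rintro ⟨a | e, h⟩ <;> rfl
  · have : IsEmpty {a : Unit // GComp.mk s t (Sum.elim (fun _ : Unit => v) s (Sum.inl a)) = k} :=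
      ⟨fun a => hk a.2⟩
    rw [← Mtau_of_gconn S hc]
    refine Mtau_iso S (Equiv.refl _) (φ.trans (Equiv.emptySum _ _)) ?_ ?_ ?_ <;>
      rintro ⟨a | e, h⟩ <;> first | exact absurd h hk | rfl

end Splitting

/-! ### Induction on polynomial labels -/

section Adjoin

/-- Induction principle for graphs labelled in a subalgebra. -/
theorem adjoin_graph_induction {R : Type u} [Ring R] [Algebra ℂ R] (L : Set R)
    (Pr : ∀ (V E : Type) [Finite V] [Finite E], (E → V) → (E → V) → (E → R) → Prop)
    (iso : ∀ (V E E' : Type) [Finite V] [Finite E] [Finite E'] (s t : E → V) (l : E → R)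
      (φ : E' ≃ E), Pr V E' (s ∘ φ) (t ∘ φ) (l ∘ φ) → Pr V E s t l)
    (base : ∀ (V E : Type) [Finite V] [Finite E] (s t : E → V) (l : E → R), (∀ e, l e ∈ L) →
      Pr V E s t l)
    (lin : ∀ (V E : Type) [Finite V] [Finite E] (v w : V) (s t : E → V) (l : E → R) (z : ℂ)
      (x y : R),
      Pr V (Unit ⊕ E) (Sum.elim (fun _ => v) s) (Sum.elim (fun _ => w) t) (Sum.elim (fun _ => x) l) →
      Pr V (Unit ⊕ E) (Sum.elim (fun _ => v) s) (Sum.elim (fun _ => w) t) (Sum.elim (fun _ => y) l) →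
      Pr V (Unit ⊕ E) (Sum.elim (fun _ => v) s) (Sum.elim (fun _ => w) t)
        (Sum.elim (fun _ => z • x + y) l))
    (mul : ∀ (V E : Type) [Finite V] [Finite E] (v w : V) (s t : E → V) (l : E → R) (x y : R),
      (∀ (W : Type) [Finite W] (f : V ⊕ Unit → W), Function.Surjective f →
        Pr W (Unit ⊕ (Unit ⊕ E))
          (f ∘ Sum.elim (fun _ => Sum.inl v) (Sum.elim Sum.inr (Sum.inl ∘ s)))
          (f ∘ Sum.elim Sum.inr (Sum.elim (fun _ => Sum.inl w) (Sum.inl ∘ t)))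
          (Sum.elim (fun _ => x) (Sum.elim (fun _ => y) l))) →
      Pr V (Unit ⊕ E) (Sum.elim (fun _ => v) s) (Sum.elim (fun _ => w) t)
        (Sum.elim (fun _ => x * y) l))
    (one : ∀ (V E : Type) [Finite V] [Finite E] (v w : V) (s t : E → V) (l : E → R),
      (∀ (W : Type) [Finite W] (f : V → W), Function.Surjective f → f v = f w →
        Pr W E (f ∘ s) (f ∘ t) l) →
      Pr V (Unit ⊕ E) (Sum.elim (fun _ => v) s) (Sum.elim (fun _ => w) t)
        (Sum.elim (fun _ => 1) l)) :
    ∀ (V E : Type) [Finite V] [Finite E] (s t : E → V) (l : E → R),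
      (∀ e, l e ∈ Algebra.adjoin ℂ L) → Pr V E s t l := by
  -- The induction is on the number of edges whose label is not in `L`.
  suffices H : ∀ (n : ℕ) (V E : Type) [Finite V] [Finite E] (s t : E → V) (l : E → R),
      (∀ e, l e ∈ Algebra.adjoin ℂ L) → Nat.card {e // l e ∉ L} ≤ n → Pr V E s t l from
    fun V E _ _ s t l hl => H _ V E s t l hl le_rfl
  intro n
  induction n with
  | zero =>
    intro V E _ _ s t l hl hn
    refine base V E s t l fun e => ?_
    by_contra he
    have := (Nat.card_eq_zero.1 (Nat.le_zero.1 hn)).resolve_right (not_infinite_iff_finite.2 inferInstance)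
    exact this.false ⟨e, he⟩
  | succ n ih =>
    -- One edge with an arbitrary label `x` is set apart, at most `n` other labels being outside
    -- `L`; `x` is then built as a linear combination of words in `L`.
    have key : ∀ x ∈ Algebra.adjoin ℂ L, ∀ (V E : Type) [Finite V] [Finite E] (v w : V)
        (s t : E → V) (l : E → R), (∀ e, l e ∈ Algebra.adjoin ℂ L) → Nat.card {e // l e ∉ L} ≤ n →
        Pr V (Unit ⊕ E) (Sum.elim (fun _ => v) s) (Sum.elim (fun _ => w) t)
          (Sum.elim (fun _ => x) l) := by
      have h1 : ∀ (V E : Type) [Finite V] [Finite E] (v w : V)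
          (s t : E → V) (l : E → R), (∀ e, l e ∈ Algebra.adjoin ℂ L) → Nat.card {e // l e ∉ L} ≤ n →
          Pr V (Unit ⊕ E) (Sum.elim (fun _ => v) s) (Sum.elim (fun _ => w) t)
            (Sum.elim (fun _ => 1) l) := by
        intro V E _ _ v w s t l hl hn
        exact one V E v w s t l fun W _ f _ _ => ih W E _ _ l hl hn
      have h0 : ∀ (V E : Type) [Finite V] [Finite E] (v w : V)
          (s t : E → V) (l : E → R), (∀ e, l e ∈ Algebra.adjoin ℂ L) → Nat.card {e // l e ∉ L} ≤ n →
          Pr V (Unit ⊕ E) (Sum.elim (fun _ => v) s) (Sum.elim (fun _ => w) t)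
            (Sum.elim (fun _ => 0) l) := by
        intro V E _ _ v w s t l hl hn
        -- The label `0` is obtained as `(-1) • 1 + 1`.
        have := lin V E v w s t l (-1) 1 1 (h1 V E v w s t l hl hn) (h1 V E v w s t l hl hn)
        simpa using this
      intro x hx
      rw [← Subalgebra.mem_toSubmodule, Algebra.adjoin_eq_span] at hx
      induction hx using Submodule.span_induction with
      | mem x hx =>
        induction hx using Submonoid.closure_induction_left with
        | one => exact h1
        | mul_left y hy x hx ihx =>
          intro V E _ _ v w s t l hl hn
          refine mul V E v w s t l y x fun W _ f _ => ?_
          -- The two halves of the split edge are exchanged, so that the remaining word is the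
          -- distinguished label. The letter `y` lies in `L` and does not increase the count.
          let φ : Unit ⊕ (Unit ⊕ E) ≃ Unit ⊕ (Unit ⊕ E) :=
            ⟨Sum.elim (fun a => Sum.inr (Sum.inl a)) (Sum.elim Sum.inl fun e => Sum.inr (Sum.inr e)),
            Sum.elim (fun a => Sum.inr (Sum.inl a)) (Sum.elim Sum.inl fun e => Sum.inr (Sum.inr e)),
            by rintro (a | a | a) <;> rfl, by rintro (a | a | a) <;> rfl⟩
          refine iso _ _ _ _ _ _ φ ?_
          have := ihx W (Unit ⊕ E) (f (Sum.inr ())) (f (Sum.inl w))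
            (Sum.elim (fun _ => f (Sum.inl v)) (fun e => f (Sum.inl (s e))))
            (Sum.elim (fun _ => f (Sum.inr ())) (fun e => f (Sum.inl (t e))))
            (Sum.elim (fun _ => y) l) ?_ ?_
          · convert this using 1 <;> funext e <;> rcases e with a | a | a <;> rfl
          · rintro (a | e)
            · exact Algebra.subset_adjoin hy
            · exact hl e
          · have : IsEmpty {a : Unit // Sum.elim (fun _ => y) l (Sum.inl a) ∉ L} := ⟨fun a => a.2 hy⟩
            rw [Nat.card_congr ((fibSumEquiv fun e => Sum.elim (fun _ : Unit => y) l e ∉ L).trans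
              (Equiv.emptySum _ _))]
            exact hn
      | zero => exact h0
      | add x y _ _ hx hy =>
        intro V E _ _ v w s t l hl hn
        have := lin V E v w s t l 1 x y (hx V E v w s t l hl hn) (hy V E v w s t l hl hn)
        rwa [one_smul] at this
      | smul z x _ hx =>
        intro V E _ _ v w s t l hl hn
        have := lin V E v w s t l z x 0 (hx V E v w s t l hl hn) (h0 V E v w s t l hl hn)
        rwa [add_zero] at this
    intro V E _ _ s t l hl hn
    by_cases hb : ∀ e, l e ∈ L
    · exact base V E s t l hb
    · push Not at hb
      obtain ⟨e0, he0⟩ := hb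
      let φ : Unit ⊕ {e // e ≠ e0} ≃ E :=
        ⟨Sum.elim (fun _ => e0) Subtype.val, fun e => if h : e = e0 then Sum.inl () else Sum.inr ⟨e, h⟩,
        by
          rintro (a | ⟨e, he⟩)
          · simp
          · simp [he], by
          intro e
          by_cases h : e = e0 <;> simp [h]⟩
      refine iso _ _ _ _ _ _ φ ?_
      have := key (l e0) (hl e0) V {e // e ≠ e0} (s e0) (t e0) (fun e => s e.1) (fun e => t e.1)
        (fun e => l e.1) (fun e => hl _) ?_
      · convert this using 1 <;> funext e <;> rcases e with a | a <;> rfl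
      · have h2 : Nat.card {e : {e // e ≠ e0} // l e.1 ∉ L} < Nat.card {e // l e ∉ L} := by
          rw [Nat.card_congr (((φ.subtypeEquiv (p := fun e => l (φ e) ∉ L) fun _ => Iff.rfl).symm).trans
            (fibSumEquiv fun e => l (φ e) ∉ L)), Nat.card_sum]
          have h3 : 0 < Nat.card {a : Unit // l (φ (Sum.inl a)) ∉ L} :=
            Nat.card_pos_iff.2 ⟨⟨⟨(), he0⟩⟩, inferInstance⟩
          exact Nat.lt_add_of_pos_left h3
        omega

end Adjoin

/-! ### Linearity in one label -/

section Linear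

variable {A : Type u} [Ring A] [StarRing A] [Algebra ℂ A] [StarModule ℂ A] (S : TrafficSpace A)
variable {V E : Type} [Finite V] [Finite E]

theorem tau_lin {s t : E → V} (h : GConn s t) {l l₁ l₂ : E → A} (e : E) (z : ℂ)
    (hl : l e = z • l₁ e + l₂ e) (h₁ : ∀ e' ≠ e, l₁ e' = l e') (h₂ : ∀ e' ≠ e, l₂ e' = l e') :
    tau S s t l = z * tau S s t l₁ + tau S s t l₂ := by
  rw [tau_add S h (l₁ := Function.update l e (z • l₁ e)) e (by simpa using hl)
    (fun e' he => by simp [he]) h₂, tau_smul S h (l₁ := l₁) e z (by simp)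
    (fun e' he => by simp [he, h₁ e' he])]

theorem tau0_lin {s t : E → V} (h : GConn s t) {l l₁ l₂ : E → A} (e : E) (z : ℂ)
    (hl : l e = z • l₁ e + l₂ e) (h₁ : ∀ e' ≠ e, l₁ e' = l e') (h₂ : ∀ e' ≠ e, l₂ e' = l e') :
    tau0 S s t l = z * tau0 S s t l₁ + tau0 S s t l₂ := by
  rw [tau0_add S h (l₁ := Function.update l e (z • l₁ e)) e (by simpa using hl)
    (fun e' he => by simp [he]) h₂, tau0_smul S h (l₁ := l₁) e z (by simp)
    (fun e' he => by simp [he, h₁ e' he])]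

theorem Mtau_lin (s t : E → V) {l l₁ l₂ : E → A} (e : E) (z : ℂ)
    (hl : l e = z • l₁ e + l₂ e) (h₁ : ∀ e' ≠ e, l₁ e' = l e') (h₂ : ∀ e' ≠ e, l₂ e' = l e') :
    Mtau S s t l = z * Mtau S s t l₁ + Mtau S s t l₂ := by
  rw [Mtau_add S s t (l₁ := Function.update l e (z • l₁ e)) e (by simpa using hl)
    (fun e' he => by simp [he]) h₂, Mtau_smul S s t (l₁ := l₁) e z (by simp)
    (fun e' he => by simp [he, h₁ e' he])]

end Linear

/-! ### Traffic-freeness in counting form, and generated algebras -/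

section TFree

variable {A : Type u} [Ring A] [StarRing A] [Algebra ℂ A] [StarModule ℂ A] (S : TrafficSpace A)

/-- The condition of traffic-freeness, for graphs whose edges are labelled in `L₁` or in `L₂`. The
graph is a free product if and only if its monochromatic components (isolated vertices included)
number one more than its vertices. -/
def TFree (L₁ L₂ : Set A) : Prop :=
  ∀ (V E₁ E₂ : Type) [Finite V] [Finite E₁] [Finite E₂] (s₁ t₁ : E₁ → V) (s₂ t₂ : E₂ → V)
    (l₁ : E₁ → A) (l₂ : E₂ → A), (∀ e, l₁ e ∈ L₁) → (∀ e, l₂ e ∈ L₂) →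
    GConn (Sum.elim s₁ s₂) (Sum.elim t₁ t₂) →
    tau0 S (Sum.elim s₁ s₂) (Sum.elim t₁ t₂) (Sum.elim l₁ l₂) =
      if ccard s₁ t₁ + ccard s₂ t₂ = Nat.card V + 1 then Mtau S s₁ t₁ l₁ * Mtau S s₂ t₂ l₂ else 0

variable {S}

theorem TFree.mono {L₁ L₂ L₁' L₂' : Set A} (h : TFree S L₁ L₂) (h₁ : L₁' ⊆ L₁) (h₂ : L₂' ⊆ L₂) :
    TFree S L₁' L₂' := fun V E₁ E₂ _ _ _ s₁ t₁ s₂ t₂ l₁ l₂ hl₁ hl₂ hc =>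
  h V E₁ E₂ s₁ t₁ s₂ t₂ l₁ l₂ (fun e => h₁ (hl₁ e)) (fun e => h₂ (hl₂ e)) hc

theorem TFree.symm {L₁ L₂ : Set A} (h : TFree S L₁ L₂) : TFree S L₂ L₁ := by
  intro V E₁ E₂ _ _ _ s₁ t₁ s₂ t₂ l₁ l₂ hl₁ hl₂ hc
  have hc' : GConn (Sum.elim s₂ s₁) (Sum.elim t₂ t₁) := by
    convert hc.comp_equiv (Equiv.sumComm E₂ E₁) using 1 <;> funext e <;> rcases e with e | e <;> rfl
  have := h V E₂ E₁ s₂ t₂ s₁ t₁ l₂ l₁ hl₂ hl₁ hc'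
  rw [add_comm, mul_comm, ← this, ← tau0_comp_equiv S hc (Equiv.sumComm E₂ E₁)]
  congr 1 <;> funext e <;> rcases e with e | e <;> rfl

/-- Both sides obey the same rules in the label of one edge. Linearity is immediate. A unit edge
that is not a loop kills both sides, and a unit loop can be dropped from both. For a product, each
side is a sum over the gluings of the middle vertex, and the terms match. -/
theorem TFree.adjoin {L₁ L₂ : Set A} (h : TFree S L₁ L₂) :
    TFree S L₁ (Algebra.adjoin ℂ L₂ : Subalgebra ℂ A) := by
  intro V E₁ E₂ _ _ _ s₁ t₁ s₂ t₂ l₁ l₂ hl₁ hl₂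
  refine adjoin_graph_induction L₂ (fun V E₂ _ _ s₂ t₂ l₂ => ∀ (E₁ : Type) [Finite E₁]
    (s₁ t₁ : E₁ → V) (l₁ : E₁ → A), (∀ e, l₁ e ∈ L₁) → GConn (Sum.elim s₁ s₂) (Sum.elim t₁ t₂) →
    tau0 S (Sum.elim s₁ s₂) (Sum.elim t₁ t₂) (Sum.elim l₁ l₂) =
      if ccard s₁ t₁ + ccard s₂ t₂ = Nat.card V + 1 then Mtau S s₁ t₁ l₁ * Mtau S s₂ t₂ l₂ else 0)
    ?_ ?_ ?_ ?_ ?_ V E₂ s₂ t₂ l₂ hl₂ E₁ s₁ t₁ l₁ hl₁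
  · intro V E E' _ _ _ s t l φ H E₁ _ s₁ t₁ l₁ hl₁ hc
    have hc' : GConn (Sum.elim s₁ (s ∘ φ)) (Sum.elim t₁ (t ∘ φ)) := by
      convert hc.comp_equiv ((Equiv.refl E₁).sumCongr φ) using 1 <;> funext e <;>
        rcases e with e | e <;> rfl
    have H := H E₁ s₁ t₁ l₁ hl₁ hc'
    rw [Mtau_iso S (s := s ∘ φ) (t := t ∘ φ) (l := l ∘ φ) (s' := s) (t' := t) (l' := l)
      (Equiv.refl V) φ (fun _ => rfl) (fun _ => rfl) (fun _ => rfl),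
      ccard_iso (s := s ∘ φ) (t := t ∘ φ) (s' := s) (t' := t)
      (Equiv.refl V) φ (fun _ => rfl) (fun _ => rfl)] at H
    rw [← H, ← tau0_comp_equiv S hc ((Equiv.refl E₁).sumCongr φ)]
    congr 1 <;> funext e <;> rcases e with e | e <;> rfl
  · intro V E _ _ s t l hl E₁ _ s₁ t₁ l₁ hl₁ hc
    exact h V E₁ E s₁ t₁ s t l₁ l hl₁ hl hc
  · intro V E _ _ v w s t l z x y Hx Hy E₁ _ s₁ t₁ l₁ hl₁ hc
    have Hx := Hx E₁ s₁ t₁ l₁ hl₁ hc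
    have Hy := Hy E₁ s₁ t₁ l₁ hl₁ hc
    rw [tau0_lin S hc (l₁ := Sum.elim l₁ (Sum.elim (fun _ => x) l))
      (l₂ := Sum.elim l₁ (Sum.elim (fun _ => y) l)) (Sum.inr (Sum.inl ())) z rfl
      (by rintro (e | _ | e) he <;> first | rfl | exact absurd rfl he)
      (by rintro (e | _ | e) he <;> first | rfl | exact absurd rfl he),
      Mtau_lin S _ _ (l := Sum.elim (fun _ => z • x + y) l) (l₁ := Sum.elim (fun _ => x) l)
      (l₂ := Sum.elim (fun _ => y) l) (Sum.inl ()) z rfl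
      (by rintro (_ | e) he <;> first | rfl | exact absurd rfl he)
      (by rintro (_ | e) he <;> first | rfl | exact absurd rfl he), Hx, Hy]
    split_ifs <;> ring
  · intro V E _ _ v w s t l x y H E₁ _ s₁ t₁ l₁ hl₁ hc
    let φ : Unit ⊕ (E₁ ⊕ E) ≃ E₁ ⊕ (Unit ⊕ E) :=
      ⟨Sum.elim (fun a => Sum.inr (Sum.inl a)) (Sum.elim Sum.inl fun e => Sum.inr (Sum.inr e)),
      Sum.elim (fun a => Sum.inr (Sum.inl a)) (Sum.elim Sum.inl fun e => Sum.inr (Sum.inr e)),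
      by rintro (a | a | a) <;> rfl, by rintro (a | a | a) <;> rfl⟩
    let ψ : E₁ ⊕ (Unit ⊕ (Unit ⊕ E)) ≃ Unit ⊕ (Unit ⊕ (E₁ ⊕ E)) :=
      ⟨Sum.elim (fun e => Sum.inr (Sum.inr (Sum.inl e))) (Sum.elim Sum.inl
        (Sum.elim (fun a => Sum.inr (Sum.inl a)) fun e => Sum.inr (Sum.inr (Sum.inr e)))),
      Sum.elim (fun a => Sum.inr (Sum.inl a)) (Sum.elim (fun a => Sum.inr (Sum.inr (Sum.inl a)))
        (Sum.elim Sum.inl fun e => Sum.inr (Sum.inr (Sum.inr e)))),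
      by rintro (a | a | a | a) <;> rfl, by rintro (a | a | a | a) <;> rfl⟩
    have hfn : Function.Bijective
        (Sum.elim Sum.inl Sum.inr : V ⊕ Unit → V ⊕ Unit) := by
      rw [Sum.elim_inl_inr]; exact Function.bijective_id
    have hc' : GConn (Sum.elim (fun _ : Unit => v) (Sum.elim s₁ s))
        (Sum.elim (fun _ : Unit => w) (Sum.elim t₁ t)) := by
      convert hc.comp_equiv φ using 1 <;> funext e <;> rcases e with e | e | e <;> rfl
    have hA : tau0 S (Sum.elim s₁ (Sum.elim (fun _ : Unit => v) s))
        (Sum.elim t₁ (Sum.elim (fun _ : Unit => w) t)) (Sum.elim l₁ (Sum.elim (fun _ => x * y) l)) =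
        tau0 S (Sum.elim (fun _ : Unit => v) (Sum.elim s₁ s))
        (Sum.elim (fun _ : Unit => w) (Sum.elim t₁ t))
        (Sum.elim (fun _ => x * y) (Sum.elim l₁ l)) := by
      rw [← tau0_comp_equiv S hc φ]
      congr 1 <;> funext e <;> rcases e with e | e | e <;> rfl
    have hsplit := gconn_split hfn hc'
    rw [hA, (refines_split S hfn (fun _ => x) (fun _ => y) (Sum.elim l₁ l) hc').tau0_eq hsplit,
      Mtau_split S hfn (fun _ => x) (fun _ => y) l]
    -- The tree condition for the glued graph splits in two. Vertices outside the image of `V` are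
    -- isolated for the first colour, so it compares a sum of two component counts with `|V| + 1`.
    -- That sum is bounded by its value before gluing, itself at most `|V| + 1`. Equality thus means
    -- that the original graph is a free product and that `ρ` glues inside components of the second
    -- colour.
    have hle := ccard_add_le s₁ t₁ (Sum.elim (fun _ : Unit => v) s) (Sum.elim (fun _ : Unit => w) t)
    rw [ccard_eq_one hc] at hle
    rw [Finset.sum_congr rfl (g := fun ρ => if
      (ρ ≤ Setoid.ker (GComp.mk
        (Sum.elim (Sum.inl ∘ fun _ => v) (Sum.elim Sum.inr (Sum.inl ∘ s)))
        (Sum.elim Sum.inr (Sum.elim (Sum.inl ∘ fun _ => w) (Sum.inl ∘ t)))) ∧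
      ccard s₁ t₁ + ccard (Sum.elim (fun _ : Unit => v) s) (Sum.elim (fun _ : Unit => w) t) =
        Nat.card V + 1) then Mtau S s₁ t₁ l₁ * Mtau S (qmk ρ ∘ Sum.elim (Sum.inl ∘ fun _ => v) (Sum.elim Sum.inr (Sum.inl ∘ s)))
        (qmk ρ ∘ Sum.elim Sum.inr (Sum.elim (Sum.inl ∘ fun _ => w) (Sum.inl ∘ t)))
        (Sum.elim (fun _ : Unit => x) (Sum.elim (fun _ : Unit => y) l)) else 0) ?_]
    · split_ifs with h0
      · simp only [h0, and_true]
        rw [← Finset.sum_filter, Finset.filter_filter, Finset.mul_sum]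
      · simp [h0]
    · intro ρ hρ
      have hj : Function.Injective (qmk ρ ∘ Sum.inl : V → Quotient ρ) := by
        intro a b hab
        have : Setoid.comap Sum.inl ρ a b := (qmk_eq_iff (σ := ρ)).1 hab
        rw [(Finset.mem_filter.1 hρ).2] at this
        exact this
      have hg := (hsplit.map (qmk_surjective ρ)).comp_equiv ψ
      have hr := ccard_map_eq_iff (Sum.elim (Sum.inl ∘ fun _ => v) (Sum.elim Sum.inr (Sum.inl ∘ s)))
        (Sum.elim Sum.inr (Sum.elim (Sum.inl ∘ fun _ => w) (Sum.inl ∘ t))) (qmk_surjective ρ)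
      have hr' := ccard_map_le (Sum.elim (Sum.inl ∘ fun _ => v) (Sum.elim Sum.inr (Sum.inl ∘ s)))
        (Sum.elim Sum.inr (Sum.elim (Sum.inl ∘ fun _ => w) (Sum.inl ∘ t))) (qmk_surjective ρ)
      rw [ccard_split hfn, ker_qmk] at hr
      rw [ccard_split hfn] at hr'
      have hi := ccard_injective hj s₁ t₁
      have := H (Quotient ρ) (qmk ρ) (qmk_surjective ρ) E₁ (qmk ρ ∘ Sum.inl ∘ s₁)
        (qmk ρ ∘ Sum.inl ∘ t₁) l₁ hl₁ (by
          convert hg using 1 <;> funext e <;> rcases e with e | e | e | e <;> rfl)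
      rw [← tau0_comp_equiv S (hsplit.map (qmk_surjective ρ)) ψ]
      trans
      · refine Eq.trans ?_ this
        congr 1 <;> funext e <;> rcases e with e | e | e | e <;> rfl
      · refine if_congr ?_ ?_ rfl
        · rw [← hr]
          change ccard ((qmk ρ ∘ Sum.inl) ∘ s₁) ((qmk ρ ∘ Sum.inl) ∘ t₁) +
            ccard (qmk ρ ∘ Sum.elim (Sum.inl ∘ fun _ => v) (Sum.elim Sum.inr (Sum.inl ∘ s)))
              (qmk ρ ∘ Sum.elim Sum.inr (Sum.elim (Sum.inl ∘ fun _ => w) (Sum.inl ∘ t))) = _ ↔ _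
          omega
        · exact congrArg (· * _) (Mtau_injective S hj s₁ t₁ l₁)
  · intro V E _ _ v w s t l H E₁ _ s₁ t₁ l₁ hl₁ hc
    let φ : Unit ⊕ (E₁ ⊕ E) ≃ E₁ ⊕ (Unit ⊕ E) :=
      ⟨Sum.elim (fun a => Sum.inr (Sum.inl a)) (Sum.elim Sum.inl fun e => Sum.inr (Sum.inr e)),
      Sum.elim (fun a => Sum.inr (Sum.inl a)) (Sum.elim Sum.inl fun e => Sum.inr (Sum.inr e)),
      by rintro (a | a | a) <;> rfl, by rintro (a | a | a) <;> rfl⟩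
    have hc' : GConn (Sum.elim (fun _ : Unit => v) (Sum.elim s₁ s))
        (Sum.elim (fun _ : Unit => w) (Sum.elim t₁ t)) := by
      convert hc.comp_equiv φ using 1 <;> funext e <;> rcases e with e | e | e <;> rfl
    have hA : tau0 S (Sum.elim s₁ (Sum.elim (fun _ : Unit => v) s))
        (Sum.elim t₁ (Sum.elim (fun _ : Unit => w) t)) (Sum.elim l₁ (Sum.elim (fun _ => 1) l)) =
        tau0 S (Sum.elim (fun _ : Unit => v) (Sum.elim s₁ s))
        (Sum.elim (fun _ : Unit => w) (Sum.elim t₁ t))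
        (Sum.elim (fun _ => 1) (Sum.elim l₁ l)) := by
      rw [← tau0_comp_equiv S hc φ]
      congr 1 <;> funext e <;> rcases e with e | e | e <;> rfl
    rw [hA]
    by_cases hvw : v = w
    · subst hvw
      rw [tau0_one_loop S _ hc', Mtau_one_loop S, ccard_loop]
      exact H V id Function.surjective_id rfl E₁ s₁ t₁ l₁ hl₁
        ⟨hc'.1, fun a b => (loop_mk_iff a b).1 (hc'.2 a b)⟩
    · rw [tau0_one_of_ne S hvw _ hc', Mtau_one_of_ne S hvw, mul_zero, ite_self]

end TFree

/-! ### Equality of distributions on generated algebras -/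

section SameDistribution

variable {A : Type u} [Ring A] [StarRing A] [Algebra ℂ A] [StarModule ℂ A] (S : TrafficSpace A)
variable {B : Type v} [Ring B] [StarRing B] [Algebra ℂ B] [StarModule ℂ B] (S' : TrafficSpace B)

/-- Labels in `A × B` carry the same polynomial evaluated in both spaces, so a single induction
rewrites both traces in parallel. -/
theorem tau_eq_of_mem_adjoin (L : Set (A × B))
    (base : ∀ (V E : Type) [Finite V] [Finite E] (s t : E → V) (l : E → A × B), (∀ e, l e ∈ L) →
      GConn s t → tau S s t (fun e => (l e).1) = tau S' s t (fun e => (l e).2))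
    (V E : Type) [Finite V] [Finite E] (s t : E → V) (l : E → A × B)
    (hl : ∀ e, l e ∈ Algebra.adjoin ℂ L) (hc : GConn s t) :
    tau S s t (fun e => (l e).1) = tau S' s t (fun e => (l e).2) := by
  refine adjoin_graph_induction L (fun V E _ _ s t l => GConn s t →
    tau S s t (fun e => (l e).1) = tau S' s t (fun e => (l e).2)) ?_ base ?_ ?_ ?_ V E s t l hl hc
  · intro V E E' _ _ _ s t l φ H hc
    have := H (hc.comp_equiv φ)
    rwa [← tau_comp_equiv S hc φ, ← tau_comp_equiv S' hc φ]
  · intro V E _ _ v w s t l z x y Hx Hy hc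
    rw [tau_lin S hc (l := fun e => (Sum.elim (fun _ => z • x + y) l e).1)
        (l₁ := fun e => (Sum.elim (fun _ => x) l e).1)
        (l₂ := fun e => (Sum.elim (fun _ => y) l e).1) (Sum.inl ()) z rfl
        (by rintro (_ | e) he <;> first | rfl | exact absurd rfl he)
        (by rintro (_ | e) he <;> first | rfl | exact absurd rfl he),
      tau_lin S' hc (l := fun e => (Sum.elim (fun _ => z • x + y) l e).2)
        (l₁ := fun e => (Sum.elim (fun _ => x) l e).2)
        (l₂ := fun e => (Sum.elim (fun _ => y) l e).2) (Sum.inl ()) z rfl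
        (by rintro (_ | e) he <;> first | rfl | exact absurd rfl he)
        (by rintro (_ | e) he <;> first | rfl | exact absurd rfl he), Hx hc, Hy hc]
  · intro V E _ _ v w s t l x y H hc
    have hfn : Function.Bijective (Sum.elim Sum.inl Sum.inr : V ⊕ Unit → V ⊕ Unit) := by
      rw [Sum.elim_inl_inr]; exact Function.bijective_id
    have H := H (V ⊕ Unit) id Function.surjective_id (gconn_split hfn hc)
    have h1 := tau_split S (fun _ : Unit => x.1) (fun _ => y.1) (fun e => (l e).1) hc
    have h2 := tau_split S' (fun _ : Unit => x.2) (fun _ => y.2) (fun e => (l e).2) hc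
    refine Eq.trans ?_ (h1.trans (Eq.trans ?_ (h2.symm.trans ?_)))
    · congr 1; funext e; rcases e with e | e <;> rfl
    · refine Eq.trans ?_ (H.trans ?_) <;> congr 1 <;> funext e <;> rcases e with e | e | e <;> rfl
    · congr 1; funext e; rcases e with e | e <;> rfl
  · intro V E _ _ v w s t l H hc
    let σ : Setoid V := Relation.EqvGen.setoid fun a b => a = v ∧ b = w
    have hvw : qmk σ v = qmk σ w := qmk_eq_iff.2 (Relation.EqvGen.rel _ _ ⟨rfl, rfl⟩)
    have hmin : ∀ a b, qmk σ a = qmk σ b → ∀ ρ : Setoid V, ρ v w → ρ a b := by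
      intro a b hab ρ hρ
      have hle : σ ≤ ρ := Setoid.eqvGen_le fun a b h => by rw [h.1, h.2]; exact hρ
      exact hle (qmk_eq_iff.1 hab)
    have hc2 : GConn (qmk σ ∘ s) (qmk σ ∘ t) := by
      have := hc.map (qmk_surjective σ)
      refine ⟨this.1, fun a b => GComp.eq_of_mk_eq (this.2 a b) _ ?_⟩
      rintro (e | e)
      · exact congrArg _ hvw
      · exact GComp.sound (qmk σ ∘ s) (qmk σ ∘ t) e
    have H := H (Quotient σ) (qmk σ) (qmk_surjective σ) hvw hc2
    have h1 := tau_one S (fun e => (l e).1) hc (qmk_surjective σ) hvw hmin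
    have h2 := tau_one S' (fun e => (l e).2) hc (qmk_surjective σ) hvw hmin
    refine Eq.trans ?_ (h1.trans (H.trans (h2.symm.trans ?_)))
    · congr 1; funext e; rcases e with e | e <;> rfl
    · congr 1; funext e; rcases e with e | e <;> rfl

/-- The elements of a family and their adjoints. -/
def starSet {A : Type u} [Star A] {J : Type w} (a : J → A) : Set A :=
  Set.range fun p : J × Bool => starPow (a p.1) p.2

theorem tau_pair_of_sameDistribution {J : Type w} {a : J → A} {b : J → B}
    (h : S.SameDistribution a S' b) (V E : Type) [Finite V] [Finite E] (s t : E → V)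
    (l : E → A × B)
    (hl : ∀ e, l e ∈ Set.range fun p : J × Bool => (starPow (a p.1) p.2, starPow (b p.1) p.2))
    (hc : GConn s t) : tau S s t (fun e => (l e).1) = tau S' s t (fun e => (l e).2) := by
  choose p hp using hl
  let T : StarGraph J := ⟨V, E, inferInstance, inferInstance, s, t, fun e => (p e).1,
    fun e => (p e).2⟩
  have hT : T.Connected := (connected_iff_gconn T).2 hc
  have h1 := h T hT
  rw [tau_eq_of_connected S (T.map a) hT, tau_eq_of_connected S' (T.map b) hT] at h1
  simp only [← hp]
  exact h1

/-- Each label is lifted to the algebra generated by the pairs and then projected to `B`. The lift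
is chosen once per label, before the graph, so the same `y` serves for all quotients of a graph. -/
theorem exists_pair_of_sameDistribution {J : Type w} {a : J → A} {b : J → B}
    (h : S.SameDistribution a S' b) {E : Type} (x : E → A) (hx : ∀ e, x e ∈ Algebra.adjoin ℂ (starSet a)) :
    ∃ y : E → B, (∀ e, y e ∈ Algebra.adjoin ℂ (starSet b)) ∧
      ∀ (V' E' : Type) [Finite V'] [Finite E'] (s t : E' → V') (φ : E' → E), GConn s t →
        tau S s t (fun e => x (φ e)) = tau S' s t (fun e => y (φ e)) := by
  let L : Set (A × B) := Set.range fun p : J × Bool => (starPow (a p.1) p.2, starPow (b p.1) p.2)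
  have h1 : starSet a = AlgHom.fst ℂ A B '' L := by
    rw [← Set.range_comp]; rfl
  have h2 : starSet b = AlgHom.snd ℂ A B '' L := by
    rw [← Set.range_comp]; rfl
  have h3 : ∀ e, ∃ y : B, (x e, y) ∈ Algebra.adjoin ℂ L := by
    intro e
    have := hx e
    rw [h1, ← AlgHom.map_adjoin, Subalgebra.mem_map] at this
    obtain ⟨⟨z, y⟩, hz, rfl⟩ := this
    exact ⟨y, hz⟩
  choose y hy using h3
  refine ⟨y, fun e => ?_, fun V' E' _ _ s t φ hc => ?_⟩
  · rw [h2, ← AlgHom.map_adjoin, Subalgebra.mem_map]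
    exact ⟨_, hy e, rfl⟩
  · exact tau_eq_of_mem_adjoin S S' L (fun V E _ _ s t l hl hc =>
      tau_pair_of_sameDistribution S S' h V E s t l hl hc) V' E' s t
      (fun e => (x (φ e), y (φ e))) (fun e => hy _) hc

end SameDistribution

/-! ### The trace of a product as a cycle -/

section Cycles

variable {A : Type u} [Ring A] [StarRing A] [Algebra ℂ A] [StarModule ℂ A] (S : TrafficSpace A)

theorem gconn_unit {E : Type} (s t : E → Unit) : GConn s t := ⟨⟨()⟩, fun _ _ => rfl⟩

theorem Phi_eq_tau (x : A) :
    S.Φ x = tau S (fun _ : Unit => ()) (fun _ => ()) (fun _ => x) := by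
  have h0 := S.compatibility [(x, false)]
  have hx : ([(x, false)].map fun p : A × Bool => starPow p.1 p.2).prod = x := by simp [starPow]
  rw [hx] at h0
  let T := BiGraph.path [(x, false)]
  have hT : T.Connected := path_connected _
  have hg : GConn T.close.src T.close.tgt :=
    ((connected_iff_gconn _).1 hT).map (f := Quot.mk fun v w => v = T.inp ∧ w = T.out) Quot.mk_surjective
  rw [show S.Φ x = S.Φ (S.eval T) from congrArg S.Φ h0.symm, S.state _ hT, tau_eq_of_connected S T.close ((connected_iff_gconn _).2 hg)]
  have hsub : ∀ v w : T.close.V, v = w := by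
    have h01 : (Quot.mk _ (0 : Fin 2) : T.close.V) = Quot.mk _ (1 : Fin 2) :=
      Quot.sound ⟨rfl, rfl⟩
    intro v w
    obtain ⟨v, rfl⟩ := Quot.mk_surjective v
    obtain ⟨w, rfl⟩ := Quot.mk_surjective w
    have : ∀ v : Fin 2, (Quot.mk _ v : T.close.V) = Quot.mk _ (0 : Fin 2) := by
      intro v; fin_cases v
      · rfl
      · exact h01.symm
    exact (this v).trans (this w).symm
  refine tau_iso S hg (W := Unit) (F := Unit) ⟨fun _ => (), fun _ => Quot.mk _ (0 : Fin 2), fun v => hsub _ _,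
    fun _ => rfl⟩ ⟨fun _ => (), fun _ => (0 : Fin 1), fun e => Subsingleton.elim (α := Fin 1) _ _,
      fun _ => rfl⟩
    (fun _ => rfl) (fun _ => rfl) ?_
  intro e
  obtain rfl : e = (0 : Fin 1) := Subsingleton.elim (α := Fin 1) _ _
  simp [T, BiGraph.close, StarGraph.glue, BiGraph.path, starPow]

theorem gconn_cycle (n : ℕ) : GConn (id : Fin (n + 1) → Fin (n + 1)) (finRotate (n + 1)) := by
  refine ⟨⟨0⟩, ?_⟩
  have h : ∀ i : ℕ, ∀ hi : i < n + 1, GComp.mk (id : Fin (n + 1) → Fin (n + 1)) (finRotate (n + 1))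
      ⟨i, hi⟩ = GComp.mk _ _ 0 := by
    intro i
    induction i with
    | zero => intro hi; rfl
    | succ i ih =>
      intro hi
      have h1 := GComp.sound (id : Fin (n + 1) → Fin (n + 1)) (finRotate (n + 1)) ⟨i, by omega⟩
      rw [← ih (by omega), show (⟨i + 1, hi⟩ : Fin (n + 1)) = finRotate (n + 1) ⟨i, by omega⟩ from
        (finRotate_of_lt (by omega)).symm]
      exact h1.symm
  exact fun v w => (h v v.2).trans (h w w.2).symm

/-- The trace of a product is the value of the traffic state on a cycle. -/
theorem Phi_prod_eq_tau (n : ℕ) (z : Fin (n + 1) → A) :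
    S.Φ (List.ofFn z).prod = tau S (id : Fin (n + 1) → Fin (n + 1)) (finRotate (n + 1)) z := by
  rw [Phi_eq_tau]
  let w : List (A × Bool) := List.ofFn fun i => (z i, false)
  have hw : w.length = n + 1 := List.length_ofFn
  have hprod : (List.ofFn z).prod = (w.map fun p => starPow p.1 p.2).prod := by
    simp only [w, List.map_ofFn]; rfl
  let g : Fin (w.length + 1) → Fin (n + 1) := fun i => if h : i.1 < n + 1 then ⟨i.1, h⟩ else 0
  have hg1 : g (Fin.last _) = 0 := by simp [g, hw]
  have hg : ∀ i, (h : i.1 < n + 1) → g i = ⟨i.1, h⟩ := fun i h => by simp [g, Nat.lt_succ_iff.1 h]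
  rw [hprod]
  -- A single loop labelled by the product is expanded into the path of its factors. The path has
  -- one vertex more than the cycle; `g` sends its last vertex to `0`, which closes it up.
  refine (tau_eq_pathsGraph S (gconn_unit _ _) (fun _ : Unit => w) (V' := Fin (n + 1))
    (fun _ => 0) (fun _ => g) (fun _ => hg 0 (Nat.succ_pos n)) (fun _ => hg1)
    (fun x => Or.inr ⟨(), ⟨x.1, by have := x.2; omega⟩, hg _ x.2⟩) ?_).trans ?_
  · intro Z a b h0 h1
    refine ⟨fun i => b () ⟨i.1, by have := i.2; omega⟩, fun _ => h0 (), fun _ i => ?_⟩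
    by_cases hi : i.1 < n + 1
    · rw [hg i hi]
    · obtain rfl : i = Fin.last _ := Fin.ext (by have := i.2; simp; omega)
      rw [hg1]
      exact (h0 ()).trans (h1 ()).symm
  · let T := pathsGraph (fun _ : Unit => w) (fun _ => g)
    let φ : Fin (n + 1) ≃ T.E := ⟨fun i => ⟨(), Fin.cast hw.symm i⟩, fun p => Fin.cast hw p.2,
      fun i => rfl, fun p => rfl⟩
    have hs : ∀ i, T.src (φ i) = i := fun i => hg (Fin.cast hw.symm i).castSucc i.2
    have ht : ∀ i, T.tgt (φ i) = finRotate (n + 1) i := by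
      intro i
      by_cases hi : i.1 < n
      · rw [finRotate_of_lt hi]
        exact hg (Fin.cast hw.symm i).succ (Nat.succ_lt_succ hi)
      · obtain rfl : i = Fin.last n := Fin.ext (by have := i.2; simp; omega)
        rw [finRotate_last]
        refine Eq.trans (congrArg g (Fin.ext ?_)) hg1
        change n + 1 = w.length
        exact hw.symm
    have hl : ∀ i, starPow (T.lab (φ i)) (T.adj (φ i)) = z i := by
      intro i
      have hi : w.get (Fin.cast hw.symm i) = (z i, false) := by
        simp only [w, List.get_ofFn]; rfl
      change starPow (w.get (Fin.cast hw.symm i)).1 (w.get (Fin.cast hw.symm i)).2 = z i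
      rw [hi]
      rfl
    have hcT : GConn T.src T.tgt := by
      have h1 : T.src = id ∘ φ.symm := by
        funext e; obtain ⟨i, rfl⟩ := φ.surjective e; simp [hs]; rfl
      have h2 : T.tgt = finRotate (n + 1) ∘ φ.symm := by
        funext e; obtain ⟨i, rfl⟩ := φ.surjective e; simp [ht]; rfl
      rw [h1, h2]
      exact (gconn_cycle n).comp_equiv φ.symm
    rw [tau_eq_of_connected S T ((connected_iff_gconn T).2 hcT)]
    exact (tau_iso S (gconn_cycle n) (Equiv.refl _) φ hs ht hl).symm

end Cycles

/-! ### The tree condition as a count of components -/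

section FreeProduct

variable {J : Type u} (T : StarGraph J) (c : J → Bool)

/-- The edges of a given colour. -/
def ColE (b : Bool) : Type := {e : T.E // c (T.lab e) = b}

instance (b : Bool) : Finite (ColE T c b) := inferInstanceAs (Finite {e : T.E // c (T.lab e) = b})

/-- The sources of the edges of a given colour. -/
def colS (b : Bool) : ColE T c b → T.V := fun e => T.src e.1

/-- The targets of the edges of a given colour. -/
def colT (b : Bool) : ColE T c b → T.V := fun e => T.tgt e.1

/-- A component with at least one edge, among the components of the two colours. -/
def compIncl : T.Comp c → Σ b, GComp (colS T c b) (colT T c b) :=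
  Quot.lift (fun e => ⟨c (T.lab e), GComp.mk _ _ (T.src e)⟩) (by
    rintro e e' ⟨hc, v, hv, hv'⟩
    have key : ∀ e, T.Incident e v → (⟨c (T.lab e), GComp.mk _ _ (T.src e)⟩ :
        Σ b, GComp (colS T c b) (colT T c b)) = ⟨c (T.lab e), GComp.mk _ _ v⟩ := by
      rintro e (rfl | rfl)
      · rfl
      · exact congrArg _ (GComp.sound (colS T c (c (T.lab e))) (colT T c _) ⟨e, rfl⟩)
    rw [key e hv, key e' hv', hc])

theorem compIncl_mk_of_incident {e : T.E} {v : T.V} (h : T.Incident e v) :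
    compIncl T c (Quot.mk _ e) = ⟨c (T.lab e), GComp.mk _ _ v⟩ := by
  rcases h with rfl | rfl
  · rfl
  · exact congrArg (Sigma.mk (c (T.lab e)))
      (GComp.sound (colS T c (c (T.lab e))) (colT T c _) ⟨e, rfl⟩)

theorem hasVertex_iff (k : T.Comp c) (v : T.V) :
    T.HasVertex c k v ↔ compIncl T c k = ⟨(compIncl T c k).1, GComp.mk _ _ v⟩ := by
  constructor
  · rintro ⟨e, rfl, he⟩
    exact compIncl_mk_of_incident T c he
  · obtain ⟨e, rfl⟩ := Quot.mk_surjective k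
    intro h
    -- `f` sends a vertex to the component of the colour of `e` through it, if there is one. It is
    -- constant along the edges of that colour, which separates components.
    let f : T.V → Option (T.Comp c) := fun w =>
      if h : ∃ e', c (T.lab e') = c (T.lab e) ∧ T.Incident e' w then some (Quot.mk _ h.choose)
      else none
    have hf : ∀ e' w, c (T.lab e') = c (T.lab e) → T.Incident e' w → f w = some (Quot.mk _ e') := by
      intro e' w h1 h2
      have h3 : ∃ e', c (T.lab e') = c (T.lab e) ∧ T.Incident e' w := ⟨e', h1, h2⟩
      simp only [f, dif_pos h3]
      exact congrArg some (Quot.sound ⟨h3.choose_spec.1.trans h1.symm, w, h3.choose_spec.2, h2⟩)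
    have h1 : GComp.mk (colS T c (c (T.lab e))) (colT T c (c (T.lab e))) (T.src e) =
      GComp.mk _ _ v := eq_of_heq (Sigma.mk.inj h).2
    have h2 := GComp.eq_of_mk_eq h1 f fun e' =>
      (hf e'.1 _ e'.2 (Or.inl rfl)).trans (hf e'.1 _ e'.2 (Or.inr rfl)).symm
    rw [hf e _ rfl (Or.inl rfl)] at h2
    have h3 : ∃ e', c (T.lab e') = c (T.lab e) ∧ T.Incident e' v := by
      by_contra h3
      simp [f, dif_neg h3] at h2
    obtain ⟨e', h4, h5⟩ := h3
    rw [hf e' _ h4 h5] at h2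
    exact ⟨e', (Option.some_injective _ h2).symm, h5⟩

theorem compIncl_injective : Function.Injective (compIncl T c) := by
  intro k k' h
  obtain ⟨e, rfl⟩ := Quot.mk_surjective k
  have h1 : T.HasVertex c k' (T.src e) := by
    rw [hasVertex_iff, ← h]; rfl
  obtain ⟨e', rfl, he'⟩ := h1
  refine Quot.sound ⟨(Sigma.mk.inj h).1, T.src e, Or.inl rfl, he'⟩

theorem mem_range_compIncl (b : Bool) (v : T.V) :
    (⟨b, GComp.mk _ _ v⟩ : Σ b, GComp (colS T c b) (colT T c b)) ∈ Set.range (compIncl T c) ↔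
      ∃ e, c (T.lab e) = b ∧ T.Incident e v := by
  constructor
  · rintro ⟨k, hk⟩
    have h1 : T.HasVertex c k v := by
      rw [hasVertex_iff, hk]
    obtain ⟨e, rfl, he⟩ := h1
    exact ⟨e, (Sigma.mk.inj hk).1, he⟩
  · rintro ⟨e, rfl, he⟩
    exact ⟨Quot.mk _ e, compIncl_mk_of_incident T c he⟩

/-- A vertex lies in at most one component of each colour. With only two colours, being shared means
meeting edges of both. -/
theorem shared_iff (v : T.V) :
    (∃ k k' : T.Comp c, k ≠ k' ∧ T.HasVertex c k v ∧ T.HasVertex c k' v) ↔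
      ∀ b, ∃ e, c (T.lab e) = b ∧ T.Incident e v := by
  constructor
  · rintro ⟨k, k', hne, hk, hk'⟩
    rw [hasVertex_iff] at hk hk'
    have hb : (compIncl T c k).1 ≠ (compIncl T c k').1 := by
      intro h
      refine hne (compIncl_injective T c ?_)
      rw [hk, hk', h]
    intro b
    rw [← mem_range_compIncl]
    by_cases h : b = (compIncl T c k).1
    · exact ⟨k, by rw [h]; exact hk⟩
    · have h' : b = (compIncl T c k').1 := by
        revert h hb; cases b <;> cases (compIncl T c k).1 <;> cases (compIncl T c k').1 <;> simp
      exact ⟨k', by rw [h']; exact hk'⟩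
  · intro h
    obtain ⟨e, he, hev⟩ := h true
    obtain ⟨e', he', hev'⟩ := h false
    refine ⟨Quot.mk _ e, Quot.mk _ e', fun h => ?_, ⟨e, rfl, hev⟩, ⟨e', rfl, hev'⟩⟩
    have := congrArg (fun k => (compIncl T c k).1) h
    have h2 : c (T.lab e) = c (T.lab e') := this
    rw [he, he'] at h2
    exact absurd h2 (by simp)

instance : Finite (T.Comp c) := inferInstanceAs (Finite (Quot _))
instance : Finite (T.Shared c) := inferInstanceAs (Finite (Subtype _))

theorem eq_of_notMem_range {b : Bool} {v w : T.V}
    (hv : (⟨b, GComp.mk _ _ v⟩ : Σ b, GComp (colS T c b) (colT T c b)) ∉ Set.range (compIncl T c))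
    (h : GComp.mk (colS T c b) (colT T c b) v = GComp.mk _ _ w) : v = w := by
  rw [mem_range_compIncl] at hv
  push Not at hv
  have := GComp.eq_of_mk_eq h (fun x => x = v) fun e => by
    have h1 := hv e.1 e.2
    simp only [StarGraph.Incident, not_or] at h1
    exact propext ⟨fun h => absurd h h1.1, fun h => absurd h h1.2⟩
  exact (this.mp rfl).symm

theorem exists_incident (hT : GConn T.src T.tgt) [Nonempty T.E] (v : T.V) :
    ∃ e, T.Incident e v := by
  by_contra h
  push Not at h
  obtain ⟨e⟩ := ‹Nonempty T.E›
  have := hT.const (fun x => x = v) (fun e => by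
    have h1 := h e
    simp only [StarGraph.Incident, not_or] at h1
    exact propext ⟨fun h => absurd h h1.1, fun h => absurd h h1.2⟩) v (T.src e)
  exact h e (Or.inl (this.mp rfl))

/-- Among the components of the two colours, those with an edge are the elements of `T.Comp c`. The
others are single vertices missing one colour; since every vertex meets some edge, they correspond
bijectively to the vertices that are not shared. -/
theorem card_comp_add (hT : GConn T.src T.tgt) [Nonempty T.E] :
    ccard (colS T c true) (colT T c true) + ccard (colS T c false) (colT T c false) +
      Nat.card (T.Shared c) = Nat.card (T.Comp c) + Nat.card T.V := by
  have h1 : Nat.card (Σ b, GComp (colS T c b) (colT T c b)) =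
      ccard (colS T c true) (colT T c true) + ccard (colS T c false) (colT T c false) := by
    rw [Nat.card_sigma, Fintype.sum_bool]; rfl
  have h2 : Nat.card (Σ b, GComp (colS T c b) (colT T c b)) =
      Nat.card (T.Comp c) + Nat.card ↥(Set.range (compIncl T c))ᶜ := by
    rw [← Nat.card_congr (Equiv.Set.sumCompl (Set.range (compIncl T c))), Nat.card_sum,
      Nat.card_congr (Equiv.ofInjective _ (compIncl_injective T c))]
  have h3 : Nat.card T.V = Nat.card (T.Shared c) + Nat.card {v : T.V // ¬ ∃ k k' : T.Comp c,
      k ≠ k' ∧ T.HasVertex c k v ∧ T.HasVertex c k' v} := by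
    rw [← Nat.card_congr (Equiv.sumCompl fun v : T.V => ∃ k k' : T.Comp c,
      k ≠ k' ∧ T.HasVertex c k v ∧ T.HasVertex c k' v), Nat.card_sum]
    rfl
  have h4 : Nat.card {v : T.V // ¬ ∃ k k' : T.Comp c,
      k ≠ k' ∧ T.HasVertex c k v ∧ T.HasVertex c k' v} = Nat.card ↥(Set.range (compIncl T c))ᶜ := by
    have hex : ∀ v : {v : T.V // ¬ ∃ k k' : T.Comp c,
        k ≠ k' ∧ T.HasVertex c k v ∧ T.HasVertex c k' v}, ∃ b,
        (⟨b, GComp.mk _ _ v.1⟩ : Σ b, GComp (colS T c b) (colT T c b)) ∉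
          Set.range (compIncl T c) := by
      rintro ⟨v, hv⟩
      rw [shared_iff, not_forall] at hv
      obtain ⟨b, hb⟩ := hv
      exact ⟨b, by rwa [mem_range_compIncl]⟩
    choose β hβ using hex
    refine Nat.card_congr (Equiv.ofBijective (fun v => ⟨⟨β v, GComp.mk _ _ v.1⟩, hβ v⟩) ⟨?_, ?_⟩)
    · intro v w h
      have h := congrArg Subtype.val h
      have hβ1 := hβ v
      have hb : β v = β w := (Sigma.mk.inj h).1
      refine Subtype.ext (eq_of_notMem_range T c (hβ v) (w := w.1) ?_)
      simp only at h
      rw [← hb] at h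
      exact eq_of_heq (Sigma.mk.inj h).2
    · rintro ⟨⟨b, q⟩, h⟩
      obtain ⟨v, rfl⟩ := GComp.mk_surjective _ _ q
      have hv : ¬ ∃ k k' : T.Comp c, k ≠ k' ∧ T.HasVertex c k v ∧ T.HasVertex c k' v := by
        rw [shared_iff]
        intro h'
        exact h ((mem_range_compIncl T c b v).2 (h' b))
      refine ⟨⟨v, hv⟩, Subtype.ext ?_⟩
      have hb : β ⟨v, hv⟩ = b := by
        by_contra hb
        obtain ⟨e, he⟩ := exists_incident T hT v
        have h1 := hβ ⟨v, hv⟩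
        have h2 : (⟨b, GComp.mk _ _ v⟩ : Σ b, GComp (colS T c b) (colT T c b)) ∉
          Set.range (compIncl T c) := h
        rw [mem_range_compIncl] at h1 h2
        push Not at h1 h2
        by_cases h3 : c (T.lab e) = b
        · exact h2 e h3 he
        · refine h1 e ?_ he
          revert hb h3
          cases c (T.lab e) <;> cases b <;> cases β ⟨v, hv⟩ <;> simp
      change (⟨β ⟨v, hv⟩, GComp.mk _ _ v⟩ : Σ b, GComp (colS T c b) (colT T c b)) = ⟨b, _⟩
      rw [hb]
  omega

theorem barGraph_adj_iff (k : T.Comp c) (v : T.Shared c) :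
    (T.barGraph c).Adj (Sum.inl k) (Sum.inr v) ↔ T.HasVertex c k v.1 := by
  rw [StarGraph.barGraph, SimpleGraph.fromRel_adj]
  constructor
  · rintro ⟨-, ⟨k', v', h1, h2, h3⟩ | ⟨k', v', h1, h2, h3⟩⟩
    · obtain rfl := Sum.inl_injective h1
      obtain rfl := Sum.inr_injective h2
      exact h3
    · simp at h1
  · intro h
    exact ⟨by simp, Or.inl ⟨k, v, rfl, rfl, h⟩⟩

theorem barGraph_connected (hT : GConn T.src T.tgt) [Nonempty T.E] :
    (T.barGraph c).Connected := by
  let G := T.barGraph c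
  have hex : ∀ v, ∃ k, T.HasVertex c k v := fun v => by
    obtain ⟨e, he⟩ := exists_incident T hT v
    exact ⟨Quot.mk _ e, e, rfl, he⟩
  have hsame : ∀ v k k', T.HasVertex c k v → T.HasVertex c k' v →
      G.Reachable (Sum.inl k) (Sum.inl k') := by
    intro v k k' hk hk'
    by_cases h : k = k'
    · rw [h]
    · let v' : T.Shared c := ⟨v, k, k', h, hk, hk'⟩
      exact ((barGraph_adj_iff T c k v').2 hk).reachable.trans
        ((barGraph_adj_iff T c k' v').2 hk').symm.reachable
  have hk : ∀ k : T.Comp c, ∃ v, T.HasVertex c k v := by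
    intro k
    obtain ⟨e, rfl⟩ := Quot.mk_surjective k
    exact ⟨T.src e, e, rfl, Or.inl rfl⟩
  choose κ hκ using hex
  have hconst := hT.const (fun v => G.connectedComponentMk (Sum.inl (κ v))) (fun e => by
    have h1 : T.HasVertex c (Quot.mk _ e) (T.src e) := ⟨e, rfl, Or.inl rfl⟩
    have h2 : T.HasVertex c (Quot.mk _ e) (T.tgt e) := ⟨e, rfl, Or.inr rfl⟩
    exact SimpleGraph.ConnectedComponent.sound
      ((hsame _ _ _ (hκ _) h1).trans (hsame _ _ _ h2 (hκ _))))
  have hkk : ∀ k k' : T.Comp c, G.Reachable (Sum.inl k) (Sum.inl k') := by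
    intro k k'
    obtain ⟨v, hv⟩ := hk k
    obtain ⟨v', hv'⟩ := hk k'
    exact (hsame _ _ _ hv (hκ _)).trans
      ((SimpleGraph.ConnectedComponent.exact (hconst v v')).trans (hsame _ _ _ (hκ _) hv'))
  have hS : ∀ v : T.Shared c, ∃ k, G.Reachable (Sum.inl k) (Sum.inr v) := fun v =>
    ⟨κ v.1, ((barGraph_adj_iff T c _ v).2 (hκ _)).reachable⟩
  have hall : ∀ x, ∃ k, G.Reachable (Sum.inl k) x := by
    rintro (k | v)
    · exact ⟨k, SimpleGraph.Reachable.refl _⟩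
    · exact hS v
  have : Nonempty (T.Comp c ⊕ T.Shared c) := ⟨Sum.inl (Quot.mk _ (Classical.arbitrary T.E))⟩
  refine SimpleGraph.Connected.mk fun x y => ?_
  obtain ⟨k, hk⟩ := hall x
  obtain ⟨k', hk'⟩ := hall y
  exact hk.symm.trans ((hkk k k').trans hk')

/-- A shared vertex belongs to exactly one component of each of the two colours. -/
theorem card_edgeSet_barGraph :
    Nat.card (T.barGraph c).edgeSet = 2 * Nat.card (T.Shared c) := by
  have hex : ∀ p : Bool × T.Shared c, ∃ k, T.HasVertex c k p.2.1 ∧ (compIncl T c k).1 = p.1 := by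
    rintro ⟨b, v⟩
    obtain ⟨e, he, hv⟩ := (shared_iff T c v.1).1 v.2 b
    exact ⟨Quot.mk _ e, ⟨e, rfl, hv⟩, he⟩
  choose κ hκ hκ' using hex
  have hb : Nat.card Bool = 2 := by simp
  rw [← hb, ← Nat.card_prod]
  refine (Nat.card_congr (Equiv.ofBijective (fun p : Bool × T.Shared c =>
    (⟨s(Sum.inl (κ p), Sum.inr p.2), (barGraph_adj_iff T c _ _).2 (hκ p)⟩ :
      (T.barGraph c).edgeSet)) ⟨?_, ?_⟩)).symm
  · intro p p' h
    have h := congrArg Subtype.val h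
    simp only [Sym2.eq_iff, Sum.inl.injEq, Sum.inr.injEq, reduceCtorEq, and_self, or_false] at h
    refine Prod.ext ?_ h.2
    rw [← hκ' p, ← hκ' p', h.1]
  · rintro ⟨x, hx⟩
    induction x with
    | _ x y =>
      have key : ∀ k v, T.HasVertex c k v.1 → ∃ p : Bool × T.Shared c, κ p = k ∧ p.2 = v := by
        intro k v h
        refine ⟨((compIncl T c k).1, v), compIncl_injective T c ?_, rfl⟩
        have h1 := (hasVertex_iff T c _ _).1 (hκ ((compIncl T c k).1, v))
        rw [h1, (hasVertex_iff T c _ _).1 h, hκ']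
      have hx' := hx
      rw [SimpleGraph.mem_edgeSet, StarGraph.barGraph, SimpleGraph.fromRel_adj] at hx'
      obtain ⟨-, ⟨k, v, rfl, rfl, h⟩ | ⟨k, v, rfl, rfl, h⟩⟩ := hx'
      · obtain ⟨p, rfl, rfl⟩ := key k v h
        exact ⟨p, rfl⟩
      · obtain ⟨p, rfl, rfl⟩ := key k v h
        exact ⟨p, Subtype.ext Sym2.eq_swap⟩

/-- The bipartite graph is always connected, so it is a tree if and only if it has one edge fewer
than vertices, which means that there is one more component than shared vertices. `card_comp_add`
translates this into the stated equality. -/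
theorem isFreeProduct_iff (hT : GConn T.src T.tgt) : T.IsFreeProduct c ↔
    ccard (colS T c true) (colT T c true) + ccard (colS T c false) (colT T c false) =
      Nat.card T.V + 1 := by
  rcases isEmpty_or_nonempty T.E with hE | hE
  · have h1 : ∀ b, IsEmpty (ColE T c b) := fun b => ⟨fun e => hE.false e.1⟩
    have h2 := ccard_eq_one hT
    rw [ccard_of_isEmpty] at h2
    rw [ccard_of_isEmpty, ccard_of_isEmpty, h2]
    exact iff_of_true (Or.inl hE) rfl
  · have h1 := card_comp_add T c hT
    have : Fintype (T.Comp c ⊕ T.Shared c) := Fintype.ofFinite _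
    rw [StarGraph.IsFreeProduct, or_iff_right (not_isEmpty_of_nonempty T.E),
      SimpleGraph.isTree_iff_connected_and_card, card_edgeSet_barGraph, Nat.card_sum]
    rw [and_iff_right (barGraph_connected T c hT)]
    omega

end FreeProduct

/-! ### Traffic-freeness of two families in counting form -/

section TrafficFreePair

variable {A : Type u} [Ring A] [StarRing A] [Algebra ℂ A] [StarModule ℂ A] (S : TrafficSpace A)

/-- The edge labels of a `*`-graph, as elements of the algebra. -/
def starLab (T : StarGraph A) : T.E → A := fun e => starPow (T.lab e) (T.adj e)

theorem tau0_eq_of_connected (T : StarGraph A) (hT : GConn T.src T.tgt) :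
    S.τ₀ T = tau0 S T.src T.tgt (starLab T) := by
  rw [tau0_def, TrafficSpace.τ₀, finsum_eq_sum_of_fintype]
  refine Finset.sum_congr rfl fun π _ => ?_
  congr 1
  have hg : GConn (T.quotient π).src (T.quotient π).tgt :=
    hT.map (f := Quot.mk fun v w => π v w) Quot.mk_surjective
  rw [tau_eq_of_connected S _ ((connected_iff_gconn _).2 hg)]
  rfl

/-- The only difference between the two sides is the isolated vertices of each colour, which have no
counterpart in `T.Comp c` and contribute `1`. -/
theorem finprod_compGraph {J : Type v} (T : StarGraph J) (c : J → Bool) (a : J → A) :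
    ∏ᶠ k : T.Comp c, S.τ₀ ((T.compGraph c k).map a) =
      Mtau S (colS T c true) (colT T c true) (fun e => starLab (T.map a) e.1) *
      Mtau S (colS T c false) (colT T c false) (fun e => starLab (T.map a) e.1) := by
  have : Fintype (T.Comp c) := Fintype.ofFinite _
  let F : (Σ b, GComp (colS T c b) (colT T c b)) → ℂ := fun d =>
    tau0 S (fibS (GComp.mk (colS T c d.1) (colT T c d.1)) (colS T c d.1) d.2)
      (fibT _ _ _ (GComp.sound (colS T c d.1) (colT T c d.1)) d.2)
      (fun e => starLab (T.map a) e.1.1)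
  rw [finprod_eq_prod_of_fintype]
  trans ∏ d, F d
  · refine Fintype.prod_of_injective _ (compIncl_injective T c) _ F ?_ ?_
    · rintro ⟨b, q⟩ hq
      have hc := gconn_fib (colS T c b) (colT T c b) q
      have : IsEmpty {e : ColE T c b // GComp.mk (colS T c b) (colT T c b) (colS T c b e) = q} := by
        refine ⟨?_⟩
        rintro ⟨e, rfl⟩
        exact hq ((mem_range_compIncl T c b _).2 ⟨e.1, e.2, Or.inl rfl⟩)
      exact tau0_point S hc _
    · intro k
      obtain ⟨e₀, rfl⟩ := Quot.mk_surjective k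
      have hV : ∀ v, T.HasVertex c (Quot.mk _ e₀) v ↔ GComp.mk (colS T c (c (T.lab e₀)))
          (colT T c (c (T.lab e₀))) v = GComp.mk _ _ (T.src e₀) := by
        intro v
        refine (hasVertex_iff T c _ v).trans ?_
        exact ⟨fun h => (eq_of_heq (Sigma.mk.inj h).2).symm, fun h => congrArg (Sigma.mk _) h.symm⟩
      have hE : ∀ e, (Quot.mk _ e : T.Comp c) = Quot.mk _ e₀ ↔ ∃ h : c (T.lab e) = c (T.lab e₀),
          GComp.mk (colS T c (c (T.lab e₀))) (colT T c (c (T.lab e₀))) (T.src e) =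
            GComp.mk _ _ (T.src e₀) := by
        intro e
        refine (compIncl_injective T c).eq_iff.symm.trans ?_
        constructor
        · intro h
          have h1 : c (T.lab e) = c (T.lab e₀) := (Sigma.mk.inj h).1
          have h2 : (⟨c (T.lab e), GComp.mk _ _ (T.src e)⟩ :
            Σ b, GComp (colS T c b) (colT T c b)) = ⟨c (T.lab e₀), GComp.mk _ _ (T.src e₀)⟩ := h
          rw [h1] at h2
          exact ⟨h1, eq_of_heq (Sigma.mk.inj h2).2⟩
        · rintro ⟨h1, h2⟩
          change (⟨c (T.lab e), GComp.mk _ _ (T.src e)⟩ :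
            Σ b, GComp (colS T c b) (colT T c b)) = ⟨c (T.lab e₀), GComp.mk _ _ (T.src e₀)⟩
          rw [h1]
          exact congrArg _ h2
      let f := Equiv.subtypeEquivRight hV
      let φ : {e // (Quot.mk _ e : T.Comp c) = Quot.mk _ e₀} ≃
          {e : ColE T c (c (T.lab e₀)) // GComp.mk (colS T c (c (T.lab e₀)))
            (colT T c (c (T.lab e₀))) (colS T c (c (T.lab e₀)) e) = GComp.mk _ _ (T.src e₀)} :=
        { toFun := fun e => ⟨⟨e.1, ((hE e.1).1 e.2).1⟩, ((hE e.1).1 e.2).2⟩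
          invFun := fun e => ⟨e.1.1, (hE e.1.1).2 ⟨e.1.2, e.2⟩⟩
          left_inv := fun _ => rfl
          right_inv := fun _ => rfl }
      have hc : GConn (T.compGraph c (Quot.mk _ e₀)).src (T.compGraph c (Quot.mk _ e₀)).tgt :=
        ((gconn_fib (colS T c (c (T.lab e₀))) (colT T c (c (T.lab e₀)))
          (GComp.mk _ _ (T.src e₀))).map f.symm.surjective).comp_equiv φ
      rw [tau0_eq_of_connected S ((T.compGraph c (Quot.mk _ e₀)).map a) hc]
      exact tau0_iso S hc f φ (fun _ => rfl) (fun _ => rfl) (fun _ => rfl)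
  · rw [Fintype.prod_sigma, Fintype.prod_bool]
    rfl

/-- Traffic-freeness of two families, in terms of the subgraphs of each colour. -/
theorem trafficFreePair_iff {J : Type v} {K : Type w} (a : J → A) (b : K → A) :
    S.TrafficFreePair a b ↔ TFree S (starSet a) (starSet b) := by
  constructor
  · intro h V E₁ E₂ _ _ _ s₁ t₁ s₂ t₂ l₁ l₂ hl₁ hl₂ hc
    choose p₁ hp₁ using hl₁
    choose p₂ hp₂ using hl₂
    let T : StarGraph (J ⊕ K) := ⟨V, E₁ ⊕ E₂, inferInstance, inferInstance, Sum.elim s₁ s₂,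
      Sum.elim t₁ t₂, Sum.map (fun e => (p₁ e).1) (fun e => (p₂ e).1),
      Sum.elim (fun e => (p₁ e).2) (fun e => (p₂ e).2)⟩
    have h := h T ((connected_iff_gconn T).2 hc)
    rw [tau0_eq_of_connected S (T.map (Sum.elim a b)) hc, finprod_compGraph] at h
    simp only [isFreeProduct_iff T _ hc] at h
    let φ₁ : E₁ ≃ ColE T Sum.isLeft true :=
      { toFun := fun e => ⟨Sum.inl e, rfl⟩
        invFun := fun e => match e with
          | ⟨Sum.inl e, _⟩ => e
          | ⟨Sum.inr e, h⟩ => absurd h (by simp [T])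
        left_inv := fun _ => rfl
        right_inv := by rintro ⟨e | e, h⟩; exacts [rfl, absurd h (by simp [T])] }
    let φ₂ : E₂ ≃ ColE T Sum.isLeft false :=
      { toFun := fun e => ⟨Sum.inr e, rfl⟩
        invFun := fun e => match e with
          | ⟨Sum.inr e, _⟩ => e
          | ⟨Sum.inl e, h⟩ => absurd h (by simp [T])
        left_inv := fun _ => rfl
        right_inv := by rintro ⟨e | e, h⟩; exacts [absurd h (by simp [T]), rfl] }
    rw [ccard_iso (s := s₁) (t := t₁) (s' := colS T Sum.isLeft true) (t' := colT T _ true)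
        (Equiv.refl V) φ₁ (fun _ => rfl) (fun _ => rfl),
      ccard_iso (s := s₂) (t := t₂) (s' := colS T Sum.isLeft false) (t' := colT T _ false)
        (Equiv.refl V) φ₂ (fun _ => rfl) (fun _ => rfl),
      Mtau_iso S (s := s₁) (t := t₁) (s' := colS T Sum.isLeft true) (t' := colT T _ true)
        (l := l₁) (l' := fun e => starLab (T.map (Sum.elim a b)) e.1)
        (Equiv.refl V) φ₁ (fun _ => rfl) (fun _ => rfl) hp₁,
      Mtau_iso S (s := s₂) (t := t₂) (s' := colS T Sum.isLeft false) (t' := colT T _ false)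
        (l := l₂) (l' := fun e => starLab (T.map (Sum.elim a b)) e.1)
        (Equiv.refl V) φ₂ (fun _ => rfl) (fun _ => rfl) hp₂]
    refine Eq.trans ?_ h
    congr 1
    funext e
    rcases e with e | e
    · exact (hp₁ e).symm
    · exact (hp₂ e).symm
  · intro h T hT
    have hc := (connected_iff_gconn T).1 hT
    let φ : ColE T Sum.isLeft true ⊕ ColE T Sum.isLeft false ≃ T.E :=
      { toFun := Sum.elim Subtype.val Subtype.val
        invFun := fun e => if h : (T.lab e).isLeft = true then Sum.inl ⟨e, h⟩
          else Sum.inr ⟨e, by simpa using h⟩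
        left_inv := by
          rintro (⟨e, h⟩ | ⟨e, h⟩)
          · exact dif_pos h
          · exact dif_neg fun h' => Bool.noConfusion (h.symm.trans h')
        right_inv := by
          intro e
          by_cases h : (T.lab e).isLeft = true
          · simp only [dif_pos h]; rfl
          · simp only [dif_neg h]; rfl }
    have hs : T.src ∘ φ = Sum.elim (colS T Sum.isLeft true) (colS T Sum.isLeft false) := by
      funext e; rcases e with e | e <;> rfl
    have ht : T.tgt ∘ φ = Sum.elim (colT T Sum.isLeft true) (colT T Sum.isLeft false) := by
      funext e; rcases e with e | e <;> rfl
    have hl : starLab (T.map (Sum.elim a b)) ∘ φ =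
        Sum.elim (fun e => starLab (T.map (Sum.elim a b)) e.1)
          (fun e => starLab (T.map (Sum.elim a b)) e.1) := by
      funext e; rcases e with e | e <;> rfl
    have hc' := hc.comp_equiv φ
    rw [hs, ht] at hc'
    have h := h T.V _ _ _ _ _ _ (fun e => starLab (T.map (Sum.elim a b)) e.1)
      (fun e => starLab (T.map (Sum.elim a b)) e.1) ?_ ?_ hc'
    · rw [← hs, ← ht, ← hl] at h
      have h := (tau0_comp_equiv S hc φ (l := starLab (T.map (Sum.elim a b)))).symm.trans h
      rw [tau0_eq_of_connected S (T.map (Sum.elim a b)) hc, finprod_compGraph]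
      simp only [isFreeProduct_iff T _ hc]
      exact h
    · rintro ⟨e, he⟩
      change starPow (Sum.elim a b (T.lab e)) (T.adj e) ∈ _
      obtain ⟨j, hj⟩ := Sum.isLeft_iff.1 he
      rw [hj]
      exact ⟨(j, T.adj e), rfl⟩
    · rintro ⟨e, he⟩
      change starPow (Sum.elim a b (T.lab e)) (T.adj e) ∈ _
      obtain ⟨j, hj⟩ := Sum.isRight_iff.1 (by simpa using he)
      rw [hj]
      exact ⟨(j, T.adj e), rfl⟩

end TrafficFreePair

/-! ### Haar measure on the unitary group -/

section UnitaryHaar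

instance (N : ℕ) : MeasurableSpace (Matrix.unitaryGroup (Fin N) ℂ) := borel _
instance (N : ℕ) : BorelSpace (Matrix.unitaryGroup (Fin N) ℂ) := ⟨rfl⟩
instance (N : ℕ) : CompactSpace (Matrix.unitaryGroup (Fin N) ℂ) := unitaryGroup_compactSpace N

/-- The Haar probability measure on the unitary group. -/
def unitaryHaar (N : ℕ) : Measure (Matrix.unitaryGroup (Fin N) ℂ) :=
  Measure.haarMeasure (⊤ : TopologicalSpace.PositiveCompacts (Matrix.unitaryGroup (Fin N) ℂ))

theorem haarExpectation_eq (N : ℕ) (f : Matrix.unitaryGroup (Fin N) ℂ → ℂ) :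
    haarExpectation N f = ∫ U, f U ∂unitaryHaar N := rfl

instance (N : ℕ) : (unitaryHaar N).IsHaarMeasure := by unfold unitaryHaar; infer_instance

instance (N : ℕ) : IsProbabilityMeasure (unitaryHaar N) :=
  ⟨by rw [← TopologicalSpace.PositiveCompacts.coe_top]; exact Measure.haarMeasure_self⟩

/-- A right translate is again a left invariant probability measure, and such a measure is unique on
a compact group. -/
instance (N : ℕ) : (unitaryHaar N).IsMulRightInvariant where
  map_mul_right_eq_self g := by
    have : IsProbabilityMeasure (Measure.map (· * g) (unitaryHaar N)) :=
      Measure.isProbabilityMeasure_map (by fun_prop)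
    have h := Measure.isMulInvariant_eq_smul_of_compactSpace
      (Measure.map (· * g) (unitaryHaar N)) (unitaryHaar N)
    have h1 := congrArg (fun μ => μ Set.univ) h
    simp only [measure_univ, Measure.smul_apply] at h1
    rw [h]
    have h2 : (Measure.haarScalarFactor (Measure.map (· * g) (unitaryHaar N)) (unitaryHaar N)) = 1 := by
      have := h1.symm
      simpa [ENNReal.smul_def] using this
    rw [h2, one_smul]

theorem integrable_unitaryHaar {N : ℕ} {F : Type*} [NormedAddCommGroup F] [SecondCountableTopology F]
    {f : Matrix.unitaryGroup (Fin N) ℂ → F}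
    (hf : Continuous f) : Integrable f (unitaryHaar N) :=
  hf.integrable_of_hasCompactSupport (HasCompactSupport.of_compactSpace f)

end UnitaryHaar

/-! ### Symmetries of Haar moments -/

section Moments

variable {E V R C : Type} [Finite E] [Finite V] [Finite R] [Finite C]

/-- A mixed moment of the entries of a Haar unitary matrix. -/
def umom (N : ℕ) (ε : E → Bool) (i j : E → Fin N) : ℂ :=
  haarExpectation N fun U => ∏ᶠ e, starPow (U.1 (i e) (j e)) (ε e)

theorem starPow_mul_real {d z : ℂ} (hd : star d = d) (b : Bool) :
    starPow (d * z) b = d * starPow z b := by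
  cases b
  · rfl
  · simp only [starPow, star_mul', hd]

/-- A permutation matrix with signs. -/
def signedPerm {N : ℕ} (α : Equiv.Perm (Fin N)) (d : Fin N → ℂ) (hd : ∀ a, star (d a) = d a)
    (hd' : ∀ a, d a * d a = 1) : Matrix.unitaryGroup (Fin N) ℂ :=
  ⟨Matrix.of fun a b => if b = α a then d a else 0, by
    rw [Matrix.mem_unitaryGroup_iff]
    ext a b
    simp only [Matrix.mul_apply, Matrix.star_apply, Matrix.of_apply, ite_mul, zero_mul,
      Finset.sum_ite_eq', Finset.mem_univ, if_true, Matrix.one_apply, EmbeddingLike.apply_eq_iff_eq]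
    split_ifs with h
    · rw [h, hd, hd']
    · simp⟩

theorem signedPerm_mul_apply {N : ℕ} (α : Equiv.Perm (Fin N)) (d : Fin N → ℂ)
    (hd : ∀ a, star (d a) = d a) (hd' : ∀ a, d a * d a = 1) (U : Matrix.unitaryGroup (Fin N) ℂ)
    (a b : Fin N) : (signedPerm α d hd hd' * U).1 a b = d a * U.1 (α a) b := by
  simp [signedPerm, Matrix.mul_apply]

theorem mul_signedPerm_apply {N : ℕ} (α : Equiv.Perm (Fin N)) (d : Fin N → ℂ)
    (hd : ∀ a, star (d a) = d a) (hd' : ∀ a, d a * d a = 1) (U : Matrix.unitaryGroup (Fin N) ℂ)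
    (a b : Fin N) : (U * star (signedPerm α d hd hd')).1 a b = d b * U.1 a (α b) := by
  simp only [Submonoid.coe_mul, Unitary.coe_star, Matrix.mul_apply, Matrix.star_apply, signedPerm,
    Matrix.of_apply]
  rw [Finset.sum_eq_single (α b)]
  · rw [if_pos rfl, hd, mul_comm]
  · intro c _ hc; rw [if_neg hc]; simp
  · simp

/-- Invariance under left multiplication by a signed permutation matrix. The signs are real, so they
come out of conjugated entries as well. -/
theorem umom_signedPerm_left {N : ℕ} (α : Equiv.Perm (Fin N)) {d : Fin N → ℂ}
    (hd : ∀ a, star (d a) = d a) (hd' : ∀ a, d a * d a = 1) (ε : E → Bool) (i j : E → Fin N) :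
    umom N ε i j = (∏ᶠ e, d (i e)) * umom N ε (α ∘ i) j := by
  rw [umom, umom, haarExpectation_eq, haarExpectation_eq,
    ← integral_mul_left_eq_self _ (signedPerm α d hd hd'), ← integral_const_mul]
  congr 1
  funext U
  rw [← finprod_mul_distrib (Set.toFinite _) (Set.toFinite _)]
  exact finprod_congr fun e => by
    rw [signedPerm_mul_apply, starPow_mul_real (hd _)]; rfl

theorem umom_signedPerm_right {N : ℕ} (α : Equiv.Perm (Fin N)) {d : Fin N → ℂ}
    (hd : ∀ a, star (d a) = d a) (hd' : ∀ a, d a * d a = 1) (ε : E → Bool) (i j : E → Fin N) :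
    umom N ε i j = (∏ᶠ e, d (j e)) * umom N ε i (α ∘ j) := by
  rw [umom, umom, haarExpectation_eq, haarExpectation_eq,
    ← integral_mul_right_eq_self _ (star (signedPerm α d hd hd')), ← integral_const_mul]
  congr 1
  funext U
  rw [← finprod_mul_distrib (Set.toFinite _) (Set.toFinite _)]
  exact finprod_congr fun e => by
    rw [mul_signedPerm_apply, starPow_mul_real (hd _)]; rfl

theorem umom_perm {N : ℕ} (α β : Equiv.Perm (Fin N)) (ε : E → Bool) (i j : E → Fin N) :
    umom N ε (α ∘ i) (β ∘ j) = umom N ε i j := by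
  rw [umom_signedPerm_left α (d := fun _ => 1) (by simp) (by simp) ε i j,
    umom_signedPerm_right β (d := fun _ => 1) (by simp) (by simp) ε (α ∘ i) j]
  simp

theorem finprod_sign {N : ℕ} (i : E → Fin N) (a : Fin N) (h : Odd (Nat.card {e // i e = a})) :
    ∏ᶠ e, (if i e = a then (-1 : ℂ) else 1) = -1 := by
  have := Fintype.ofFinite E
  rw [finprod_eq_prod_of_fintype, Finset.prod_ite, Finset.prod_const_one, mul_one,
    Finset.prod_const]
  rw [Nat.card_eq_fintype_card, Fintype.card_subtype] at h
  exact h.neg_one_pow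

/-- Changing the sign of row `a` preserves the Haar law and multiplies the moment by `-1`. -/
theorem umom_eq_zero_of_odd_row {N : ℕ} {ε : E → Bool} {i j : E → Fin N} (a : Fin N)
    (h : Odd (Nat.card {e // i e = a})) : umom N ε i j = 0 := by
  have h1 := umom_signedPerm_left (Equiv.refl _) (d := fun b => if b = a then (-1 : ℂ) else 1)
    (by intro b; split_ifs <;> simp) (by intro b; split_ifs <;> simp) ε i j
  rw [finprod_sign i a h] at h1
  exact self_eq_neg.1 (h1.trans (neg_one_mul _))

theorem umom_eq_zero_of_odd_col {N : ℕ} {ε : E → Bool} {i j : E → Fin N} (a : Fin N)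
    (h : Odd (Nat.card {e // j e = a})) : umom N ε i j = 0 := by
  have h1 := umom_signedPerm_right (Equiv.refl _) (d := fun b => if b = a then (-1 : ℂ) else 1)
    (by intro b; split_ifs <;> simp) (by intro b; split_ifs <;> simp) ε i j
  rw [finprod_sign j a h] at h1
  exact self_eq_neg.1 (h1.trans (neg_one_mul _))

theorem exists_perm_comp_eq {N : ℕ} {f g : V → Fin N} (hf : Function.Injective f)
    (hg : Function.Injective g) : ∃ α : Equiv.Perm (Fin N), ⇑α ∘ f = g := by
  let e : {x // x ∈ Set.range f} ≃ {x // x ∈ Set.range g} :=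
    (Equiv.ofInjective f hf).symm.trans (Equiv.ofInjective g hg)
  refine ⟨e.extendSubtype, funext fun v => ?_⟩
  change e.extendSubtype (f v) = g v
  rw [Equiv.extendSubtype_apply_of_mem e _ ⟨v, rfl⟩]
  have : (Equiv.ofInjective f hf).symm ⟨f v, ⟨v, rfl⟩⟩ = v :=
    (Equiv.ofInjective f hf).symm_apply_eq.2 rfl
  simp [e, this]

/-- A mixed moment of the entries of a Haar unitary matrix, the rows and the columns being
indexed by arbitrary sets. -/
def hmom (N : ℕ) (ε : E → Bool) (r : E → R) (c : E → C) : ℂ :=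
  if h : (∃ f : R → Fin N, Function.Injective f) ∧ ∃ g : C → Fin N, Function.Injective g then
    umom N ε (h.1.choose ∘ r) (h.2.choose ∘ c) else 0

/-- Any two injections into `Fin N` differ by a permutation, so the choices made in `hmom` are
immaterial. The default value `0` occurs only when `N` is too small for such injections. -/
theorem umom_eq_hmom {N : ℕ} (ε : E → Bool) (r : E → R) (c : E → C) {f : R → Fin N}
    (hf : Function.Injective f) {g : C → Fin N} (hg : Function.Injective g) :
    umom N ε (f ∘ r) (g ∘ c) = hmom N ε r c := by
  have h : (∃ f : R → Fin N, Function.Injective f) ∧ ∃ g : C → Fin N, Function.Injective g :=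
    ⟨⟨f, hf⟩, ⟨g, hg⟩⟩
  rw [hmom, dif_pos h]
  obtain ⟨α, hα⟩ := exists_perm_comp_eq hf h.1.choose_spec
  obtain ⟨β, hβ⟩ := exists_perm_comp_eq hg h.2.choose_spec
  rw [← hα, ← hβ]
  exact (umom_perm α β ε (f ∘ r) (g ∘ c)).symm

end Moments

/-! ### Injective traces as limits of moments -/

section MomentLimit

variable {A : Type u} [Ring A] [StarRing A] [Algebra ℂ A] [StarModule ℂ A] {S : TrafficSpace A}
variable {E V R C : Type} [Finite E] [Finite V] [Finite R] [Finite C]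

theorem continuous_starPow_entry {N : ℕ} (i j : Fin N) (b : Bool) :
    Continuous fun U : Matrix.unitaryGroup (Fin N) ℂ => starPow (U.1 i j) b := by
  have h : Continuous fun U : Matrix.unitaryGroup (Fin N) ℂ => U.1 i j :=
    (continuous_subtype_val).matrix_elem i j
  cases b
  · exact h
  · exact h.star

theorem continuous_prod_starPow {N : ℕ} (ε : E → Bool) (i j : E → Fin N) :
    Continuous fun U : Matrix.unitaryGroup (Fin N) ℂ => ∏ᶠ e, starPow (U.1 (i e) (j e)) (ε e) := by
  have := Fintype.ofFinite E
  simp only [finprod_eq_prod_of_fintype]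
  exact continuous_finsetProd _ fun e _ => continuous_starPow_entry _ _ _

/-- The end of an edge which indexes a row of the matrix. -/
def rowEnd (s t : E → V) (ε : E → Bool) : E → V := fun e => if ε e then t e else s e

/-- The end of an edge which indexes a column of the matrix. -/
def colEnd (s t : E → V) (ε : E → Bool) : E → V := fun e => if ε e then s e else t e

/-- The expectation of the normalized trace of a graph in a Haar unitary matrix. -/
theorem haarExpectation_matrixTrace [Fintype V] {J : Type v} (N : ℕ) (s t : E → V) (ε : E → Bool)
    (j : E → J) :
    haarExpectation N (fun U => (N : ℂ)⁻¹ * (⟨V, E, inferInstance, inferInstance, s, t, j, ε⟩ :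
      StarGraph J).matrixTrace fun _ => U.1) =
    (N : ℂ)⁻¹ * ∑ f : V → Fin N, umom N ε (f ∘ rowEnd s t ε) (f ∘ colEnd s t ε) := by
  rw [haarExpectation_eq, integral_const_mul]
  congr 1
  simp only [umom, haarExpectation_eq]
  rw [← integral_finsetSum _ fun f _ => integrable_unitaryHaar (continuous_prod_starPow _ _ _)]
  congr 1
  funext U
  rw [StarGraph.matrixTrace, finsum_eq_sum_of_fintype]
  refine Finset.sum_congr rfl fun f _ => finprod_congr fun e => ?_
  change (match ε e with | false => U.1 | true => U.1.conjTranspose) (f (s e)) (f (t e)) = _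
  simp only [Function.comp, rowEnd, colEnd]
  cases ε e <;> rfl

/-- Sort the maps `V → Fin N` by their kernel: Möbius inversion keeps the injective ones, which are
`N.descFactorial |V|` in number and all give the same moment. This moment depends only on the
incidences `r` and `c` of the edges with rows and columns; how rows are identified with columns in
`V` enters only through `|V|`. -/
theorem tendsto_hmom {y : A} (hy : S.IsHaarUnitary y) {s t : E → V} (hc : GConn s t) (ε : E → Bool)
    {r : E → R} {c : E → C} {jR : R → V} {jC : C → V} (hjR : Function.Injective jR)
    (hjC : Function.Injective jC) (hr : rowEnd s t ε = jR ∘ r) (hcol : colEnd s t ε = jC ∘ c) :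
    Tendsto (fun N : ℕ => (N : ℂ)⁻¹ * (N.descFactorial (Nat.card V) : ℂ) * hmom N ε r c) atTop
      (𝓝 (tau0 S s t fun e => starPow y (ε e))) := by
  have : Fintype V := Fintype.ofFinite V
  let g : ℕ → Setoid V → ℂ := fun N π => (N : ℂ)⁻¹ *
    ∑ f : V → Fin N with Setoid.ker f = π, umom N ε (f ∘ rowEnd s t ε) (f ∘ colEnd s t ε)
  let T : Setoid V → StarGraph Unit := fun σ =>
    ⟨Quotient σ, E, inferInstance, inferInstance, qmk σ ∘ s, qmk σ ∘ t, fun _ => (), ε⟩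
  let h : ℕ → Setoid V → ℂ := fun N σ =>
    haarExpectation N fun U => (N : ℂ)⁻¹ * (T σ).matrixTrace fun _ => U.1
  have hgh : ∀ N, ∀ σ, h N σ = ∑ π with σ ≤ π, g N π := by
    intro N σ
    have : Fintype (Quotient σ) := Fintype.ofFinite _
    simp only [h, g, T]
    rw [haarExpectation_matrixTrace, ← Finset.mul_sum]
    congr 1
    have h1 : ∀ f : Quotient σ → Fin N, umom N ε (f ∘ rowEnd (qmk σ ∘ s) (qmk σ ∘ t) ε)
        (f ∘ colEnd (qmk σ ∘ s) (qmk σ ∘ t) ε) =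
        umom N ε ((f ∘ qmk σ) ∘ rowEnd s t ε) ((f ∘ qmk σ) ∘ colEnd s t ε) := by
      intro f
      congr 1 <;> funext e <;> simp only [rowEnd, colEnd, Function.comp] <;> split_ifs <;> rfl
    simp only [h1]
    trans ∑ f : V → Fin N with σ ≤ Setoid.ker f,
      umom N ε (f ∘ rowEnd s t ε) (f ∘ colEnd s t ε)
    · refine Finset.sum_nbij (fun x => x ∘ qmk σ) ?_ ?_ ?_ (fun _ _ => rfl)
      · intro x _
        refine Finset.mem_filter.2 ⟨Finset.mem_univ _, fun v w hvw => ?_⟩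
        exact congrArg x (qmk_eq_iff.2 hvw)
      · exact fun x _ y _ hxy => (qmk_surjective σ).injective_comp_right hxy
      · intro f hf
        have hf := (Finset.mem_filter.1 hf).2
        exact ⟨Quotient.lift f hf, by simp, rfl⟩
    · rw [← Finset.sum_fiberwise_of_maps_to (t := {π | σ ≤ π}) (g := fun f => Setoid.ker f)
        (fun f hf => by simpa using hf)]
      refine Finset.sum_congr rfl fun π hπ => ?_
      rw [Finset.filter_filter]
      refine Finset.sum_congr (Finset.filter_congr fun f _ => ?_) fun _ _ => rfl
      exact ⟨fun h => h.2, fun h => ⟨h ▸ (Finset.mem_filter.1 hπ).2, h⟩⟩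
  have hlim : ∀ σ, Tendsto (fun N => h N σ) atTop (𝓝 (tau S (qmk σ ∘ s) (qmk σ ∘ t)
      fun e => starPow y (ε e))) := by
    intro σ
    have hcσ : (T σ).Connected := (connected_iff_gconn _).2 (hc.map (qmk_surjective σ))
    have := hy.2.2 (T σ) hcσ
    rwa [tau_eq_of_connected S _ (by exact hcσ)] at this
  have hlim2 : Tendsto (fun N => ∑ σ, partitionMoebius V σ * h N σ) atTop
      (𝓝 (tau0 S s t fun e => starPow y (ε e))) := by
    rw [tau0_def]
    exact tendsto_finsetSum _ fun σ _ => (hlim σ).const_mul _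
  refine hlim2.congr fun N => ?_
  rw [sum_partitionMoebius_mul (h N) (g N) (hgh N)]
  simp only [g, mul_assoc]
  congr 1
  have h2 : ∀ f ∈ ({f | Setoid.ker f = ⊥} : Finset (V → Fin N)),
      umom N ε (f ∘ rowEnd s t ε) (f ∘ colEnd s t ε) = hmom N ε r c := by
    intro f hf
    have hf : Function.Injective f := Setoid.injective_iff_ker_bot f |>.2 (Finset.mem_filter.1 hf).2
    rw [hr, hcol]
    exact umom_eq_hmom ε r c (hf.comp hjR) (hf.comp hjC)
  rw [Finset.sum_congr rfl h2, Finset.sum_const, nsmul_eq_mul]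
  congr 2
  rw [← Fintype.card_subtype, Nat.card_eq_fintype_card, ← Fintype.card_fin N,
    ← Fintype.card_embedding_eq, Fintype.card_fin]
  exact Fintype.card_congr ((Equiv.subtypeEquivRight fun f =>
    (Setoid.injective_iff_ker_bot f).symm).trans (Equiv.subtypeInjectiveEquivEmbedding V (Fin N)))

end MomentLimit

/-! ### A Khintchine inequality -/

section Khintchine

variable {ι : Type*} [Fintype ι] [DecidableEq ι]

/-- The sign attached to a boolean. -/
def boolSign (b : Bool) : ℝ := if b then -1 else 1

/-- By independence of the signs, the exponential moment is a product of hyperbolic cosines, and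
`cosh x ≤ exp (x² / 2)`. -/
theorem sum_exp_sign_le (a : ι → ℝ) (ha : ∑ i, a i ^ 2 ≤ 1) :
    ∑ d : ι → Bool, Real.exp (∑ i, boolSign (d i) * a i) ≤ 2 ^ Fintype.card ι * Real.exp (1 / 2) := by
  calc ∑ d : ι → Bool, Real.exp (∑ i, boolSign (d i) * a i)
      = ∏ i, ∑ b : Bool, Real.exp (boolSign b * a i) := by
        rw [Finset.prod_univ_sum]
        simp only [Real.exp_sum, Fintype.piFinset_univ]
    _ = ∏ i, (2 * Real.cosh (a i)) := by
        refine Finset.prod_congr rfl fun i _ => ?_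
        rw [Fintype.sum_bool, Real.cosh_eq]
        simp [boolSign]
        ring
    _ ≤ ∏ i, (2 * Real.exp (a i ^ 2 / 2)) := by
        gcongr with i
        exact Real.cosh_le_exp_half_sq _
    _ = 2 ^ Fintype.card ι * Real.exp ((∑ i, a i ^ 2) / 2) := by
        rw [Finset.prod_mul_distrib, Finset.prod_const, Finset.card_univ, ← Real.exp_sum,
          Finset.sum_div]
    _ ≤ _ := by gcongr

/-- The exponential series gives `|x| ^ n ≤ n! (exp x + exp (-x))`, which reduces powers to
exponential moments. -/
theorem sum_abs_sign_pow_le (n : ℕ) (a : ι → ℝ) (ha : ∑ i, a i ^ 2 ≤ 1) :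
    ∑ d : ι → Bool, |∑ i, boolSign (d i) * a i| ^ n ≤
      2 ^ Fintype.card ι * (2 * Real.exp (1 / 2) * n.factorial) := by
  have h1 : ∀ x : ℝ, |x| ^ n ≤ n.factorial * (Real.exp x + Real.exp (-x)) := by
    intro x
    have h := Real.pow_div_factorial_le_exp |x| (abs_nonneg x) n
    rw [div_le_iff₀' (by positivity)] at h
    refine h.trans (mul_le_mul_of_nonneg_left ?_ (by positivity))
    rcases abs_cases x with ⟨h, -⟩ | ⟨h, -⟩ <;> rw [h] <;> linarith [Real.exp_pos x, Real.exp_pos (-x)]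
  have h2 := sum_exp_sign_le a ha
  have h3 := sum_exp_sign_le (fun i => -a i) (by simpa using ha)
  calc ∑ d : ι → Bool, |∑ i, boolSign (d i) * a i| ^ n
      ≤ ∑ d : ι → Bool, n.factorial * (Real.exp (∑ i, boolSign (d i) * a i) +
          Real.exp (-∑ i, boolSign (d i) * a i)) := Finset.sum_le_sum fun d _ => h1 _
    _ = n.factorial * (∑ d : ι → Bool, Real.exp (∑ i, boolSign (d i) * a i) +
          ∑ d : ι → Bool, Real.exp (∑ i, boolSign (d i) * -a i)) := by
        rw [← Finset.mul_sum, Finset.sum_add_distrib]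
        simp only [mul_neg, Finset.sum_neg_distrib]
    _ ≤ n.factorial * (2 ^ Fintype.card ι * Real.exp (1 / 2) + 2 ^ Fintype.card ι * Real.exp (1 / 2)) := by
        gcongr
    _ = _ := by ring

/-- A form of the Khintchine inequality. -/
theorem sum_norm_sign_pow_le (n : ℕ) (a : ι → ℂ) (ha : ∑ i, ‖a i‖ ^ 2 ≤ 1) :
    ∑ d : ι → Bool, ‖∑ i, (boolSign (d i) : ℂ) * a i‖ ^ n ≤
      2 ^ Fintype.card ι * (2 ^ (n - 1) * (4 * Real.exp (1 / 2) * n.factorial)) := by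
  have hre : ∑ i, (a i).re ^ 2 ≤ 1 := (Finset.sum_le_sum fun i _ => by
    rw [← sq_abs]; gcongr; exact Complex.abs_re_le_norm _).trans ha
  have him : ∑ i, (a i).im ^ 2 ≤ 1 := (Finset.sum_le_sum fun i _ => by
    rw [← sq_abs]; gcongr; exact Complex.abs_im_le_norm _).trans ha
  have h1 := sum_abs_sign_pow_le n _ hre
  have h2 := sum_abs_sign_pow_le n _ him
  calc ∑ d : ι → Bool, ‖∑ i, (boolSign (d i) : ℂ) * a i‖ ^ n
      ≤ ∑ d : ι → Bool, 2 ^ (n - 1) * (|∑ i, boolSign (d i) * (a i).re| ^ n +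
          |∑ i, boolSign (d i) * (a i).im| ^ n) := by
        refine Finset.sum_le_sum fun d _ => ?_
        refine (pow_le_pow_left₀ (norm_nonneg _) (Complex.norm_le_abs_re_add_abs_im _) n).trans ?_
        have h3 : (∑ i, (boolSign (d i) : ℂ) * a i).re = ∑ i, boolSign (d i) * (a i).re := by
          simp [Complex.re_sum]
        have h4 : (∑ i, (boolSign (d i) : ℂ) * a i).im = ∑ i, boolSign (d i) * (a i).im := by
          simp [Complex.im_sum]
        rw [h3, h4]
        exact add_pow_le (abs_nonneg _) (abs_nonneg _) n
    _ ≤ 2 ^ (n - 1) * (2 ^ Fintype.card ι * (2 * Real.exp (1 / 2) * n.factorial) +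
          2 ^ Fintype.card ι * (2 * Real.exp (1 / 2) * n.factorial)) := by
        rw [← Finset.mul_sum, Finset.sum_add_distrib]
        gcongr
    _ = _ := by ring

end Khintchine

/-! ### Size of the moments of a Haar unitary matrix -/

section MomentBound

/-- The normalized matrix of the discrete Fourier transform. -/
def fourierUnitary (N : ℕ) (hN : N ≠ 0) : Matrix.unitaryGroup (Fin N) ℂ :=
  ⟨Matrix.of fun a b =>
    (Complex.exp (2 * Real.pi * Complex.I / N) ^ (a : ℕ)) ^ (b : ℕ) / (Real.sqrt N : ℂ), by
    have hζ := Complex.isPrimitiveRoot_exp N hN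
    set ζ := Complex.exp (2 * Real.pi * Complex.I / N)
    have hn : ‖ζ‖ = 1 := hζ.norm'_eq_one hN
    have hstar : star ζ = ζ⁻¹ := (Complex.inv_eq_conj hn).symm
    have hζ0 : ζ ≠ 0 := hζ.ne_zero hN
    have hsq : (Real.sqrt N : ℂ) * (Real.sqrt N : ℂ) = N := by
      rw [← Complex.ofReal_mul, Real.mul_self_sqrt (Nat.cast_nonneg N), Complex.ofReal_natCast]
    have hN' : (N : ℂ) ≠ 0 := Nat.cast_ne_zero.2 hN
    rw [Matrix.mem_unitaryGroup_iff]
    ext a b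
    have h1 : ∀ k : Fin N, ((ζ ^ (a : ℕ)) ^ (k : ℕ) / (Real.sqrt N : ℂ)) *
        star ((ζ ^ (b : ℕ)) ^ (k : ℕ) / (Real.sqrt N : ℂ)) =
        (ζ ^ (a : ℕ) * (ζ ^ (b : ℕ))⁻¹) ^ (k : ℕ) / N := by
      intro k
      rw [star_div₀, star_pow, star_pow, hstar, div_mul_div_comm]
      have : star (Real.sqrt N : ℂ) = Real.sqrt N := Complex.conj_ofReal _
      rw [this, hsq, mul_pow, inv_pow]
    simp only [Matrix.mul_apply, Matrix.star_apply, Matrix.of_apply, h1, Matrix.one_apply]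
    rw [← Finset.sum_div, Fin.sum_univ_eq_sum_range fun k => (ζ ^ (a : ℕ) * (ζ ^ (b : ℕ))⁻¹) ^ k]
    split_ifs with hab
    · rw [hab, mul_inv_cancel₀ (pow_ne_zero _ hζ0)]
      simp [hN']
    · have hx : ζ ^ (a : ℕ) * (ζ ^ (b : ℕ))⁻¹ ≠ 1 := by
        intro h
        rw [mul_inv_eq_one₀ (pow_ne_zero _ hζ0)] at h
        exact hab (Fin.ext (hζ.pow_inj a.2 b.2 h))
      have hxN : (ζ ^ (a : ℕ) * (ζ ^ (b : ℕ))⁻¹) ^ N = 1 := by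
        have h2 : ∀ m : ℕ, (ζ ^ m) ^ N = 1 := fun m => by
          rw [← pow_mul, mul_comm, pow_mul, hζ.pow_eq_one, one_pow]
        rw [mul_pow, inv_pow, h2, h2, inv_one, one_mul]
      have := geom_sum_mul (ζ ^ (a : ℕ) * (ζ ^ (b : ℕ))⁻¹) N
      rw [hxN, sub_self, mul_eq_zero, sub_eq_zero] at this
      rw [this.resolve_right hx, zero_div]⟩

theorem norm_fourierUnitary (N : ℕ) (hN : N ≠ 0) (a b : Fin N) :
    ‖(fourierUnitary N hN).1 a b‖ = (Real.sqrt N)⁻¹ := by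
  have hn : ‖Complex.exp (2 * Real.pi * Complex.I / N)‖ = 1 :=
    (Complex.isPrimitiveRoot_exp N hN).norm'_eq_one hN
  simp only [fourierUnitary, Matrix.of_apply, norm_div, norm_pow, hn, one_pow]
  rw [Complex.norm_real, Real.norm_of_nonneg (Real.sqrt_nonneg _), one_div]

theorem sum_norm_sq_col {N : ℕ} (U : Matrix.unitaryGroup (Fin N) ℂ) (b : Fin N) :
    ∑ k, ‖U.1 k b‖ ^ 2 = 1 := by
  have h : (star U.1 * U.1) b b = 1 := by
    rw [Matrix.mem_unitaryGroup_iff'.1 U.2, Matrix.one_apply_eq]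
  rw [Matrix.mul_apply] at h
  have h1 : ∀ k, (star U.1) b k * U.1 k b = ((‖U.1 k b‖ ^ 2 : ℝ) : ℂ) := by
    intro k
    rw [Matrix.star_apply]
    push_cast
    exact Complex.conj_mul' _
  simp only [h1] at h
  exact_mod_cast h

theorem continuous_norm_entry_pow {N : ℕ} (a b : Fin N) (n : ℕ) :
    Continuous fun U : Matrix.unitaryGroup (Fin N) ℂ => ‖U.1 a b‖ ^ n :=
  ((continuous_subtype_val).matrix_elem a b).norm.pow n

/-- The moments of an entry of a Haar unitary matrix. -/
theorem integral_norm_entry_pow_le (n N : ℕ) (hN : N ≠ 0) (a b : Fin N) :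
    ∫ U, ‖U.1 a b‖ ^ n ∂unitaryHaar N ≤
      (2 ^ (n - 1) * (4 * Real.exp (1 / 2) * n.factorial)) / Real.sqrt N ^ n := by
  set K : ℝ := 2 ^ (n - 1) * (4 * Real.exp (1 / 2) * n.factorial) with hK
  have hpos : 0 < Real.sqrt N := Real.sqrt_pos.2 (Nat.cast_pos.2 (Nat.pos_of_ne_zero hN))
  -- `U` has the same law as `F D U`, with `F` the Fourier matrix and `D` diagonal with signs. An
  -- entry of `F D U` is a signed sum whose coefficients have squared moduli summing to `1 / N`,
  -- because every entry of `F` has modulus `N^(-1/2)` and the columns of `U` are unit vectors.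
  -- Averaging over the signs, the Khintchine inequality applies for every fixed `U`.
  let g : (Fin N → Bool) → Matrix.unitaryGroup (Fin N) ℂ := fun d =>
    fourierUnitary N hN * signedPerm (Equiv.refl _) (fun i => (boolSign (d i) : ℂ))
      (fun i => Complex.conj_ofReal _) (fun i => by
        rw [← Complex.ofReal_mul]; unfold boolSign; split_ifs <;> simp)
  have hg : ∀ d U, (g d * U).1 a b = ∑ k, (boolSign (d k) : ℂ) *
      ((fourierUnitary N hN).1 a k * U.1 k b) := by
    intro d U
    simp only [g, mul_assoc]
    rw [Submonoid.coe_mul, Matrix.mul_apply]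
    refine Finset.sum_congr rfl fun k _ => ?_
    rw [signedPerm_mul_apply, Equiv.refl_apply]
    ring
  have h1 : ∀ U : Matrix.unitaryGroup (Fin N) ℂ, ∑ d : Fin N → Bool, ‖(g d * U).1 a b‖ ^ n ≤
      2 ^ N * (K / Real.sqrt N ^ n) := by
    intro U
    have h2 := sum_norm_sign_pow_le n
      (fun k => (Real.sqrt N : ℂ) * ((fourierUnitary N hN).1 a k * U.1 k b)) (by
        simp only [norm_mul, norm_fourierUnitary, Complex.norm_real,
          Real.norm_of_nonneg hpos.le, mul_inv_cancel_left₀ hpos.ne']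
        exact (sum_norm_sq_col U b).le)
    rw [Fintype.card_fin] at h2
    have h3 : ∀ d : Fin N → Bool, ‖∑ k, (boolSign (d k) : ℂ) *
        ((Real.sqrt N : ℂ) * ((fourierUnitary N hN).1 a k * U.1 k b))‖ ^ n =
        Real.sqrt N ^ n * ‖(g d * U).1 a b‖ ^ n := by
      intro d
      have h4 : ∑ k, (boolSign (d k) : ℂ) *
        ((Real.sqrt N : ℂ) * ((fourierUnitary N hN).1 a k * U.1 k b)) =
          (Real.sqrt N : ℂ) * (g d * U).1 a b := by
        rw [hg, Finset.mul_sum]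
        exact Finset.sum_congr rfl fun k _ => by ring
      rw [h4, norm_mul, Complex.norm_real, Real.norm_of_nonneg hpos.le, mul_pow]
    simp only [h3, ← Finset.mul_sum] at h2
    rw [← mul_div_assoc, le_div_iff₀' (by positivity)]
    exact h2
  have hcont : ∀ d, Continuous fun U : Matrix.unitaryGroup (Fin N) ℂ => ‖(g d * U).1 a b‖ ^ n :=
    fun d => (continuous_norm_entry_pow a b n).comp (continuous_const.mul continuous_id)
  have h2 : ∫ U, ∑ d : Fin N → Bool, ‖(g d * U).1 a b‖ ^ n ∂unitaryHaar N =
      2 ^ N * ∫ U, ‖U.1 a b‖ ^ n ∂unitaryHaar N := by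
    rw [integral_finsetSum _ fun d _ => integrable_unitaryHaar (hcont d)]
    simp only [integral_mul_left_eq_self
      (fun U : Matrix.unitaryGroup (Fin N) ℂ => ‖U.1 a b‖ ^ n)]
    simp
  have h3 : ∫ U, ∑ d : Fin N → Bool, ‖(g d * U).1 a b‖ ^ n ∂unitaryHaar N ≤
      2 ^ N * (K / Real.sqrt N ^ n) := by
    refine (integral_mono (integrable_unitaryHaar ?_) (integrable_const _) h1).trans ?_
    · exact continuous_finsetSum _ fun d _ => hcont d
    · simp
  rw [h2] at h3
  exact le_of_mul_le_mul_left h3 (by positivity)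

theorem prod_le_sum_pow {E : Type*} [Fintype E] [Nonempty E] (x : E → ℝ) (hx : ∀ e, 0 ≤ x e) :
    ∏ e, x e ≤ ∑ e, x e ^ Fintype.card E := by
  obtain ⟨e₀, he₀⟩ := Finite.exists_max x
  calc ∏ e, x e ≤ x e₀ ^ Fintype.card E := by
        rw [← Finset.card_univ, ← Finset.prod_const]
        exact Finset.prod_le_prod (fun e _ => hx e) fun e _ => he₀ e
    _ ≤ _ := Finset.single_le_sum (f := fun e => x e ^ Fintype.card E)
        (fun e _ => pow_nonneg (hx e) _) (Finset.mem_univ e₀)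

theorem norm_starPow (z : ℂ) (b : Bool) : ‖starPow z b‖ = ‖z‖ := by
  cases b
  · rfl
  · exact norm_star z

variable {E R C : Type} [Finite E] [Finite R] [Finite C]

theorem exists_norm_hmom_le (ε : E → Bool) (r : E → R) (c : E → C) :
    ∃ K : ℝ, 0 ≤ K ∧ ∀ N : ℕ, N ≠ 0 → ‖hmom N ε r c‖ ≤ K / Real.sqrt N ^ Nat.card E := by
  have : Fintype E := Fintype.ofFinite E
  have key : ∃ K : ℝ, 0 ≤ K ∧ ∀ N : ℕ, N ≠ 0 → ∀ i j : E → Fin N, ‖umom N ε i j‖ ≤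
      K / Real.sqrt N ^ Nat.card E := by
    rcases isEmpty_or_nonempty E with hE | hE
    · refine ⟨1, zero_le_one, fun N _ i j => ?_⟩
      simp only [umom, haarExpectation_eq, finprod_of_isEmpty, integral_const, probReal_univ,
        one_smul, norm_one, Nat.card_of_isEmpty, pow_zero, div_one, le_refl]
    · set n := Nat.card E with hn
      set K : ℝ := 2 ^ (n - 1) * (4 * Real.exp (1 / 2) * n.factorial) with hK
      refine ⟨n * K, by positivity, fun N hN i j => ?_⟩
      rw [umom, haarExpectation_eq]
      calc ‖∫ U, ∏ᶠ e, starPow (U.1 (i e) (j e)) (ε e) ∂unitaryHaar N‖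
          ≤ ∫ U, ‖∏ᶠ e, starPow (U.1 (i e) (j e)) (ε e)‖ ∂unitaryHaar N :=
            norm_integral_le_integral_norm _
        _ ≤ ∫ U, ∑ e, ‖U.1 (i e) (j e)‖ ^ n ∂unitaryHaar N := by
            refine integral_mono (integrable_unitaryHaar (continuous_prod_starPow ε i j).norm)
              (integrable_unitaryHaar (continuous_finsetSum _ fun e _ =>
                continuous_norm_entry_pow _ _ _)) fun U => ?_
            simp only [finprod_eq_prod_of_fintype, norm_prod, norm_starPow]
            rw [hn, Nat.card_eq_fintype_card]
            exact prod_le_sum_pow _ fun e => norm_nonneg _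
        _ = ∑ e, ∫ U, ‖U.1 (i e) (j e)‖ ^ n ∂unitaryHaar N :=
            integral_finsetSum _ fun e _ => integrable_unitaryHaar (continuous_norm_entry_pow _ _ _)
        _ ≤ ∑ _e : E, K / Real.sqrt N ^ n :=
            Finset.sum_le_sum fun e _ => integral_norm_entry_pow_le n N hN _ _
        _ = n * K / Real.sqrt N ^ n := by
            rw [Finset.sum_const, Finset.card_univ, nsmul_eq_mul, ← Nat.card_eq_fintype_card,
              ← mul_div_assoc]
  obtain ⟨K, hK, h⟩ := key
  refine ⟨K, hK, fun N hN => ?_⟩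
  rw [hmom]
  split_ifs
  · exact h N hN _ _
  · rw [norm_zero]; positivity

end MomentBound

/-! ### Constraints on connected graphs with nonzero injective trace in a Haar unitary -/

section HaarGraphs

variable {A : Type u} [Ring A] [StarRing A] [Algebra ℂ A] [StarModule ℂ A] {S : TrafficSpace A}
variable {E V R C W : Type} [Finite E] [Finite V] [Finite R] [Finite C] [Finite W]

/-- An odd row makes every moment in the limit vanish. -/
theorem even_row_of_tau0_ne_zero {y : A} (hy : S.IsHaarUnitary y) {s t : E → V} (hc : GConn s t)
    (ε : E → Bool) (h : tau0 S s t (fun e => starPow y (ε e)) ≠ 0) (v : V) :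
    Even (Nat.card {e // rowEnd s t ε e = v}) := by
  by_contra hodd
  rw [Nat.not_even_iff_odd] at hodd
  have hlim := tendsto_hmom hy hc ε (r := rowEnd s t ε) (c := colEnd s t ε) (jR := id) (jC := id) Function.injective_id
    Function.injective_id rfl rfl
  have h0 : ∀ N, hmom N ε (rowEnd s t ε) (colEnd s t ε) = 0 := by
    intro N
    rw [hmom]
    split_ifs with hN
    · refine umom_eq_zero_of_odd_row (hN.1.choose v) ?_
      simpa only [Function.comp, hN.1.choose_spec.eq_iff] using hodd
    · rfl
  simp only [h0, mul_zero] at hlim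
  exact h (tendsto_nhds_unique hlim tendsto_const_nhds)

theorem even_col_of_tau0_ne_zero {y : A} (hy : S.IsHaarUnitary y) {s t : E → V} (hc : GConn s t)
    (ε : E → Bool) (h : tau0 S s t (fun e => starPow y (ε e)) ≠ 0) (v : V) :
    Even (Nat.card {e // colEnd s t ε e = v}) := by
  by_contra hodd
  rw [Nat.not_even_iff_odd] at hodd
  have hlim := tendsto_hmom hy hc ε (r := rowEnd s t ε) (c := colEnd s t ε) (jR := id) (jC := id) Function.injective_id
    Function.injective_id rfl rfl
  have h0 : ∀ N, hmom N ε (rowEnd s t ε) (colEnd s t ε) = 0 := by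
    intro N
    rw [hmom]
    split_ifs with hN
    · refine umom_eq_zero_of_odd_col (hN.2.choose v) ?_
      simpa only [Function.comp, hN.2.choose_spec.eq_iff] using hodd
    · rfl
  simp only [h0, mul_zero] at hlim
  exact h (tendsto_nhds_unique hlim tendsto_const_nhds)

/-- The quantity converging to τ⁰ has order at most `N^(|V| - 1 - |E|/2)`, so a nonzero limit
requires a nonnegative exponent. -/
theorem card_edges_le_of_tau0_ne_zero {y : A} (hy : S.IsHaarUnitary y) {s t : E → V}
    (hc : GConn s t) (ε : E → Bool) (h : tau0 S s t (fun e => starPow y (ε e)) ≠ 0) :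
    Nat.card E + 2 ≤ 2 * Nat.card V := by
  by_contra hlt
  have hlim := tendsto_hmom hy hc ε (r := rowEnd s t ε) (c := colEnd s t ε) (jR := id) (jC := id) Function.injective_id
    Function.injective_id rfl rfl
  refine h (tendsto_nhds_unique hlim ?_)
  obtain ⟨K, hK, hb⟩ := exists_norm_hmom_le ε (rowEnd s t ε) (colEnd s t ε)
  have hlim2 : Tendsto (fun N : ℕ => K / Real.sqrt N) atTop (𝓝 0) :=
    (Real.tendsto_sqrt_atTop.comp tendsto_natCast_atTop_atTop).const_div_atTop K
  refine squeeze_zero_norm' (Filter.eventually_atTop.2 ⟨1, fun N hN => ?_⟩) hlim2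
  have hN0 : N ≠ 0 := by omega
  have h1 : 1 ≤ Real.sqrt N := by rw [Real.one_le_sqrt]; exact_mod_cast hN
  have hsq : (N : ℝ) = Real.sqrt N ^ 2 := (Real.sq_sqrt (Nat.cast_nonneg N)).symm
  set x := Real.sqrt N
  have hx : 0 < x := by linarith
  rw [norm_mul, norm_mul, norm_inv, Complex.norm_natCast, Complex.norm_natCast]
  have h2 : (N.descFactorial (Nat.card V) : ℝ) ≤ x ^ (2 * Nat.card V) := by
    rw [pow_mul, ← hsq]
    exact_mod_cast Nat.descFactorial_le_pow N _
  calc (N : ℝ)⁻¹ * (N.descFactorial (Nat.card V) : ℝ) * ‖hmom N ε (rowEnd s t ε) (colEnd s t ε)‖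
      ≤ (x ^ 2)⁻¹ * x ^ (2 * Nat.card V) * (K / x ^ Nat.card E) := by
        rw [hsq]
        gcongr
        exact hb N hN0
    _ ≤ (x ^ 2)⁻¹ * x ^ (Nat.card E + 1) * (K / x ^ Nat.card E) := by
        gcongr
        omega
    _ = K / x := by
        field_simp
        ring

theorem GConn.of_mk_eq {E' : Type} {s t : E → V} {s' t' : E' → V} (h : GConn s t)
    (h' : ∀ e, GComp.mk s' t' (s e) = GComp.mk s' t' (t e)) : GConn s' t' :=
  ⟨h.1, fun v w => GComp.eq_of_mk_eq (h.2 v w) _ h'⟩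

/-- The components of a bipartite graph can be glued into a connected graph, the vertices of a same
side being kept distinct. -/
theorem exists_chain_gluing [Nonempty E] {r : E → R} {c : E → C} (hr : Function.Surjective r)
    (hc : Function.Surjective c) :
    ∃ (W : Type) (_ : Finite W) (jR : R → W) (jC : C → W), Function.Injective jR ∧
      Function.Injective jC ∧ GConn (jR ∘ r) (jC ∘ c) ∧
      Nat.card W + ccard (Sum.inl ∘ r : E → R ⊕ C) (Sum.inr ∘ c) = Nat.card R + Nat.card C + 1 := by
  set s : E → R ⊕ C := Sum.inl ∘ r with hs
  set t : E → R ⊕ C := Sum.inr ∘ c with ht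
  have hpos : 0 < ccard s t := Nat.card_pos_iff.2
    ⟨⟨GComp.mk s t (Sum.inl (r (Classical.arbitrary E)))⟩, inferInstance⟩
  obtain ⟨m, hm⟩ : ∃ m, ccard s t = m + 1 := ⟨ccard s t - 1, by omega⟩
  let f : GComp s t ≃ Fin (m + 1) := Finite.equivFinOfCardEq hm
  have hρ : ∀ i, ∃ x : R, f (GComp.mk s t (Sum.inl x)) = i := by
    intro i
    obtain ⟨x | x, hx⟩ := GComp.mk_surjective s t (f.symm i)
    · exact ⟨x, by rw [hx, f.apply_symm_apply]⟩
    · obtain ⟨e, rfl⟩ := hc x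
      exact ⟨r e, by rw [← f.apply_symm_apply i, ← hx]; exact congrArg f (GComp.sound s t e)⟩
  have hκ : ∀ i, ∃ x : C, f (GComp.mk s t (Sum.inr x)) = i := by
    intro i
    obtain ⟨x | x, hx⟩ := GComp.mk_surjective s t (f.symm i)
    · obtain ⟨e, rfl⟩ := hr x
      exact ⟨c e, by rw [← f.apply_symm_apply i, ← hx]; exact congrArg f (GComp.sound s t e).symm⟩
    · exact ⟨x, by rw [hx, f.apply_symm_apply]⟩
  choose ρ hρ using hρ
  choose κ hκ using hκ
  have hρi : Function.Injective ρ := fun i j h => by rw [← hρ i, ← hρ j, h]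
  have hκi : Function.Injective κ := fun i j h => by rw [← hκ i, ← hκ j, h]
  -- With the components numbered `0, …, m`, the chosen column of component `i + 1` is identified
  -- with the chosen row of component `i`. All rows and the remaining columns are kept, so exactly
  -- `m` vertices disappear.
  let Q : C → Prop := fun x => ∃ i : Fin m, x = κ i.succ
  let jC : C → R ⊕ {x // ¬ Q x} := fun x =>
    if h : Q x then Sum.inl (ρ h.choose.castSucc) else Sum.inr ⟨x, h⟩
  have hjC : ∀ i : Fin m, jC (κ i.succ) = Sum.inl (ρ i.castSucc) := by
    intro i
    have h : Q (κ i.succ) := ⟨i, rfl⟩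
    have h2 : h.choose = i := (Fin.succ_injective _ (hκi h.choose_spec)).symm
    simp only [jC, dif_pos h, h2]
  have hjC' : ∀ x (h : ¬ Q x), jC x = Sum.inr ⟨x, h⟩ := fun x h => dif_neg h
  refine ⟨R ⊕ {x // ¬ Q x}, inferInstance, Sum.inl, jC, Sum.inl_injective, ?_, ?_, ?_⟩
  · intro x x' hxx
    by_cases h : Q x <;> by_cases h' : Q x'
    · obtain ⟨i, rfl⟩ := h
      obtain ⟨j, rfl⟩ := h'
      rw [hjC, hjC] at hxx
      rw [Fin.castSucc_injective _ (hρi (Sum.inl_injective hxx))]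
    · obtain ⟨i, rfl⟩ := h
      rw [hjC, hjC' _ h'] at hxx
      simp at hxx
    · obtain ⟨i, rfl⟩ := h'
      rw [hjC, hjC' _ h] at hxx
      simp at hxx
    · rw [hjC' _ h, hjC' _ h'] at hxx
      exact congrArg Subtype.val (Sum.inr_injective hxx)
  · let F : R ⊕ C → GComp (Sum.inl ∘ r : E → R ⊕ {x // ¬ Q x}) (jC ∘ c) :=
      fun x => GComp.mk _ _ (Sum.elim Sum.inl jC x)
    have hF : ∀ x x', GComp.mk s t x = GComp.mk s t x' → F x = F x' := fun x x' h =>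
      GComp.eq_of_mk_eq h F fun e => GComp.sound (Sum.inl ∘ r : E → R ⊕ {x // ¬ Q x}) (jC ∘ c) e
    have hchain : ∀ i, F (Sum.inl (ρ i)) = F (Sum.inl (ρ 0)) := by
      intro i
      induction i using Fin.induction with
      | zero => rfl
      | succ i ih =>
        rw [← ih, hF (Sum.inl (ρ i.succ)) (Sum.inr (κ i.succ))
          (f.injective ((hρ _).trans (hκ _).symm))]
        exact congrArg (GComp.mk _ _) (hjC i)
    have hall : ∀ x, F x = F (Sum.inl (ρ 0)) := fun x => by
      rw [← hchain (f (GComp.mk s t x))]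
      exact hF _ _ (f.injective (hρ _).symm)
    have hsurj : ∀ w : R ⊕ {x // ¬ Q x}, GComp.mk _ _ w = F (Sum.inl (ρ 0)) := by
      rintro (x | ⟨x, hx⟩)
      · exact hall (Sum.inl x)
      · rw [← hjC' x hx]
        exact hall (Sum.inr x)
    exact ⟨⟨Sum.inl (ρ 0)⟩, fun v w => (hsurj v).trans (hsurj w).symm⟩
  · rw [hm, Nat.card_sum]
    have h1 : Nat.card C = Nat.card {x // Q x} + Nat.card {x // ¬ Q x} := by
      rw [← Nat.card_sum]; exact (Nat.card_congr (Equiv.sumCompl Q)).symm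
    have h2 : Nat.card {x // Q x} = m := by
      have : Function.Injective fun i : Fin m => κ i.succ := fun i j h =>
        Fin.succ_injective _ (hκi h)
      have h3 := Nat.card_congr (Equiv.ofInjective _ this)
      rw [Nat.card_fin] at h3
      rw [h3]
      exact Nat.card_congr (Equiv.subtypeEquivRight fun x => by simp [Q, eq_comm])
    omega

/-- Compare `V` with the chained graph `W`, which has the same moments. If `W` had more vertices,
convergence of `N^(-1) (N)_|W| hmom` would force the same expression with `|V|` in place of `|W|` to
tend to `0`, against the nonvanishing of τ⁰. -/
theorem card_add_le_of_surjective {y : A} (hy : S.IsHaarUnitary y) {s t : E → V} (hc : GConn s t)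
    (ε : E → Bool) (h : tau0 S s t (fun e => starPow y (ε e)) ≠ 0) [Nonempty E]
    {r : E → R} {c : E → C} (hr : Function.Surjective r)
    (hcs : Function.Surjective c) {jR : R → V} {jC : C → V} (hjR : Function.Injective jR)
    (hjC : Function.Injective jC) (hrow : rowEnd s t ε = jR ∘ r) (hcol : colEnd s t ε = jC ∘ c) :
    Nat.card R + Nat.card C + 1 ≤ Nat.card V + ccard (Sum.inl ∘ r : E → R ⊕ C) (Sum.inr ∘ c) := by
  obtain ⟨W, _, kR, kC, hkR, hkC, hW, hcard⟩ := exists_chain_gluing hr hcs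
  suffices hVW : Nat.card W ≤ Nat.card V by omega
  by_contra hlt
  push Not at hlt
  let s' : E → W := fun e => if ε e then kC (c e) else kR (r e)
  let t' : E → W := fun e => if ε e then kR (r e) else kC (c e)
  have hrow' : rowEnd s' t' ε = kR ∘ r := by
    funext e; simp only [rowEnd, s', t', Function.comp]; split_ifs <;> rfl
  have hcol' : colEnd s' t' ε = kC ∘ c := by
    funext e; simp only [colEnd, s', t', Function.comp]; split_ifs <;> rfl
  have hcW : GConn s' t' := hW.of_mk_eq fun e => by
    have := GComp.sound s' t' e
    simp only [s', t'] at this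
    simp only [Function.comp]
    split_ifs at this
    · exact this.symm
    · exact this
  have hlim := tendsto_hmom hy hc ε hjR hjC hrow hcol
  have hlim' := tendsto_hmom hy hcW ε hkR hkC hrow' hcol'
  obtain ⟨k, hk⟩ : ∃ k, Nat.card W = Nat.card V + (k + 1) :=
    ⟨Nat.card W - Nat.card V - 1, by omega⟩
  -- This is the ratio of the two falling factorials: the extra `k + 1` factors of the larger one
  -- tend to infinity.
  have hD : Tendsto (fun N : ℕ => ((N - Nat.card V).descFactorial (k + 1) : ℂ)⁻¹) atTop (𝓝 0) := by
    refine tendsto_inv₀_cobounded.comp (tendsto_norm_atTop_iff_cobounded.1 ?_)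
    simp only [Complex.norm_natCast]
    refine tendsto_natCast_atTop_atTop.comp ?_
    refine tendsto_atTop_mono (f := fun N => N - Nat.card V - k) (fun N => ?_) ?_
    · refine le_trans ?_ (Nat.pow_sub_le_descFactorial (N - Nat.card V) (k + 1))
      refine le_trans ?_ (Nat.le_self_pow (Nat.succ_ne_zero k) _)
      omega
    · simp only [Nat.sub_sub]
      exact tendsto_sub_atTop_nat _
  have h2 := hlim'.mul hD
  rw [mul_zero] at h2
  refine h (tendsto_nhds_unique hlim (h2.congr' ?_))
  filter_upwards [eventually_ge_atTop (Nat.card W)] with N hN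
  have h3 := Nat.descFactorial_mul_descFactorial (n := N) (k := Nat.card V) (m := Nat.card W) hlt.le
  have h4 : Nat.card W - Nat.card V = k + 1 := by omega
  rw [h4] at h3
  have h5 : ((N - Nat.card V).descFactorial (k + 1) : ℂ) ≠ 0 :=
    Nat.cast_ne_zero.2 (Nat.descFactorial_pos.2 (by omega)).ne'
  rw [← h3]
  push_cast
  field_simp

theorem ccard_sum_injective {R' C' : Type} [Finite R'] [Finite C'] {jR : R' → R} {jC : C' → C}
    (hjR : Function.Injective jR) (hjC : Function.Injective jC) (r : E → R') (c : E → C') :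
    ccard (Sum.inl ∘ jR ∘ r : E → R ⊕ C) (Sum.inr ∘ jC ∘ c) + (Nat.card R' + Nat.card C') =
      ccard (Sum.inl ∘ r : E → R' ⊕ C') (Sum.inr ∘ c) + (Nat.card R + Nat.card C) := by
  rw [← Nat.card_sum, ← Nat.card_sum]
  exact ccard_injective (hjR.sumMap hjC) (Sum.inl ∘ r) (Sum.inr ∘ c)

/-- A graph with a nonzero injective trace in a Haar unitary traffic has at least as many vertices
as the largest connected graph with the same rows and columns. -/
theorem card_add_le_of_tau0_ne_zero {y : A} (hy : S.IsHaarUnitary y) {s t : E → V}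
    (hc : GConn s t) (ε : E → Bool) (h : tau0 S s t (fun e => starPow y (ε e)) ≠ 0)
    {r : E → R} {c : E → C} {jR : R → V} {jC : C → V} (hjR : Function.Injective jR)
    (hjC : Function.Injective jC) (hrow : rowEnd s t ε = jR ∘ r) (hcol : colEnd s t ε = jC ∘ c) :
    Nat.card R + Nat.card C + 1 ≤ Nat.card V + ccard (Sum.inl ∘ r : E → R ⊕ C) (Sum.inr ∘ c) := by
  rcases isEmpty_or_nonempty E with hE | hE
  · have := hc.1
    have hV : 0 < Nat.card V := Nat.card_pos
    rw [ccard_of_isEmpty, Nat.card_sum]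
    omega
  -- Unused rows and columns are isolated vertices, which add equally to both sides; it suffices to
  -- treat the ranges of `r` and `c`.
  · have h1 := card_add_le_of_surjective hy hc ε h (r := Set.rangeFactorization r)
      (c := Set.rangeFactorization c) Set.rangeFactorization_surjective
      Set.rangeFactorization_surjective (hjR.comp Subtype.val_injective)
      (hjC.comp Subtype.val_injective) hrow hcol
    have h2 := ccard_sum_injective (Subtype.val_injective (p := (· ∈ Set.range r)))
      (Subtype.val_injective (p := (· ∈ Set.range c))) (Set.rangeFactorization r)
      (Set.rangeFactorization c)
    have h3 : ccard (Sum.inl ∘ r : E → R ⊕ C) (Sum.inr ∘ c) +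
        (Nat.card (Set.range r) + Nat.card (Set.range c)) = _ := h2
    omega

end HaarGraphs

/-! ### The same constraints, and freeness, for disconnected graphs -/

section HaarComponents

variable {A : Type u} [Ring A] [StarRing A] [Algebra ℂ A] [StarModule ℂ A] {S : TrafficSpace A}
variable {E E₁ E₂ V I R C W : Type} [Finite E] [Finite E₁] [Finite E₂] [Finite V] [Finite I]
  [Finite R] [Finite C] [Finite W]

theorem GComp.mk_rowEnd (s t : E → V) (ε : E → Bool) (e : E) :
    GComp.mk s t (rowEnd s t ε e) = GComp.mk s t (s e) := by
  unfold rowEnd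
  split_ifs
  · exact (GComp.sound s t e).symm
  · rfl

theorem GComp.mk_colEnd (s t : E → V) (ε : E → Bool) (e : E) :
    GComp.mk s t (colEnd s t ε e) = GComp.mk s t (s e) := by
  unfold colEnd
  split_ifs
  · rfl
  · exact (GComp.sound s t e).symm

theorem ccard_rowEnd_colEnd (s t : E → V) (ε : E → Bool) :
    ccard (rowEnd s t ε) (colEnd s t ε) = ccard s t := by
  refine Nat.card_congr (Equiv.ofBijective (GComp.lift (GComp.mk s t) fun e =>
    (GComp.mk_rowEnd s t ε e).trans (GComp.mk_colEnd s t ε e).symm) ⟨?_, ?_⟩)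
  · intro x y hxy
    obtain ⟨v, rfl⟩ := GComp.mk_surjective _ _ x
    obtain ⟨w, rfl⟩ := GComp.mk_surjective _ _ y
    refine GComp.eq_of_mk_eq (s := s) (t := t) hxy (GComp.mk _ _) fun e => ?_
    have := GComp.sound (rowEnd s t ε) (colEnd s t ε) e
    unfold rowEnd colEnd at this ⊢
    by_cases h : ε e = true
    · simp only [h, if_true] at this
      exact this.symm
    · simp only [h] at this
      exact this
  · intro k
    obtain ⟨v, rfl⟩ := GComp.mk_surjective _ _ k
    exact ⟨GComp.mk _ _ v, rfl⟩

theorem tau0_fib_ne_zero {s t : E → V} {l : E → A} (h : Mtau S s t l ≠ 0) (k : GComp s t) :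
    tau0 S (fibS (GComp.mk s t) s k) (fibT (GComp.mk s t) s t (GComp.sound s t) k)
      (fun e => l e.1) ≠ 0 :=
  Finset.prod_ne_zero_iff.1 h k (Finset.mem_univ k)

theorem fib_rowEnd (s t : E → V) (ε : E → Bool) (k : GComp s t) :
    rowEnd (fibS (GComp.mk s t) s k) (fibT (GComp.mk s t) s t (GComp.sound s t) k)
      (fun e => ε e.1) = fun e => ⟨rowEnd s t ε e.1, (GComp.mk_rowEnd s t ε e.1).trans e.2⟩ := by
  funext e
  refine Subtype.ext ?_
  simp only [rowEnd]
  split_ifs <;> rfl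

theorem fib_colEnd (s t : E → V) (ε : E → Bool) (k : GComp s t) :
    colEnd (fibS (GComp.mk s t) s k) (fibT (GComp.mk s t) s t (GComp.sound s t) k)
      (fun e => ε e.1) = fun e => ⟨colEnd s t ε e.1, (GComp.mk_colEnd s t ε e.1).trans e.2⟩ := by
  funext e
  refine Subtype.ext ?_
  simp only [colEnd]
  split_ifs <;> rfl

theorem even_row_of_Mtau_ne_zero {y : A} (hy : S.IsHaarUnitary y) {s t : E → V}
    (ε : E → Bool) (h : Mtau S s t (fun e => starPow y (ε e)) ≠ 0) (v : V) :
    Even (Nat.card {e // rowEnd s t ε e = v}) := by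
  have h1 := even_row_of_tau0_ne_zero hy (gconn_fib s t (GComp.mk s t v)) (fun e => ε e.1)
    (tau0_fib_ne_zero h (GComp.mk s t v)) ⟨v, rfl⟩
  rw [fib_rowEnd] at h1
  refine (Nat.card_congr ?_) ▸ h1
  exact
    { toFun := fun e => ⟨e.1.1, congrArg Subtype.val e.2⟩
      invFun := fun e => ⟨⟨e.1, (GComp.mk_rowEnd s t ε e.1).symm.trans (congrArg _ e.2)⟩,
        Subtype.ext e.2⟩
      left_inv := fun _ => rfl
      right_inv := fun _ => rfl }

theorem even_col_of_Mtau_ne_zero {y : A} (hy : S.IsHaarUnitary y) {s t : E → V}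
    (ε : E → Bool) (h : Mtau S s t (fun e => starPow y (ε e)) ≠ 0) (v : V) :
    Even (Nat.card {e // colEnd s t ε e = v}) := by
  have h1 := even_col_of_tau0_ne_zero hy (gconn_fib s t (GComp.mk s t v)) (fun e => ε e.1)
    (tau0_fib_ne_zero h (GComp.mk s t v)) ⟨v, rfl⟩
  rw [fib_colEnd] at h1
  refine (Nat.card_congr ?_) ▸ h1
  exact
    { toFun := fun e => ⟨e.1.1, congrArg Subtype.val e.2⟩
      invFun := fun e => ⟨⟨e.1, (GComp.mk_colEnd s t ε e.1).symm.trans (congrArg _ e.2)⟩,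
        Subtype.ext e.2⟩
      left_inv := fun _ => rfl
      right_inv := fun _ => rfl }

theorem ccard_eq_sum_one (s t : E → V) : ccard s t = ∑ _k : GComp s t, 1 := by
  rw [Finset.sum_const, Finset.card_univ, smul_eq_mul, mul_one, ccard, Nat.card_eq_fintype_card]

/-- A bound on the number of edges of connected graphs extends to all graphs. -/
theorem card_edges_add_le {s t : E → V}
    (h : ∀ k : GComp s t, Nat.card {e // GComp.mk s t (s e) = k} + 2 ≤
      2 * Nat.card {v // GComp.mk s t v = k}) :
    Nat.card E + 2 * ccard s t ≤ 2 * Nat.card V := by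
  rw [card_eq_sum_fib (fun e => GComp.mk s t (s e)), card_eq_sum_fib (GComp.mk s t),
    ccard_eq_sum_one, Finset.mul_sum, Finset.mul_sum, ← Finset.sum_add_distrib]
  exact Finset.sum_le_sum fun k _ => h k

theorem card_edges_le_of_Mtau_ne_zero {y : A} (hy : S.IsHaarUnitary y) {s t : E → V}
    (ε : E → Bool) (h : Mtau S s t (fun e => starPow y (ε e)) ≠ 0) :
    Nat.card E + 2 * ccard s t ≤ 2 * Nat.card V :=
  card_edges_add_le fun k => card_edges_le_of_tau0_ne_zero hy (gconn_fib s t k) (fun e => ε e.1)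
    (tau0_fib_ne_zero h k)

theorem card_add_le_of_Mtau_ne_zero {y : A} (hy : S.IsHaarUnitary y) {s t : E → V}
    (ε : E → Bool) (h : Mtau S s t (fun e => starPow y (ε e)) ≠ 0)
    {r : E → R} {c : E → C} {jR : R → V} {jC : C → V} (hjR : Function.Injective jR)
    (hjC : Function.Injective jC) (hrow : rowEnd s t ε = jR ∘ r) (hcol : colEnd s t ε = jC ∘ c) :
    Nat.card R + Nat.card C + ccard s t ≤
      Nat.card V + ccard (Sum.inl ∘ r : E → R ⊕ C) (Sum.inr ∘ c) := by
  let p : R ⊕ C → GComp s t := fun x => GComp.mk s t (Sum.elim jR jC x)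
  have hr : ∀ e, GComp.mk s t (jR (r e)) = GComp.mk s t (s e) := fun e => by
    rw [← GComp.mk_rowEnd s t ε e, hrow]; rfl
  have hc : ∀ e, GComp.mk s t (jC (c e)) = GComp.mk s t (s e) := fun e => by
    rw [← GComp.mk_colEnd s t ε e, hcol]; rfl
  have hp : ∀ e, p ((Sum.inl ∘ r : E → R ⊕ C) e) = p ((Sum.inr ∘ c : E → R ⊕ C) e) :=
    fun e => (hr e).trans (hc e).symm
  rw [card_eq_sum_fib (GComp.mk s t), card_eq_sum_fib (fun x => GComp.mk s t (jR x)),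
    card_eq_sum_fib (fun x => GComp.mk s t (jC x)), ccard_eq_sum_one,
    ccard_eq_sum_fib p hp, ← Finset.sum_add_distrib, ← Finset.sum_add_distrib,
    ← Finset.sum_add_distrib]
  refine Finset.sum_le_sum fun k _ => ?_
  let jRk : {x // GComp.mk s t (jR x) = k} → {v // GComp.mk s t v = k} := fun x => ⟨jR x.1, x.2⟩
  let jCk : {x // GComp.mk s t (jC x) = k} → {v // GComp.mk s t v = k} := fun x => ⟨jC x.1, x.2⟩
  let rk : {e // GComp.mk s t (s e) = k} → {x // GComp.mk s t (jR x) = k} :=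
    fun e => ⟨r e.1, (hr e.1).trans e.2⟩
  let ck : {e // GComp.mk s t (s e) = k} → {x // GComp.mk s t (jC x) = k} :=
    fun e => ⟨c e.1, (hc e.1).trans e.2⟩
  have h1 := card_add_le_of_tau0_ne_zero hy (gconn_fib s t k) (fun e => ε e.1)
    (tau0_fib_ne_zero h k) (r := rk) (c := ck) (jR := jRk) (jC := jCk)
    (fun x y hxy => Subtype.ext (hjR (congrArg Subtype.val hxy)))
    (fun x y hxy => Subtype.ext (hjC (congrArg Subtype.val hxy)))
    (by
      rw [fib_rowEnd]; funext e; exact Subtype.ext (congrFun hrow e.1))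
    (by
      rw [fib_colEnd]; funext e; exact Subtype.ext (congrFun hcol e.1))
  refine h1.trans (Nat.add_le_add_left (le_of_eq ?_) _)
  exact ccard_iso (fibSumEquiv fun x => p x = k).symm
    (Equiv.subtypeEquivRight fun e => by
      change _ ↔ GComp.mk s t (jR (r e)) = k
      rw [hr]) (fun _ => rfl) (fun _ => rfl)

/-- The multiplicative form of traffic-freeness. -/
theorem TFree.Mtau_eq {L₁ L₂ : Set A} (hT : TFree S L₁ L₂) (s₁ t₁ : E₁ → V) (s₂ t₂ : E₂ → V)
    {l₁ : E₁ → A} {l₂ : E₂ → A} (hl₁ : ∀ e, l₁ e ∈ L₁) (hl₂ : ∀ e, l₂ e ∈ L₂) :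
    Mtau S (Sum.elim s₁ s₂) (Sum.elim t₁ t₂) (Sum.elim l₁ l₂) =
      if ccard s₁ t₁ + ccard s₂ t₂ = Nat.card V + ccard (Sum.elim s₁ s₂) (Sum.elim t₁ t₂) then
        Mtau S s₁ t₁ l₁ * Mtau S s₂ t₂ l₂ else 0 := by
  set s := Sum.elim s₁ s₂ with hs
  set t := Sum.elim t₁ t₂ with ht
  have h₁ : ∀ e, GComp.mk s t (s₁ e) = GComp.mk s t (t₁ e) := fun e => GComp.sound s t (Sum.inl e)
  have h₂ : ∀ e, GComp.mk s t (s₂ e) = GComp.mk s t (t₂ e) := fun e => GComp.sound s t (Sum.inr e)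
  have hφ : ∀ k, fibS (GComp.mk s t) s k ∘ (fibSumEquiv fun e => GComp.mk s t (s e) = k).symm =
      Sum.elim (fibS (GComp.mk s t) s₁ k) (fibS (GComp.mk s t) s₂ k) := by
    intro k; funext e; rcases e with e | e <;> rfl
  have hφ' : ∀ k, fibT (GComp.mk s t) s t (GComp.sound s t) k ∘
      (fibSumEquiv fun e => GComp.mk s t (s e) = k).symm =
      Sum.elim (fibT (GComp.mk s t) s₁ t₁ h₁ k) (fibT (GComp.mk s t) s₂ t₂ h₂ k) := by
    intro k; funext e; rcases e with e | e <;> rfl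
  have hk : ∀ k, GConn (Sum.elim (fibS (GComp.mk s t) s₁ k) (fibS (GComp.mk s t) s₂ k))
      (Sum.elim (fibT (GComp.mk s t) s₁ t₁ h₁ k) (fibT (GComp.mk s t) s₂ t₂ h₂ k)) := by
    intro k
    rw [← hφ k, ← hφ' k]
    exact (gconn_fib s t k).comp_equiv _
  have htau : ∀ k, tau0 S (fibS (GComp.mk s t) s k)
      (fibT (GComp.mk s t) s t (GComp.sound s t) k) (fun e => Sum.elim l₁ l₂ e.1) =
      if ccard (fibS (GComp.mk s t) s₁ k) (fibT (GComp.mk s t) s₁ t₁ h₁ k) +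
        ccard (fibS (GComp.mk s t) s₂ k) (fibT (GComp.mk s t) s₂ t₂ h₂ k) =
          Nat.card {v // GComp.mk s t v = k} + 1 then
        Mtau S (fibS (GComp.mk s t) s₁ k) (fibT (GComp.mk s t) s₁ t₁ h₁ k) (fun e => l₁ e.1) *
        Mtau S (fibS (GComp.mk s t) s₂ k) (fibT (GComp.mk s t) s₂ t₂ h₂ k) (fun e => l₂ e.1)
      else 0 := by
    intro k
    rw [← hT _ _ _ _ _ _ _ (fun e => l₁ e.1) (fun e => l₂ e.1) (fun e => hl₁ _) (fun e => hl₂ _)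
      (hk k), ← tau0_comp_equiv S (gconn_fib s t k) (fibSumEquiv fun e => GComp.mk s t (s e) = k).symm,
      hφ, hφ']
    congr 1
    funext e; rcases e with e | e <;> rfl
  have hle : ∀ k ∈ Finset.univ, ccard (fibS (GComp.mk s t) s₁ k) (fibT (GComp.mk s t) s₁ t₁ h₁ k) +
        ccard (fibS (GComp.mk s t) s₂ k) (fibT (GComp.mk s t) s₂ t₂ h₂ k) ≤
          Nat.card {v // GComp.mk s t v = k} + 1 := by
    intro k _
    have := ccard_add_le (fibS (GComp.mk s t) s₁ k) (fibT (GComp.mk s t) s₁ t₁ h₁ k)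
      (fibS (GComp.mk s t) s₂ k) (fibT (GComp.mk s t) s₂ t₂ h₂ k)
    rwa [ccard_eq_one (hk k)] at this
  -- The global count is the sum over the components of the inequalities `hle`, so it is an equality
  -- if and only if every component is a free product.
  have key : ccard s₁ t₁ + ccard s₂ t₂ = Nat.card V + ccard s t ↔ ∀ k ∈ Finset.univ,
      ccard (fibS (GComp.mk s t) s₁ k) (fibT (GComp.mk s t) s₁ t₁ h₁ k) +
        ccard (fibS (GComp.mk s t) s₂ k) (fibT (GComp.mk s t) s₂ t₂ h₂ k) =
          Nat.card {v // GComp.mk s t v = k} + 1 := by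
    rw [ccard_eq_sum_fib (GComp.mk s t) h₁, ccard_eq_sum_fib (GComp.mk s t) h₂,
      card_eq_sum_fib (GComp.mk s t), ccard_eq_sum_one, ← Finset.sum_add_distrib,
      ← Finset.sum_add_distrib]
    exact Finset.sum_eq_sum_iff_of_le hle
  rw [Mtau, Finset.prod_congr rfl fun k _ => htau k]
  split_ifs with h
  · rw [Finset.prod_congr rfl fun k hk => if_pos (key.1 h k hk), Finset.prod_mul_distrib,
      ← Mtau_eq_prod_fib S l₁ (GComp.mk s t) h₁, ← Mtau_eq_prod_fib S l₂ (GComp.mk s t) h₂]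
  · rw [key] at h
    push Not at h
    obtain ⟨k, hk, h⟩ := h
    exact Finset.prod_eq_zero hk (if_neg h)

def leftEquiv {V I : Type} : V ≃ {x : V ⊕ I // x.isLeft = true} where
  toFun v := ⟨Sum.inl v, rfl⟩
  invFun x := x.1.getLeft x.2
  left_inv _ := rfl
  right_inv := by rintro ⟨x | x, h⟩; exacts [rfl, absurd h (by simp)]

def rightEquiv {V I : Type} : I ≃ {x : V ⊕ I // x.isLeft = false} where
  toFun v := ⟨Sum.inr v, rfl⟩
  invFun x := x.1.getRight (by simpa using x.2)
  left_inv _ := rfl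
  right_inv := by rintro ⟨x | x, h⟩; exacts [absurd h (by simp), rfl]

def sumFib {E₁ E₂ V I : Type} (s₁ : E₁ → V) (s₂ : E₂ → I) :
    {e : E₁ ⊕ E₂ // (Sum.elim (Sum.inl ∘ s₁) (Sum.inr ∘ s₂) e : V ⊕ I).isLeft = true} ≃ E₁ where
  toFun e := match e with
    | ⟨Sum.inl e, _⟩ => e
    | ⟨Sum.inr _, h⟩ => absurd h (by simp)
  invFun e := ⟨Sum.inl e, rfl⟩
  left_inv := by rintro ⟨e | e, h⟩; exacts [rfl, absurd h (by simp)]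
  right_inv _ := rfl

def sumFib' {E₁ E₂ V I : Type} (s₁ : E₁ → V) (s₂ : E₂ → I) :
    {e : E₁ ⊕ E₂ // (Sum.elim (Sum.inl ∘ s₁) (Sum.inr ∘ s₂) e : V ⊕ I).isLeft = false} ≃ E₂ where
  toFun e := match e with
    | ⟨Sum.inr e, _⟩ => e
    | ⟨Sum.inl _, h⟩ => absurd h (by simp)
  invFun e := ⟨Sum.inr e, rfl⟩
  left_inv := by rintro ⟨e | e, h⟩; exacts [absurd h (by simp), rfl]
  right_inv _ := rfl

theorem sum_isLeft_compat (s₁ t₁ : E₁ → V) (s₂ t₂ : E₂ → I) (e : E₁ ⊕ E₂) :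
    (Sum.elim (Sum.inl ∘ s₁) (Sum.inr ∘ s₂) e : V ⊕ I).isLeft =
      (Sum.elim (Sum.inl ∘ t₁) (Sum.inr ∘ t₂) e : V ⊕ I).isLeft := by
  rcases e with e | e <;> rfl

theorem ccard_disjoint (s₁ t₁ : E₁ → V) (s₂ t₂ : E₂ → I) :
    ccard (Sum.elim (Sum.inl ∘ s₁) (Sum.inr ∘ s₂) : E₁ ⊕ E₂ → V ⊕ I)
      (Sum.elim (Sum.inl ∘ t₁) (Sum.inr ∘ t₂)) = ccard s₁ t₁ + ccard s₂ t₂ := by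
  rw [ccard_eq_sum_fib Sum.isLeft (sum_isLeft_compat s₁ t₁ s₂ t₂), Fintype.sum_bool]
  congr 1
  · refine Eq.symm (ccard_iso leftEquiv (sumFib s₁ s₂).symm ?_ ?_) <;> intro e <;> rfl
  · refine Eq.symm (ccard_iso rightEquiv (sumFib' s₁ s₂).symm ?_ ?_) <;> intro e <;> rfl

theorem Mtau_disjoint (s₁ t₁ : E₁ → V) (s₂ t₂ : E₂ → I) (l₁ : E₁ → A) (l₂ : E₂ → A) :
    Mtau S (Sum.elim (Sum.inl ∘ s₁) (Sum.inr ∘ s₂) : E₁ ⊕ E₂ → V ⊕ I)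
      (Sum.elim (Sum.inl ∘ t₁) (Sum.inr ∘ t₂)) (Sum.elim l₁ l₂) =
      Mtau S s₁ t₁ l₁ * Mtau S s₂ t₂ l₂ := by
  rw [Mtau_eq_prod_fib S _ Sum.isLeft (sum_isLeft_compat s₁ t₁ s₂ t₂), Fintype.prod_bool]
  congr 1
  · refine Eq.symm (Mtau_iso S leftEquiv (sumFib s₁ s₂).symm ?_ ?_ ?_) <;> intro e <;> rfl
  · refine Eq.symm (Mtau_iso S rightEquiv (sumFib' s₁ s₂).symm ?_ ?_ ?_) <;> intro e <;> rfl

end HaarComponents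

/-! ### Expanding conjugated labels into paths of length three -/

section Conjugation

variable {A : Type u} [Ring A] [StarRing A] [Algebra ℂ A] [StarModule ℂ A] (S : TrafficSpace A)
variable {B C V Q : Type} [Finite B] [Finite C] [Finite V] [Fintype Q]

/-- The sources of the edges of the graph obtained by replacing each edge of the first kind by a
path of length three. The new vertices are indexed by `C ⊕ C`. -/
def triS (sC : C → V) (sB : B → V) : C ⊕ (C ⊕ (C ⊕ B)) → V ⊕ (C ⊕ C) :=
  Sum.elim (Sum.inl ∘ sC) (Sum.elim (Sum.inr ∘ Sum.inl)
    (Sum.elim (Sum.inr ∘ Sum.inr) (Sum.inl ∘ sB)))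

/-- The targets of the edges of the graph obtained by replacing each edge of the first kind by a
path of length three. -/
def triT (tC : C → V) (tB : B → V) : C ⊕ (C ⊕ (C ⊕ B)) → V ⊕ (C ⊕ C) :=
  Sum.elim (Sum.inr ∘ Sum.inl) (Sum.elim (Sum.inr ∘ Sum.inr)
    (Sum.elim (Sum.inl ∘ tC) (Sum.inl ∘ tB)))

/-- The labels of the paths of length three. -/
def triL (y : A) (x : C → A) (l : B → A) : C ⊕ (C ⊕ (C ⊕ B)) → A :=
  Sum.elim (fun _ => y) (Sum.elim x (Sum.elim (fun _ => star y) l))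

variable (sC tC : C → V) (sB tB : B → V)

theorem tri_bijective₁ : Function.Bijective (Sum.elim Sum.inl Sum.inr : V ⊕ C → V ⊕ C) := by
  rw [Sum.elim_inl_inr]; exact Function.bijective_id

theorem tri_bijective₂ : Function.Bijective
    (Sum.elim (Sum.map id Sum.inr) (Sum.inr ∘ Sum.inl) : (V ⊕ C) ⊕ C → V ⊕ (C ⊕ C)) := by
  constructor
  · rintro ((a | a) | a) ((b | b) | b) h <;> simp_all
  · rintro (a | a | a)
    exacts [⟨Sum.inl (Sum.inl a), rfl⟩, ⟨Sum.inr a, rfl⟩, ⟨Sum.inl (Sum.inr a), rfl⟩]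

theorem triS_eq : triS sC sB = Sum.elim (Sum.map id Sum.inr ∘ Sum.inl ∘ sC)
    (Sum.elim (Sum.inr ∘ Sum.inl)
      (Sum.map id Sum.inr ∘ Sum.elim (Sum.inr : C → V ⊕ C) (Sum.inl ∘ sB))) := by
  funext e; rcases e with e | e | e | e <;> rfl

theorem triT_eq : triT tC tB = Sum.elim (Sum.inr ∘ Sum.inl)
    (Sum.elim (Sum.map id Sum.inr ∘ (Sum.inr : C → V ⊕ C))
      (Sum.map id Sum.inr ∘ Sum.elim (Sum.inl ∘ tC) (Sum.inl ∘ tB))) := by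
  funext e; rcases e with e | e | e | e <;> rfl

theorem tri_gconn (h : GConn (Sum.elim sC sB) (Sum.elim tC tB)) :
    GConn (triS sC sB) (triT tC tB) := by
  rw [triS_eq, triT_eq]
  exact gconn_split tri_bijective₂ (gconn_split tri_bijective₁ h)

theorem tri_ccard : ccard (triS sC sB) (triT tC tB) =
    ccard (Sum.elim sC sB) (Sum.elim tC tB) := by
  rw [triS_eq, triT_eq]
  exact (ccard_split tri_bijective₂).trans (ccard_split tri_bijective₁)

/-- Two successive splittings, of `(y x) · y*` and then of `y · x`. The old vertices stay distinct;
the new ones may a priori be glued to each other and to old ones. -/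
theorem tau0_conj (y : A) (x : C → A) (l : B → A) (h : GConn (Sum.elim sC sB) (Sum.elim tC tB)) :
    tau0 S (Sum.elim sC sB) (Sum.elim tC tB) (Sum.elim (fun e => y * x e * star y) l) =
      ∑ ρ with Setoid.comap Sum.inl ρ = ⊥,
        tau0 S (qmk ρ ∘ triS sC sB) (qmk ρ ∘ triT tC tB) (triL y x l) := by
  have h₁ := gconn_split tri_bijective₁ h
  have h₂ := gconn_split tri_bijective₂ h₁
  have H := (refines_split S tri_bijective₁ (fun e => y * x e) (fun _ => star y) l h).comp h₁
    (refines_split S tri_bijective₂ (fun _ => y) x (Sum.elim (fun _ => star y) l) h₁)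
  have := H.tau0_eq h₂
  rw [triS_eq, triT_eq]
  exact this

theorem Mtau_conj (y : A) (x : C → A) (l : B → A) :
    Mtau S (Sum.elim sC sB) (Sum.elim tC tB) (Sum.elim (fun e => y * x e * star y) l) =
      ∑ ρ with Setoid.comap Sum.inl ρ = ⊥ ∧
          ρ ≤ Setoid.ker (GComp.mk (triS sC sB) (triT tC tB)),
        Mtau S (qmk ρ ∘ triS sC sB) (qmk ρ ∘ triT tC tB) (triL y x l) := by
  rw [triS_eq, triT_eq]
  have hc₂ := split_compat (f := Sum.map id Sum.inr) (n := Sum.inr ∘ Sum.inl)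
    (sP := (Sum.inl ∘ sC : C → V ⊕ C)) (tP := Sum.inr) (s := Sum.elim Sum.inr (Sum.inl ∘ sB))
    (t := Sum.elim (Sum.inl ∘ tC) (Sum.inl ∘ tB))
  have hi₂ := split_mk_injective (tri_bijective₂ (V := V) (C := C))
    (sP := (Sum.inl ∘ sC : C → V ⊕ C)) (tP := Sum.inr) (s := Sum.elim Sum.inr (Sum.inl ∘ sB))
    (t := Sum.elim (Sum.inl ∘ tC) (Sum.inl ∘ tB))
  have hs₂ := split_mk_surjective (tri_bijective₂ (V := V) (C := C))
    (sP := (Sum.inl ∘ sC : C → V ⊕ C)) (tP := Sum.inr) (s := Sum.elim Sum.inr (Sum.inl ∘ sB))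
    (t := Sum.elim (Sum.inl ∘ tC) (Sum.inl ∘ tB))
  have hf : ∀ e, GComp.mk _ _ (Sum.map id Sum.inr ((Sum.inl : V → V ⊕ C) (Sum.elim sC sB e))) =
      GComp.mk _ _ (Sum.map id Sum.inr ((Sum.inl : V → V ⊕ C) (Sum.elim tC tB e))) := fun e =>
    GComp.eq_of_mk_eq (split_compat (n := Sum.inr) e) (fun v => GComp.mk _ _ (Sum.map id Sum.inr v))
      hc₂
  have hc := gconn_fib_of_injective (f := Sum.map id Sum.inr ∘ (Sum.inl : V → V ⊕ C)) hf
    (fun v w h => split_mk_injective (tri_bijective₁ (V := V) (C := C)) v w (hi₂ _ _ h)) (fun k => by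
      obtain ⟨v', rfl⟩ := hs₂ k
      obtain ⟨v, hv⟩ := split_mk_surjective (tri_bijective₁ (V := V) (C := C)) (sP := sC)
        (tP := tC) (s := sB) (t := tB) (GComp.mk _ _ v')
      exact ⟨v, GComp.eq_of_mk_eq hv (fun v => GComp.mk _ _ (Sum.map id Sum.inr v)) hc₂⟩)
  have hc' := gconn_fib_of_injective hc₂ hi₂ hs₂
  refine Mtau_refines S (f := Sum.map id Sum.inr ∘ (Sum.inl : V → V ⊕ C)) hf hc fun k => ?_
  exact (fib_refines_split S tri_bijective₁ (fun e => y * x e) (fun _ => star y) l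
    (fun v => GComp.mk _ _ (Sum.map id Sum.inr v)) hf hc₂ k (hc k)).comp (hc' k)
    (fib_refines_split S tri_bijective₂ (fun _ => y) x (Sum.elim (fun _ => star y) l)
      (GComp.mk _ _) hc₂ (GComp.sound _ _) k (hc' k))

end Conjugation

/-! ### No row is glued to a column -/

section Gluing

variable {A : Type u} [Ring A] [StarRing A] [Algebra ℂ A] [StarModule ℂ A] {S : TrafficSpace A}
variable {B C E V I U : Type} [Finite B] [Finite C] [Finite E] [Finite V] [Finite I] [Finite U]

/-- Glue the vertices on the right according to `ρ`. -/
def glueRight (ρ : Setoid (V ⊕ I)) : V ⊕ I → V ⊕ Quotient (Setoid.comap Sum.inr ρ) :=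
  Sum.map id (qmk _)

/-- The remaining gluing. -/
def glueRest (ρ : Setoid (V ⊕ I)) : V ⊕ Quotient (Setoid.comap Sum.inr ρ) → Quotient ρ :=
  Sum.elim (qmk ρ ∘ Sum.inl) (Quotient.lift (qmk ρ ∘ Sum.inr) fun _ _ h => qmk_eq_iff.2 h)

theorem glueRest_comp_glueRight (ρ : Setoid (V ⊕ I)) : glueRest ρ ∘ glueRight ρ = qmk ρ := by
  funext x; rcases x with v | i <;> rfl

theorem glueRight_surjective (ρ : Setoid (V ⊕ I)) : Function.Surjective (glueRight ρ) :=
  Function.surjective_id.sumMap (qmk_surjective _)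

theorem glueRest_surjective (ρ : Setoid (V ⊕ I)) : Function.Surjective (glueRest ρ) := by
  have h := qmk_surjective ρ
  rw [← glueRest_comp_glueRight] at h
  exact h.of_comp

theorem qmk_inl_injective {ρ : Setoid (V ⊕ I)} (hρ : Setoid.comap Sum.inl ρ = ⊥) :
    Function.Injective (qmk ρ ∘ Sum.inl) := by
  intro a b hab
  have : Setoid.comap Sum.inl ρ a b := (qmk_eq_iff (σ := ρ)).1 hab
  rw [hρ] at this
  exact this

theorem glueRest_inr_injective (ρ : Setoid (V ⊕ I)) :
    Function.Injective (glueRest ρ ∘ Sum.inr) := by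
  intro a b hab
  obtain ⟨a, rfl⟩ := qmk_surjective _ a
  obtain ⟨b, rfl⟩ := qmk_surjective _ b
  exact qmk_eq_iff.2 ((qmk_eq_iff (σ := ρ)).1 hab)

/-- No vertex on the left is glued to a vertex on the right. -/
def Unglued (ρ : Setoid (V ⊕ I)) : Prop := ∀ v i, ¬ ρ (Sum.inl v) (Sum.inr i)

theorem glueRest_bijective {ρ : Setoid (V ⊕ I)} (hρ : Setoid.comap Sum.inl ρ = ⊥)
    (h : Unglued ρ) : Function.Bijective (glueRest ρ) := by
  refine ⟨?_, glueRest_surjective ρ⟩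
  rintro (v | i) (w | j) hvw
  · exact congrArg Sum.inl (qmk_inl_injective hρ hvw)
  · obtain ⟨j, rfl⟩ := qmk_surjective _ j
    exact absurd ((qmk_eq_iff (σ := ρ)).1 hvw) (h v j)
  · obtain ⟨i, rfl⟩ := qmk_surjective _ i
    exact absurd (ρ.symm ((qmk_eq_iff (σ := ρ)).1 hvw)) (h w i)
  · exact congrArg Sum.inr (glueRest_inr_injective ρ hvw)

theorem rowEnd_comp {W : Type} (f : V → W) (s t : E → V) (ε : E → Bool) :
    rowEnd (f ∘ s) (f ∘ t) ε = f ∘ rowEnd s t ε := by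
  funext e; simp only [rowEnd, Function.comp]; split_ifs <;> rfl

theorem colEnd_comp {W : Type} (f : V → W) (s t : E → V) (ε : E → Bool) :
    colEnd (f ∘ s) (f ∘ t) ε = f ∘ colEnd s t ε := by
  funext e; simp only [colEnd, Function.comp]; split_ifs <;> rfl

/-- In a graph with a nonzero contribution, no row of the Haar unitary is glued to a column. -/
theorem unglued_of_Mtau_ne_zero {y : A} (hy : S.IsHaarUnitary y) {ρ : Setoid (V ⊕ I)}
    (hρ : Setoid.comap Sum.inl ρ = ⊥) {sU tU : U → V ⊕ I} {ε : U → Bool} {r : U → V} {c : U → I}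
    (hrow : rowEnd sU tU ε = Sum.inl ∘ r) (hcol : colEnd sU tU ε = Sum.inr ∘ c)
    (hM : Mtau S (qmk ρ ∘ sU) (qmk ρ ∘ tU) (fun e => starPow y (ε e)) ≠ 0)
    {sE tE : E → V ⊕ I} (hE : ∀ e, (sE e).isLeft = (tE e).isLeft)
    (htree : ccard (qmk ρ ∘ sU) (qmk ρ ∘ tU) + ccard (qmk ρ ∘ sE) (qmk ρ ∘ tE) =
      Nat.card (Quotient ρ) + ccard (Sum.elim (qmk ρ ∘ sU) (qmk ρ ∘ sE))
        (Sum.elim (qmk ρ ∘ tU) (qmk ρ ∘ tE)))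
    (hle : ρ ≤ Setoid.ker (GComp.mk (Sum.elim sU sE) (Sum.elim tU tE))) : Unglued ρ := by
  have hq := glueRest_comp_glueRight ρ
  set g := glueRight ρ with hg
  set h := glueRest ρ with hh
  have hq' : ∀ {E : Type} (s : E → V ⊕ I), h ∘ (g ∘ s) = qmk ρ ∘ s := fun s => by
    rw [← hq]; rfl
  -- Factor the gluing as `h ∘ g`, where `g` glues the right vertices among themselves and `h`
  -- performs the row-column gluings. The Haar bound compares the vertices and the `U`-components
  -- before and after `h`.
  have h1 := card_add_le_of_Mtau_ne_zero hy ε hM (r := r) (c := qmk (Setoid.comap Sum.inr ρ) ∘ c)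
    (qmk_inl_injective hρ) (glueRest_inr_injective ρ)
    (by rw [rowEnd_comp, hrow]; rfl) (by rw [colEnd_comp, hcol]; rfl)
  have h2 : ccard (Sum.inl ∘ r : U → V ⊕ Quotient (Setoid.comap Sum.inr ρ))
      (Sum.inr ∘ qmk (Setoid.comap Sum.inr ρ) ∘ c) = ccard (g ∘ sU) (g ∘ tU) := by
    have e1 : rowEnd (g ∘ sU) (g ∘ tU) ε = Sum.inl ∘ r := by rw [rowEnd_comp, hrow]; rfl
    have e2 : colEnd (g ∘ sU) (g ∘ tU) ε = Sum.inr ∘ qmk (Setoid.comap Sum.inr ρ) ∘ c := by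
      rw [colEnd_comp, hcol]; rfl
    rw [← e1, ← e2, ccard_rowEnd_colEnd]
  have h3 := ccard_add_le (g ∘ sU) (g ∘ tU) (g ∘ sE) (g ∘ tE)
  have h4 : ccard (qmk ρ ∘ Sum.elim sU sE) (qmk ρ ∘ Sum.elim tU tE) =
      ccard (Sum.elim sU sE) (Sum.elim tU tE) :=
    (ccard_map_eq_iff _ _ (qmk_surjective ρ)).2 (by rwa [ker_qmk])
  have h5 := ccard_map_le (Sum.elim sU sE) (Sum.elim tU tE) (glueRight_surjective ρ)
  have h7 := ccard_map_le (g ∘ sE) (g ∘ tE) (glueRest_surjective ρ)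
  have h8 := ccard_map_eq_iff (g ∘ sE) (g ∘ tE) (glueRest_surjective ρ)
  rw [← hh, hq', hq'] at h7 h8
  rw [Sum.comp_elim, Sum.comp_elim] at h4 h5
  rw [← hg] at h5
  have h9 : Nat.card (V ⊕ Quotient (Setoid.comap Sum.inr ρ)) =
    Nat.card V + Nat.card (Quotient (Setoid.comap Sum.inr ρ)) := Nat.card_sum
  -- Combining `h1`, rank subadditivity after `g` (`h3`), the tree condition and `h4`, `h5` shows
  -- that `h` decreases the number of components of the other edges by nothing. Hence `h` glues only
  -- inside those components.
  have h10 := h8.1 (by omega)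
  intro v i hvi
  have h11 : h (Sum.inl v) = h (Sum.inr (qmk _ i)) := qmk_eq_iff.2 hvi
  -- The other edges never join the left side to the right side, so a left and a right vertex cannot
  -- lie in a common component.
  have h12 := GComp.eq_of_mk_eq (h10 h11) Sum.isLeft fun e => by
    have := hE e
    simp only [hg, glueRight, Function.comp]
    rcases h1 : sE e with a | a <;> rcases h2 : tE e with b | b <;> simp [h1, h2] at this ⊢
  simp at h12

theorem card_quotient_of_unglued {ρ : Setoid (V ⊕ I)} (hρ : Setoid.comap Sum.inl ρ = ⊥)
    (h : Unglued ρ) :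
    Nat.card (Quotient ρ) = Nat.card V + Nat.card (Quotient (Setoid.comap Sum.inr ρ)) := by
  rw [← Nat.card_sum]
  exact (Nat.card_congr (Equiv.ofBijective _ (glueRest_bijective hρ h))).symm

theorem ccard_of_unglued {ρ : Setoid (V ⊕ I)} (hρ : Setoid.comap Sum.inl ρ = ⊥)
    (h : Unglued ρ) (sB tB : B → V) (sC tC : C → I) :
    ccard (qmk ρ ∘ Sum.elim (Sum.inl ∘ sB) (Sum.inr ∘ sC))
      (qmk ρ ∘ Sum.elim (Sum.inl ∘ tB) (Sum.inr ∘ tC)) =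
    ccard sB tB + ccard (qmk (Setoid.comap Sum.inr ρ) ∘ sC) (qmk (Setoid.comap Sum.inr ρ) ∘ tC) := by
  rw [← ccard_disjoint]
  refine (ccard_iso (Equiv.ofBijective _ (glueRest_bijective hρ h)) (Equiv.refl _) ?_ ?_).symm <;>
    rintro (e | e) <;> rfl

theorem Mtau_of_unglued {ρ : Setoid (V ⊕ I)} (hρ : Setoid.comap Sum.inl ρ = ⊥)
    (h : Unglued ρ) (sB tB : B → V) (sC tC : C → I) (l : B → A) (x : C → A) :
    Mtau S (qmk ρ ∘ Sum.elim (Sum.inl ∘ sB) (Sum.inr ∘ sC))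
      (qmk ρ ∘ Sum.elim (Sum.inl ∘ tB) (Sum.inr ∘ tC)) (Sum.elim l x) =
    Mtau S sB tB l *
      Mtau S (qmk (Setoid.comap Sum.inr ρ) ∘ sC) (qmk (Setoid.comap Sum.inr ρ) ∘ tC) x := by
  rw [← Mtau_disjoint]
  refine (Mtau_iso S (Equiv.ofBijective _ (glueRest_bijective hρ h)) (Equiv.refl _)
    ?_ ?_ ?_).symm <;> rintro (e | e) <;> rfl

end Gluing

/-! ### Conjugation by a free Haar unitary produces traffic-freeness -/

section ConjugateTerms

variable {A : Type u} [Ring A] [StarRing A] [Algebra ℂ A] [StarModule ℂ A] {S : TrafficSpace A}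
variable {B C V : Type} [Finite B] [Finite C] [Finite V]

/-- The edges of the paths of length three which are labelled by the unitary. -/
def unitS (sC : C → V) : C ⊕ C → V ⊕ (C ⊕ C) := Sum.elim (Sum.inl ∘ sC) (Sum.inr ∘ Sum.inr)

/-- The edges of the paths of length three which are labelled by the unitary. -/
def unitT (tC : C → V) : C ⊕ C → V ⊕ (C ⊕ C) := Sum.elim (Sum.inr ∘ Sum.inl) (Sum.inl ∘ tC)

/-- The exponents of the unitary. -/
def unitExp (C : Type) : C ⊕ C → Bool := Sum.elim (fun _ => false) fun _ => true

theorem rowEnd_unit (sC tC : C → V) :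
    rowEnd (unitS sC) (unitT tC) (unitExp C) = Sum.inl ∘ Sum.elim sC tC := by
  funext e; rcases e with e | e <;> rfl

theorem colEnd_unit (sC tC : C → V) :
    colEnd (unitS sC) (unitT tC) (unitExp C) = Sum.inr ∘ id := by
  funext e; rcases e with e | e <;> rfl

/-- Group the edges labelled by the unitary. -/
def triEquiv (B C : Type) : (C ⊕ C) ⊕ (B ⊕ C) ≃ C ⊕ (C ⊕ (C ⊕ B)) where
  toFun := Sum.elim (Sum.elim Sum.inl fun e => Sum.inr (Sum.inr (Sum.inl e)))
    (Sum.elim (fun e => Sum.inr (Sum.inr (Sum.inr e))) fun e => Sum.inr (Sum.inl e))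
  invFun := Sum.elim (fun e => Sum.inl (Sum.inl e)) (Sum.elim (fun e => Sum.inr (Sum.inr e))
    (Sum.elim (fun e => Sum.inl (Sum.inr e)) fun e => Sum.inr (Sum.inl e)))
  left_inv := by rintro ((e | e) | (e | e)) <;> rfl
  right_inv := by rintro (e | e | e | e) <;> rfl

theorem triS_comp (sC : C → V) (sB : B → V) : triS sC sB ∘ triEquiv B C =
    Sum.elim (unitS sC) (Sum.elim (Sum.inl ∘ sB) (Sum.inr ∘ Sum.inl)) := by
  funext e; rcases e with (e | e) | (e | e) <;> rfl

theorem triT_comp (tC : C → V) (tB : B → V) : triT tC tB ∘ triEquiv B C =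
    Sum.elim (unitT tC) (Sum.elim (Sum.inl ∘ tB) (Sum.inr ∘ Sum.inr)) := by
  funext e; rcases e with (e | e) | (e | e) <;> rfl

theorem triL_comp (y : A) (x : C → A) (l : B → A) : triL y x l ∘ triEquiv B C =
    Sum.elim (fun e => starPow y (unitExp C e)) (Sum.elim l x) := by
  funext e; rcases e with (e | e) | (e | e) <;> rfl

theorem ccard_comp_equiv {E E' : Type} [Finite E] [Finite E'] (s t : E → V) (φ : E' ≃ E) :
    ccard (s ∘ φ) (t ∘ φ) = ccard s t :=
  ccard_iso (Equiv.refl V) φ (fun _ => rfl) (fun _ => rfl)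

theorem Mtau_comp_equiv {E E' : Type} [Finite E] [Finite E'] (s t : E → V) (l : E → A)
    (φ : E' ≃ E) : Mtau S (s ∘ φ) (t ∘ φ) (l ∘ φ) = Mtau S s t l :=
  Mtau_iso S (Equiv.refl V) φ (fun _ => rfl) (fun _ => rfl) (fun _ => rfl)

/-- The contribution of a gluing of the vertices. -/
theorem Mtau_tri {y : A} (hy : S.IsHaarUnitary y) {L : Set A}
    (hT : TFree S (starSet fun _ : Unit => y) L) (sC tC : C → V) (sB tB : B → V) {x : C → A}
    {l : B → A} (hx : ∀ e, x e ∈ L) (hl : ∀ e, l e ∈ L) {ρ : Setoid (V ⊕ (C ⊕ C))}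
    (hρ : Setoid.comap Sum.inl ρ = ⊥)
    (hle : ρ ≤ Setoid.ker (GComp.mk (triS sC sB) (triT tC tB))) :
    Mtau S (qmk ρ ∘ triS sC sB) (qmk ρ ∘ triT tC tB) (triL y x l) =
      if Unglued ρ ∧ ccard (qmk ρ ∘ unitS sC) (qmk ρ ∘ unitT tC) + ccard sB tB +
          ccard (qmk (Setoid.comap Sum.inr ρ) ∘ Sum.inl) (qmk (Setoid.comap Sum.inr ρ) ∘ Sum.inr) =
          Nat.card V + Nat.card (Quotient (Setoid.comap Sum.inr ρ)) +
            ccard (Sum.elim sC sB) (Sum.elim tC tB) then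
        Mtau S (qmk ρ ∘ unitS sC) (qmk ρ ∘ unitT tC) (fun e => starPow y (unitExp C e)) *
        (Mtau S sB tB l *
          Mtau S (qmk (Setoid.comap Sum.inr ρ) ∘ Sum.inl) (qmk (Setoid.comap Sum.inr ρ) ∘ Sum.inr) x)
      else 0 := by
  have hE : ∀ e : B ⊕ C, (Sum.elim (Sum.inl ∘ sB) (Sum.inr ∘ Sum.inl) e : V ⊕ (C ⊕ C)).isLeft =
      (Sum.elim (Sum.inl ∘ tB) (Sum.inr ∘ Sum.inr) e : V ⊕ (C ⊕ C)).isLeft := by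
    rintro (e | e) <;> rfl
  have hall : ccard (qmk ρ ∘ triS sC sB) (qmk ρ ∘ triT tC tB) =
      ccard (Sum.elim sC sB) (Sum.elim tC tB) := by
    rw [← tri_ccard]
    exact (ccard_map_eq_iff _ _ (qmk_surjective ρ)).2 (by rwa [ker_qmk])
  have hS : qmk ρ ∘ triS sC sB ∘ triEquiv B C = Sum.elim (qmk ρ ∘ unitS sC)
      (qmk ρ ∘ Sum.elim (Sum.inl ∘ sB) (Sum.inr ∘ Sum.inl)) := by
    rw [triS_comp]; exact Sum.comp_elim _ _ _
  have hT' : qmk ρ ∘ triT tC tB ∘ triEquiv B C = Sum.elim (qmk ρ ∘ unitT tC)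
      (qmk ρ ∘ Sum.elim (Sum.inl ∘ tB) (Sum.inr ∘ Sum.inr)) := by
    rw [triT_comp]; exact Sum.comp_elim _ _ _
  have h1 := hT.Mtau_eq (qmk ρ ∘ unitS sC) (qmk ρ ∘ unitT tC)
    (qmk ρ ∘ Sum.elim (Sum.inl ∘ sB) (Sum.inr ∘ Sum.inl))
    (qmk ρ ∘ Sum.elim (Sum.inl ∘ tB) (Sum.inr ∘ Sum.inr))
    (l₁ := fun e => starPow y (unitExp C e)) (l₂ := Sum.elim l x)
    (fun e => ⟨((), unitExp C e), rfl⟩) (by rintro (e | e); exacts [hl e, hx e])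
  have h2 : ccard (Sum.elim (qmk ρ ∘ unitS sC) (qmk ρ ∘ Sum.elim (Sum.inl ∘ sB) (Sum.inr ∘ Sum.inl)))
      (Sum.elim (qmk ρ ∘ unitT tC) (qmk ρ ∘ Sum.elim (Sum.inl ∘ tB) (Sum.inr ∘ Sum.inr))) =
      ccard (Sum.elim sC sB) (Sum.elim tC tB) := by
    rw [← hall, ← ccard_comp_equiv _ _ (triEquiv B C), Function.comp_assoc, Function.comp_assoc,
      hS, hT']
  have h3 : Mtau S (qmk ρ ∘ triS sC sB) (qmk ρ ∘ triT tC tB) (triL y x l) =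
      Mtau S (Sum.elim (qmk ρ ∘ unitS sC) (qmk ρ ∘ Sum.elim (Sum.inl ∘ sB) (Sum.inr ∘ Sum.inl)))
      (Sum.elim (qmk ρ ∘ unitT tC) (qmk ρ ∘ Sum.elim (Sum.inl ∘ tB) (Sum.inr ∘ Sum.inr)))
      (Sum.elim (fun e => starPow y (unitExp C e)) (Sum.elim l x)) := by
    rw [← Mtau_comp_equiv _ _ _ (triEquiv B C), Function.comp_assoc, Function.comp_assoc,
      hS, hT', triL_comp]
  rw [h3, h1, h2]
  by_cases hN : Unglued ρ
  · have hcc := ccard_of_unglued hρ hN sB tB (Sum.inl : C → C ⊕ C) Sum.inr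
    rw [Mtau_of_unglued hρ hN, hcc, card_quotient_of_unglued hρ hN]
    refine if_congr ?_ rfl rfl
    rw [and_iff_right hN, ← add_assoc]
  · rw [if_neg (c := Unglued ρ ∧ _) (fun h => hN h.1)]
    by_cases hM : Mtau S (qmk ρ ∘ unitS sC) (qmk ρ ∘ unitT tC)
      (fun e => starPow y (unitExp C e)) = 0
    · rw [hM, zero_mul, ite_self]
    -- If the tree condition held, the nonvanishing of the unitary part would forbid any row-column
    -- gluing.
    · refine if_neg fun hcond => hN ?_
      refine unglued_of_Mtau_ne_zero hy hρ (rowEnd_unit sC tC) (colEnd_unit sC tC) hM hE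
        (by rw [h2]; exact hcond) ?_
      intro a b hab
      have h4 := hle hab
      refine GComp.eq_of_mk_eq h4 (GComp.mk _ _) fun e => ?_
      obtain ⟨e, rfl⟩ := (triEquiv B C).surjective e
      have h5 := GComp.sound (triS sC sB ∘ triEquiv B C) (triT tC tB ∘ triEquiv B C) e
      rw [triS_comp, triT_comp] at h5
      have h6 := congrFun (triS_comp sC sB) e
      have h7 := congrFun (triT_comp tC tB) e
      simp only [Function.comp_apply] at h6 h7
      rw [h6, h7]
      exact h5

theorem ite_sum_zero {ι : Type*} (p : Prop) [Decidable p] (s : Finset ι) (f : ι → ℂ) :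
    (if p then ∑ i ∈ s, f i else 0) = ∑ i ∈ s, if p then f i else 0 := by
  split_ifs
  · rfl
  · rw [Finset.sum_const_zero]

/-- Conjugation by a free Haar unitary traffic makes families free. -/
theorem TFree.conj {y : A} (hy : S.IsHaarUnitary y) {L L₁ L₂ : Set A}
    (hT : TFree S (starSet fun _ : Unit => y) L) (h₁ : L₁ ⊆ L) (h₂ : L₂ ⊆ L) :
    TFree S ((fun x => y * x * star y) '' L₁) L₂ := by
  intro V C B _ _ _ sC tC sB tB l₁ l hl₁ hl hc
  choose x hx hxl using hl₁
  obtain rfl : (fun e => y * x e * star y) = l₁ := funext hxl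
  have hxL : ∀ e, x e ∈ L := fun e => h₁ (hx e)
  have hlL : ∀ e, l e ∈ L := fun e => h₂ (hl e)
  -- An empty second family is added, so that the conjugated part alone is expanded by the same
  -- formula as the full graph.
  have hM : Mtau S sC tC (fun e => y * x e * star y) =
      Mtau S (Sum.elim sC (Empty.elim : Empty → V)) (Sum.elim tC Empty.elim)
        (Sum.elim (fun e => y * x e * star y) Empty.elim) :=
    Mtau_iso S (Equiv.refl V) (Equiv.sumEmpty C Empty).symm (fun _ => rfl) (fun _ => rfl)
      (fun _ => rfl)
  have hcc : ccard (Sum.elim sC (Empty.elim : Empty → V)) (Sum.elim tC Empty.elim) = ccard sC tC :=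
    (ccard_iso (Equiv.refl V) (Equiv.sumEmpty C Empty).symm (fun _ => rfl) (fun _ => rfl)).symm
  have hle := ccard_add_le sC tC sB tB
  rw [ccard_eq_one hc] at hle
  rw [tau0_conj S sC tC sB tB y x l hc, hM, Mtau_conj, ← Finset.filter_filter,
    Finset.sum_filter (fun ρ => ρ ≤ _), Finset.sum_mul,
    ite_sum_zero]
  -- The two expansions run over the same gluings and agree term by term.
  refine Finset.sum_congr rfl fun ρ hρ' => ?_
  have hρ := (Finset.mem_filter.1 hρ').2
  have hg := tri_gconn sC tC sB tB hc
  rw [← Mtau_of_gconn S (hg.map (qmk_surjective ρ)), Mtau_tri hy hT sC tC sB tB hxL hlL hρ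
    fun a b _ => hg.2 a b, ccard_eq_one hc]
  have hcc' : ccard (triS sC (Empty.elim : Empty → V)) (triT tC Empty.elim) = ccard sC tC :=
    (tri_ccard _ _ _ _).trans hcc
  have h1 := ccard_map_le (triS sC (Empty.elim : Empty → V)) (triT tC Empty.elim) (qmk_surjective ρ)
  have h2 := ccard_map_eq_iff (triS sC (Empty.elim : Empty → V)) (triT tC Empty.elim)
    (qmk_surjective ρ)
  rw [hcc'] at h1 h2
  rw [ker_qmk] at h2
  have h3 := ccard_add_le (qmk ρ ∘ unitS sC) (qmk ρ ∘ unitT tC)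
    (qmk ρ ∘ Sum.elim (Sum.inl ∘ (Empty.elim : Empty → V)) (Sum.inr ∘ Sum.inl))
    (qmk ρ ∘ Sum.elim (Sum.inl ∘ (Empty.elim : Empty → V)) (Sum.inr ∘ Sum.inr))
  rw [← Sum.comp_elim, ← Sum.comp_elim, ← triS_comp, ← triT_comp, ← Function.comp_assoc,
    ← Function.comp_assoc, ccard_comp_equiv] at h3
  have he := ccard_of_isEmpty (Empty.elim : Empty → V) Empty.elim
  by_cases hN : Unglued ρ
  · rw [ccard_of_unglued hρ hN, he, card_quotient_of_unglued hρ hN] at h3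
    by_cases hk : ρ ≤ Setoid.ker (GComp.mk (triS sC (Empty.elim : Empty → V)) (triT tC Empty.elim))
    · rw [if_pos hk, Mtau_tri hy hT sC tC _ _ hxL (fun e => e.elim) hρ hk, hcc, he,
        Mtau_of_isEmpty S (Empty.elim : Empty → V)]
      simp only [hN, true_and]
      -- The joint count is the sum of two inequalities: `hle` for the colours `C` and `B`, and `h3`
      -- for the unitary and `x` edges of the expanded paths. It is an equality if and only if both
      -- are, and then `ρ` loses no component of the conjugated part.
      have h4 := h2.2 hk
      split_ifs <;> first | (exfalso; omega) | ring
    · have h4 := mt h2.1 hk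
      rw [if_neg hk, zero_mul, ite_self, if_neg]
      rintro ⟨_, h5⟩
      omega
  · rw [if_neg (c := Unglued ρ ∧ _) (fun h => hN h.1)]
    split_ifs with h5 h6
    · rw [Mtau_tri hy hT sC tC _ _ hxL (fun e => e.elim) hρ h6,
        if_neg (c := Unglued ρ ∧ _) (fun h => hN h.1), zero_mul]
    · rw [zero_mul]
    · rfl

end ConjugateTerms

/-! ### Parity of degrees and sparsity for centered labels -/

section Degrees

variable {A : Type u} [Ring A] [StarRing A] [Algebra ℂ A] [StarModule ℂ A] {S : TrafficSpace A}
variable {E V C : Type} [Finite E] [Finite V] [Finite C]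

theorem tau0_of_subsingleton [Subsingleton V] {s t : E → V} (h : GConn s t) (l : E → A) :
    tau0 S s t l = tau S s t l := by
  have : Subsingleton (Setoid V) := ⟨fun r r' => Setoid.ext fun a b => by
    rw [Subsingleton.elim a b]; exact iff_of_true (r.refl _) (r'.refl _)⟩
  rw [tau0_def, Fintype.sum_subsingleton _ (⊥ : Setoid V), partitionMoebius_eq_mu,
    IncidenceAlgebra.mu_self, one_mul]
  exact tau_surj_congr S h (qmk_surjective ⊥) (f' := id) Function.surjective_id
    fun v w => by simp [Subsingleton.elim v w]

/-- The degree of a vertex, a loop being counted twice. -/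
def vdeg (s t : E → V) (v : V) : ℕ := Nat.card {e // s e = v} + Nat.card {e // t e = v}

theorem vdeg_fib (s t : E → V) (v : V) :
    vdeg (fibS (GComp.mk s t) s (GComp.mk s t v))
      (fibT (GComp.mk s t) s t (GComp.sound s t) (GComp.mk s t v)) ⟨v, rfl⟩ = vdeg s t v := by
  unfold vdeg
  congr 1
  · exact Nat.card_congr
      { toFun := fun e => ⟨e.1.1, congrArg Subtype.val e.2⟩
        invFun := fun e => ⟨⟨e.1, congrArg _ e.2⟩, Subtype.ext e.2⟩
        left_inv := fun _ => rfl
        right_inv := fun _ => rfl }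
  · exact Nat.card_congr
      { toFun := fun e => ⟨e.1.1, congrArg Subtype.val e.2⟩
        invFun := fun e => ⟨⟨e.1, (GComp.sound s t e.1).trans (congrArg _ e.2)⟩, Subtype.ext e.2⟩
        left_inv := fun _ => rfl
        right_inv := fun _ => rfl }

/-- An edge alone in its component and not a loop would give its source degree one. -/
theorem src_eq_tgt_of_unique {s t : E → V} (hd : ∀ v, Even (vdeg s t v)) {e : E}
    (he : ∀ e', GComp.mk s t (s e') = GComp.mk s t (s e) → e' = e) : t e = s e := by
  by_contra hne
  have h1 : Nat.card {e' // s e' = s e} = 1 :=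
    Nat.card_eq_one_iff_unique.2 ⟨⟨fun a b => Subtype.ext
      ((he _ (congrArg _ a.2)).trans (he _ (congrArg _ b.2)).symm)⟩, ⟨⟨e, rfl⟩⟩⟩
  have h2 : Nat.card {e' // t e' = s e} = 0 := by
    refine Nat.card_eq_zero.2 (Or.inl ⟨fun a => ?_⟩)
    have h3 := he a.1 ((GComp.sound s t a.1).trans (congrArg _ a.2))
    exact hne ((congrArg t h3).symm.trans a.2)
  have h4 := hd (s e)
  rw [vdeg, h1, h2] at h4
  exact absurd h4 (by decide)

/-- A graph with even degrees and centered labels has at least two edges in every component which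
is not reduced to a vertex, if its contribution is nonzero. -/
theorem two_mul_ccard_le {s t : E → V} {l : E → A} (hl : ∀ e, S.Φ (l e) = 0)
    (hd : ∀ v, Even (vdeg s t v)) (h : Mtau S s t l ≠ 0) :
    2 * ccard s t ≤ Nat.card E + 2 * Nat.card {v // ∀ e, s e ≠ v ∧ t e ≠ v} := by
  rw [card_eq_sum_fib (fun e => GComp.mk s t (s e)),
    card_eq_sum_fib (fun v : {v // ∀ e, s e ≠ v ∧ t e ≠ v} => GComp.mk s t v.1),
    ccard_eq_sum_one, Finset.mul_sum, Finset.mul_sum, ← Finset.sum_add_distrib]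
  refine Finset.sum_le_sum fun k _ => ?_
  rcases Nat.lt_trichotomy (Nat.card {e // GComp.mk s t (s e) = k}) 1 with h0 | h1 | h2
  · have hemp : IsEmpty {e // GComp.mk s t (s e) = k} := by
      rcases Nat.card_eq_zero.1 (Nat.lt_one_iff.1 h0) with h | h
      · exact h
      · exact absurd h (not_infinite_iff_finite.2 inferInstance)
    obtain ⟨v, rfl⟩ := GComp.mk_surjective s t k
    have hv : ∀ e, s e ≠ v ∧ t e ≠ v := fun e =>
      ⟨fun h => hemp.false ⟨e, congrArg _ h⟩,
        fun h => hemp.false ⟨e, (GComp.sound s t e).trans (congrArg _ h)⟩⟩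
    have : 0 < Nat.card {x : {v // ∀ e, s e ≠ v ∧ t e ≠ v} // GComp.mk s t x.1 = GComp.mk s t v} :=
      Nat.card_pos_iff.2 ⟨⟨⟨⟨v, hv⟩, rfl⟩⟩, inferInstance⟩
    omega
  -- With a single edge, parity makes this edge a loop, so the component is one vertex with a loop
  -- and its trace is `Φ (l e) = 0`.
  · exfalso
    obtain ⟨hsub, ⟨⟨e, he⟩⟩⟩ := Nat.card_eq_one_iff_unique.1 h1
    have hst : t e = s e := src_eq_tgt_of_unique hd fun e' he' =>
      congrArg Subtype.val (hsub.elim ⟨e', he'.trans he⟩ ⟨e, he⟩)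
    have hg := gconn_fib s t k
    have hV : Subsingleton {v // GComp.mk s t v = k} := by
      have hc := hg.const (fun v => v.1 = s e) fun e' => by
        obtain rfl := hsub.elim ⟨e, he⟩ e'
        simp only [fibS, fibT, hst]
      have ht : ∀ v : {v // GComp.mk s t v = k}, v.1 = s e := fun v => by
        have := hc ⟨s e, he⟩ v
        simpa using this
      exact ⟨fun v w => Subtype.ext ((ht v).trans (ht w).symm)⟩
    refine tau0_fib_ne_zero h k ?_
    rw [tau0_of_subsingleton hg]
    have := hV
    have := hsub
    let : Unique {v // GComp.mk s t v = k} := ⟨⟨⟨s e, he⟩⟩, fun _ => Subsingleton.elim _ _⟩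
    let : Unique {e // GComp.mk s t (s e) = k} := ⟨⟨⟨e, he⟩⟩, fun _ => Subsingleton.elim _ _⟩
    rw [tau_iso S hg (s' := fun _ : Unit => ()) (t' := fun _ => ()) (l' := fun _ => l e)
      (Equiv.ofUnique _ Unit) (Equiv.ofUnique _ Unit) (fun _ => rfl) (fun _ => rfl)
      (fun e' => by rw [hsub.elim e' ⟨e, he⟩]), ← Phi_eq_tau, hl]
  · omega

variable (S) in
/-- The graphs with centered labels in `L` and nonzero injective trace are sparse and have even
degrees. -/
def CenteredSparse (L : Set A) : Prop :=
  ∀ (V E : Type) [Finite V] [Finite E] (s t : E → V) (l : E → A), (∀ e, l e ∈ L) →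
    (∀ e, S.Φ (l e) = 0) → GConn s t → tau0 S s t l ≠ 0 →
    (∀ v, Even (vdeg s t v)) ∧ Nat.card E + 2 ≤ 2 * Nat.card V

theorem CenteredSparse.even_of_Mtau_ne_zero {L : Set A} (hL : CenteredSparse S L) {s t : E → V}
    {l : E → A} (hl : ∀ e, l e ∈ L) (hl' : ∀ e, S.Φ (l e) = 0) (h : Mtau S s t l ≠ 0) (v : V) :
    Even (vdeg s t v) := by
  rw [← vdeg_fib]
  exact (hL _ _ _ _ _ (fun e => hl e.1) (fun e => hl' e.1) (gconn_fib s t _)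
    (tau0_fib_ne_zero h _)).1 _

theorem CenteredSparse.card_le_of_Mtau_ne_zero {L : Set A} (hL : CenteredSparse S L) {s t : E → V}
    {l : E → A} (hl : ∀ e, l e ∈ L) (hl' : ∀ e, S.Φ (l e) = 0) (h : Mtau S s t l ≠ 0) :
    Nat.card E + 2 * ccard s t ≤ 2 * Nat.card V :=
  card_edges_add_le fun k => (hL _ _ _ _ _ (fun e => hl e.1) (fun e => hl' e.1) (gconn_fib s t k)
    (tau0_fib_ne_zero h k)).2

theorem vdeg_eq_card_sum (s t : E → V) (v : V) :
    vdeg s t v = Nat.card {e : E ⊕ E // Sum.elim s t e = v} := by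
  rw [Nat.card_congr (fibSumEquiv fun e => Sum.elim s t e = v), Nat.card_sum]; rfl

/-- Conjugation by a free Haar unitary traffic makes families centered sparse. -/
theorem TFree.centeredSparse_conj {y : A} (hy : S.IsHaarUnitary y) {L : Set A}
    (hT : TFree S (starSet fun _ : Unit => y) L) :
    CenteredSparse S ((fun x => y * x * star y) '' L) := by
  intro V C _ _ sC tC l hl hl' hc h
  choose x hx hxl using hl
  obtain rfl : (fun e => y * x e * star y) = l := funext hxl
  have hΦ : ∀ e, S.Φ (x e) = 0 := fun e => by
    rw [← hl' e]
    simp only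
    rw [S.traciality, ← mul_assoc, hy.1, one_mul]
  have hc' : GConn (Sum.elim sC (Empty.elim : Empty → V)) (Sum.elim tC Empty.elim) := by
    convert hc.comp_equiv (Equiv.sumEmpty C Empty) using 1 <;> funext e <;>
      rcases e with e | e <;> first | rfl | exact e.elim
  rw [tau0_iso S hc (l := fun e => y * x e * star y) (s' := Sum.elim sC (Empty.elim : Empty → V)) (t' := Sum.elim tC Empty.elim)
    (l' := Sum.elim (fun e => y * x e * star y) Empty.elim) (Equiv.refl V)
    (Equiv.sumEmpty C Empty).symm (fun _ => rfl) (fun _ => rfl) (fun _ => rfl),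
    tau0_conj S _ _ _ _ _ _ _ hc'] at h
  obtain ⟨ρ, hρ', hne⟩ := Finset.exists_ne_zero_of_sum_ne_zero h
  have hρ := (Finset.mem_filter.1 hρ').2
  have hg := tri_gconn sC tC _ _ hc'
  rw [← Mtau_of_gconn S (hg.map (qmk_surjective ρ)), Mtau_tri hy hT sC tC _ _ hx
    (fun e => e.elim) hρ fun a b _ => hg.2 a b, ccard_eq_one hc',
    ccard_of_isEmpty (Empty.elim : Empty → V) Empty.elim] at hne
  obtain ⟨⟨hN, hcard⟩, hne⟩ := ite_ne_right_iff.1 hne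
  have hMu := left_ne_zero_of_mul hne
  -- The two nonvanishing factors play different roles: the unitary part gives parity and the edge
  -- bound, while the centered inner part excludes components with a single edge.
  have hMF := right_ne_zero_of_mul (right_ne_zero_of_mul hne)
  refine ⟨fun v => ?_, ?_⟩
  · have h1 := even_row_of_Mtau_ne_zero hy (unitExp C) hMu ((qmk ρ ∘ Sum.inl) v)
    rw [rowEnd_comp, rowEnd_unit, ← Function.comp_assoc] at h1
    simp only [Function.comp_apply (f := qmk ρ ∘ Sum.inl), (qmk_inl_injective hρ).eq_iff] at h1
    rwa [vdeg_eq_card_sum]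
  · have hd : ∀ i, Even (vdeg (qmk (Setoid.comap Sum.inr ρ) ∘ (Sum.inl : C → C ⊕ C))
        (qmk (Setoid.comap Sum.inr ρ) ∘ Sum.inr) i) := by
      intro i
      obtain ⟨i, rfl⟩ := qmk_surjective _ i
      have h1 := even_col_of_Mtau_ne_zero hy (unitExp C) hMu (qmk ρ (Sum.inr i))
      rw [colEnd_comp, colEnd_unit] at h1
      rw [vdeg_eq_card_sum, ← Sum.comp_elim, Sum.elim_inl_inr]
      convert h1 using 1
      refine Nat.card_congr (Equiv.subtypeEquivRight fun e => ?_)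
      exact Iff.symm <| (qmk_eq_iff (σ := ρ)).trans (qmk_eq_iff (σ := Setoid.comap Sum.inr ρ)).symm
    have h2 := two_mul_ccard_le hΦ hd hMF
    -- Every new vertex is an end of an `x` edge, so there are no isolated ones and the number of
    -- `x` components is at most `|C| / 2`. Inserting this and the tree condition in the edge bound
    -- for the `2|C|` unitary edges gives `|C| + 2 ≤ 2|V|`.
    have h3 : Nat.card {v // ∀ e, (qmk (Setoid.comap Sum.inr ρ) ∘ (Sum.inl : C → C ⊕ C)) e ≠ v ∧
        (qmk (Setoid.comap Sum.inr ρ) ∘ Sum.inr) e ≠ v} = 0 := by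
      refine Nat.card_eq_zero.2 (Or.inl ⟨fun ⟨i, hi⟩ => ?_⟩)
      obtain ⟨i | i, rfl⟩ := qmk_surjective _ i
      exacts [(hi i).1 rfl, (hi i).2 rfl]
    have h4 := card_edges_le_of_Mtau_ne_zero hy (unitExp C) hMu
    rw [Nat.card_sum, card_quotient_of_unglued hρ hN] at h4
    omega

end Degrees

/-! ### From traffic-freeness to star-freeness -/

section StarFreeness

variable {A : Type u} [Ring A] [StarRing A] [Algebra ℂ A] [StarModule ℂ A] {S : TrafficSpace A}

theorem vdeg_comp_equiv {V E F : Type} (s t : E → V) (φ : F ≃ E) (v : V) :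
    vdeg (s ∘ φ) (t ∘ φ) v = vdeg s t v := by
  unfold vdeg
  congr 1 <;> exact Nat.card_congr (φ.subtypeEquiv fun _ => Iff.rfl)

theorem vdeg_sum {V E F : Type} [Finite E] [Finite F] (s₁ t₁ : E → V) (s₂ t₂ : F → V) (v : V) :
    vdeg (Sum.elim s₁ s₂) (Sum.elim t₁ t₂) v = vdeg s₁ t₁ v + vdeg s₂ t₂ v := by
  unfold vdeg
  rw [Nat.card_congr (fibSumEquiv fun e => Sum.elim s₁ s₂ e = v),
    Nat.card_congr (fibSumEquiv fun e => Sum.elim t₁ t₂ e = v), Nat.card_sum, Nat.card_sum]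
  simp only [Sum.elim_inl, Sum.elim_inr]
  omega

/-- With targets obtained from sources by a permutation of the edges, incoming and outgoing edges
balance at each vertex; this applies to every quotient of a cycle. -/
theorem even_vdeg_perm {V E : Type} (q : E → V) (φ : Equiv.Perm E) (v : V) :
    Even (vdeg q (q ∘ φ) v) := by
  have : Nat.card {e // (q ∘ φ) e = v} = Nat.card {e // q e = v} :=
    Nat.card_congr (φ.subtypeEquiv fun _ => Iff.rfl)
  rw [vdeg, this]
  exact ⟨_, rfl⟩

/-- Shifting by one matches the positions coloured `false` except the last with those coloured
`true` except the first. The last and first letters are not assumed to differ, hence the two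
boundary terms. -/
theorem card_alternating {n : ℕ} {c : Fin (n + 1) → Bool}
    (hc : ∀ i : Fin n, c i.castSucc ≠ c i.succ) :
    Nat.card {i // ¬ c i = true} + (if c 0 = true then 1 else 0) =
      Nat.card {i // c i = true} + if c (Fin.last n) = true then 0 else 1 := by
  have h : ∀ (p : Fin (n + 1) → Prop) [DecidablePred p],
      Nat.card {i // p i} = ∑ i, if p i then 1 else 0 := fun p _ => by
    rw [Nat.card_eq_fintype_card, Fintype.card_subtype, Finset.card_filter]
  rw [h, h, Fin.sum_univ_castSucc, Fin.sum_univ_succ (n := n)]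
  have : ∑ i : Fin n, (if ¬ c i.castSucc = true then 1 else 0) =
      ∑ i : Fin n, if c i.succ = true then 1 else 0 := by
    refine Finset.sum_congr rfl fun i _ => ?_
    have := hc i
    cases h1 : c i.castSucc <;> cases h2 : c i.succ <;> simp_all
  rw [this]
  split_ifs <;> omega

/-- Let `p` and `q` be the numbers of edges labelled in `LA` and `LB` in a nonzero quotient of the
cycle. Sparsity gives `p + 2 c_A ≤ 2|V|`, centering gives `2 c_B ≤ q + 2 i` with `i` the number of
vertices not met by `LB` edges, and freeness gives `c_A + c_B = |V| + 1`. Hence `p + 2 ≤ q + 2 i`,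
which alternation contradicts. -/
theorem Phi_prod_eq_zero {LA LB : Set A} (hT : TFree S LA LB) (hA : CenteredSparse S LA) {n : ℕ}
    (z : Fin (n + 1) → A) (c : Fin (n + 1) → Bool) (hcA : ∀ i, c i = true → z i ∈ LA)
    (hcB : ∀ i, ¬ c i = true → z i ∈ LB) (hz : ∀ i, S.Φ (z i) = 0)
    (hc : ∀ i : Fin n, c i.castSucc ≠ c i.succ) : S.Φ (List.ofFn z).prod = 0 := by
  have hg := gconn_cycle n
  have hsum := tau_surj_eq_sum S (l := z) hg Function.surjective_id
  rw [Phi_prod_eq_tau]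
  refine Eq.trans hsum (Finset.sum_eq_zero fun π _ => ?_)
  by_contra hne
  rw [Function.comp_id] at hne
  have hgq : GConn (qmk π) (qmk π ∘ finRotate (n + 1)) := hg.map (qmk_surjective π)
  let φ := Equiv.sumCompl fun i => c i = true
  have hs : qmk π ∘ φ = Sum.elim (fun i : {i // c i = true} => qmk π i.1) (fun i => qmk π i.1) := by
    funext e; rcases e with e | e <;> rfl
  have ht : (qmk π ∘ finRotate (n + 1)) ∘ φ =
      Sum.elim (fun i : {i // c i = true} => qmk π (finRotate (n + 1) i.1))
        (fun i => qmk π (finRotate (n + 1) i.1)) := by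
    funext e; rcases e with e | e <;> rfl
  have hl : z ∘ φ = Sum.elim (fun i : {i // c i = true} => z i.1) (fun i => z i.1) := by
    funext e; rcases e with e | e <;> rfl
  have hgφ := hgq.comp_equiv φ
  rw [← tau0_comp_equiv S hgq φ, hs, ht, hl] at hne
  rw [hs, ht] at hgφ
  rw [hT _ _ _ _ _ _ _ _ _ (fun i => hcA _ i.2) (fun i => hcB _ i.2) hgφ] at hne
  obtain ⟨hcard, hne⟩ := ite_ne_right_iff.1 hne
  have hMA := left_ne_zero_of_mul hne
  have hMB := right_ne_zero_of_mul hne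
  have h1 := hA.card_le_of_Mtau_ne_zero (fun i => hcA _ i.2) (fun i => hz _) hMA
  have hd : ∀ v, Even (vdeg (fun i : {i // ¬ c i = true} => qmk π i.1)
      (fun i => qmk π (finRotate (n + 1) i.1)) v) := by
    intro v
    have h2 := even_vdeg_perm (qmk π) (finRotate (n + 1)) v
    rw [← vdeg_comp_equiv _ _ φ, hs, ht, vdeg_sum] at h2
    -- Total degrees are even and those of the first colour are even, hence so are those of the
    -- second; no sparsity is required of `LB`.
    exact (Nat.even_add.1 h2).1 (hA.even_of_Mtau_ne_zero (fun i => hcA _ i.2) (fun i => hz _) hMA v)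
  have h2 := two_mul_ccard_le (fun i => hz _) hd hMB
  have h3 := card_alternating hc
  -- A vertex not met by the second colour has both neighbouring letters of the first colour. By
  -- alternation this occurs only at `0`, when the word begins and ends in the first colour. Then `i
  -- = 1` but `q = p - 1`; otherwise `i = 0` and `q ≤ p + 1`.
  have hiso : ∀ i, (∀ e : {i // ¬ c i = true}, qmk π e.1 ≠ qmk π i ∧
      qmk π (finRotate (n + 1) e.1) ≠ qmk π i) → i = 0 ∧ c 0 = true ∧ c (Fin.last n) = true := by
    intro i hi
    have hci : c i = true := by
      by_contra h
      exact (hi ⟨i, h⟩).1 rfl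
    have hcj : ∀ j, finRotate (n + 1) j = i → c j = true := by
      intro j hj
      by_contra h
      exact (hi ⟨j, h⟩).2 (congrArg _ hj)
    rcases Fin.eq_zero_or_eq_succ i with rfl | ⟨k, rfl⟩
    · exact ⟨rfl, hci, hcj _ finRotate_last⟩
    · refine absurd ((hcj k.castSucc ?_).trans hci.symm) (hc k)
      rw [finRotate_apply, Fin.coeSucc_eq_succ]
  by_cases hex : IsEmpty {v // ∀ e : {i // ¬ c i = true}, qmk π e.1 ≠ v ∧
      qmk π (finRotate (n + 1) e.1) ≠ v}
  · have h4 := @Nat.card_of_isEmpty _ hex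
    split_ifs at h3 <;> omega
  · obtain ⟨⟨v, hv⟩⟩ := not_isEmpty_iff.1 hex
    obtain ⟨i, rfl⟩ := qmk_surjective π v
    obtain ⟨rfl, h4, h5⟩ := hiso i hv
    rw [if_pos h4, if_pos h5] at h3
    have hs : Subsingleton {v // ∀ e : {i // ¬ c i = true}, qmk π e.1 ≠ v ∧
        qmk π (finRotate (n + 1) e.1) ≠ v} := by
      have : ∀ w : {v // ∀ e : {i // ¬ c i = true}, qmk π e.1 ≠ v ∧
          qmk π (finRotate (n + 1) e.1) ≠ v}, w.1 = qmk π 0 := by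
        rintro ⟨w, hw⟩
        obtain ⟨j, rfl⟩ := qmk_surjective π w
        exact congrArg _ (hiso j hw).1
      exact ⟨fun v w => Subtype.ext ((this v).trans (this w).symm)⟩
    have h6 := Finite.card_le_one_iff_subsingleton.2 hs
    omega

theorem eval_mem_adjoin {J : Type v} (a : J → A) (P : StarPoly J) :
    StarPoly.eval a P ∈ Algebra.adjoin ℂ (starSet a) := by
  rw [starSet, Algebra.adjoin_range_eq_range_freeAlgebra_lift]
  exact ⟨P, rfl⟩

theorem starFreePair_of_centeredSparse {J : Type v} {K : Type w} {a : J → A} {b : K → A}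
    (h : TFree S (starSet a) (starSet b))
    (hs : CenteredSparse S (Algebra.adjoin ℂ (starSet a) : Subalgebra ℂ A) ∨
      CenteredSparse S (Algebra.adjoin ℂ (starSet b) : Subalgebra ℂ A)) : S.StarFreePair a b := by
  -- Polynomials in the families lie in the generated algebras, so freeness is first extended to
  -- both of them.
  have hT := (h.adjoin.symm.adjoin).symm
  intro n hn i hi P hP
  obtain ⟨n, rfl⟩ := Nat.exists_eq_add_of_le' hn
  have hc : ∀ k : Fin n, i k.castSucc ≠ i k.succ := fun k => hi k (by omega)
  have hmemA : ∀ k, i k = true → StarPoly.eval (fun j : {j // Sum.isLeft j = i k} =>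
      Sum.elim a b j.1) (P k) ∈ Algebra.adjoin ℂ (starSet a) := fun k hk => by
    refine Algebra.adjoin_mono ?_ (eval_mem_adjoin _ _)
    rintro _ ⟨⟨⟨j | j, hj⟩, ε⟩, rfl⟩
    · exact ⟨(j, ε), rfl⟩
    · rw [hk] at hj; exact absurd hj (by simp)
  have hmemB : ∀ k, i k = false → StarPoly.eval (fun j : {j // Sum.isLeft j = i k} =>
      Sum.elim a b j.1) (P k) ∈ Algebra.adjoin ℂ (starSet b) := fun k hk => by
    refine Algebra.adjoin_mono ?_ (eval_mem_adjoin _ _)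
    rintro _ ⟨⟨⟨j | j, hj⟩, ε⟩, rfl⟩
    · rw [hk] at hj; exact absurd hj (by simp)
    · exact ⟨(j, ε), rfl⟩
  rcases hs with hs | hs
  · exact Phi_prod_eq_zero hT hs _ i hmemA (fun k hk => hmemB k (by simpa using hk)) hP hc
  · exact Phi_prod_eq_zero hT.symm hs _ (fun k => !i k) (fun k hk => hmemB k (by simpa using hk))
      (fun k hk => hmemA k (by simpa using hk)) hP (fun k h => hc k (by simpa using h))

theorem CenteredSparse.mono {L L' : Set A} (h : CenteredSparse S L) (hL : L' ⊆ L) :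
    CenteredSparse S L' :=
  fun V E _ _ s t l hl => h V E s t l fun e => hL (hl e)

theorem starSet_conjFamily {J : Type v} (y : A) (a : J → A) :
    starSet (conjFamily y a) = (fun x => y * x * star y) '' starSet a := by
  rw [starSet, starSet, ← Set.range_comp]
  congr 1
  funext ⟨j, ε⟩
  cases ε <;> simp [starPow, conjFamily, mul_assoc]

/-- Conjugation by a unitary is multiplicative and fixes scalars, so the conjugate of a subalgebra
is closed under the algebra operations. -/
theorem adjoin_conj_subset {y : A} (hy : star y * y = 1) (hy' : y * star y = 1) (L : Set A) :
    ((Algebra.adjoin ℂ ((fun x => y * x * star y) '' L) : Subalgebra ℂ A) : Set A) ⊆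
      (fun x => y * x * star y) '' (Algebra.adjoin ℂ L : Subalgebra ℂ A) := by
  intro x hx
  refine Algebra.adjoin_induction (p := fun x _ => x ∈ (fun x => y * x * star y) ''
    (Algebra.adjoin ℂ L : Subalgebra ℂ A)) ?_ ?_ ?_ ?_ hx
  · rintro _ ⟨x, hx, rfl⟩
    exact ⟨x, Algebra.subset_adjoin hx, rfl⟩
  · intro r
    refine ⟨algebraMap ℂ A r, Subalgebra.algebraMap_mem _ r, ?_⟩
    simp only
    rw [← Algebra.commutes, mul_assoc, hy', mul_one]
  · rintro _ _ _ _ ⟨x, hx, rfl⟩ ⟨x', hx', rfl⟩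
    exact ⟨x + x', add_mem hx hx', by simp only [mul_add, add_mul]⟩
  · rintro _ _ _ _ ⟨x, hx, rfl⟩ ⟨x', hx', rfl⟩
    refine ⟨x * x', mul_mem hx hx', ?_⟩
    simp only
    rw [show y * x * star y * (y * x' * star y) = y * x * (star y * y) * x' * star y by
      simp only [mul_assoc], hy, mul_one]
    simp only [mul_assoc]

/-- Freeness is extended to the algebra generated by `a` before conjugating. Polynomials in `y a y*`
are then themselves conjugates, of centered elements whenever they are centered. -/
theorem centeredSparse_adjoin_conjFamily {J : Type v} {y : A} (hy : S.IsHaarUnitary y) {a : J → A}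
    (hT : TFree S (starSet fun _ : Unit => y) (starSet a)) :
    CenteredSparse S (Algebra.adjoin ℂ (starSet (conjFamily y a)) : Subalgebra ℂ A) := by
  rw [starSet_conjFamily]
  exact (hT.adjoin.centeredSparse_conj hy).mono (adjoin_conj_subset hy.1 hy.2.1 _)

/-- The labels are replaced by the same polynomials in `b`. Centering is a statement about one loop
and τ⁰ a combination of quotients, so both are preserved. -/
theorem CenteredSparse.of_sameDistribution {B : Type x} [Ring B] [StarRing B] [Algebra ℂ B]
    [StarModule ℂ B] {S' : TrafficSpace B} {J : Type v} {a : J → A} {b : J → B}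
    (h : S.SameDistribution a S' b)
    (hb : CenteredSparse S' (Algebra.adjoin ℂ (starSet b) : Subalgebra ℂ B)) :
    CenteredSparse S (Algebra.adjoin ℂ (starSet a) : Subalgebra ℂ A) := by
  intro V E _ _ s t l hl hl' hc hne
  obtain ⟨y, hy, hyl⟩ := exists_pair_of_sameDistribution S S' h l hl
  refine hb V E s t y hy (fun e => ?_) hc ?_
  · rw [Phi_eq_tau, ← hyl Unit Unit (fun _ => ()) (fun _ => ()) (fun _ => e) (gconn_unit _ _),
      ← Phi_eq_tau, hl']
  · rw [tau0_def] at hne ⊢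
    convert hne using 4 with π
    exact (hyl _ _ _ _ id (hc.map (qmk_surjective π))).symm

theorem centeredSparse_of_freelyUnitarilyInvariant {J : Type v} {a : J → A}
    (h : TrafficSpace.FreelyUnitarilyInvariant.{u, v, x} S a) :
    CenteredSparse S (Algebra.adjoin ℂ (starSet a) : Subalgebra ℂ A) := by
  obtain ⟨B, _, _, _, _, S', a', y, -, hy, hT, h⟩ := h
  exact (centeredSparse_adjoin_conjFamily hy ((trafficFreePair_iff S' _ _).1 hT)).of_sameDistribution h

theorem trafficFreePair_conjFamily {J : Type v} {K : Type w} {a : J → A} {b : K → A} {y : A}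
    (hy : S.IsHaarUnitary y) (hT : S.TrafficFreePair (fun _ : Unit => y) (Sum.elim a b)) :
    S.TrafficFreePair (conjFamily y a) b := by
  rw [trafficFreePair_iff] at hT ⊢
  rw [starSet_conjFamily]
  refine hT.conj hy ?_ ?_
  · rintro _ ⟨⟨j, ε⟩, rfl⟩
    exact ⟨(Sum.inl j, ε), rfl⟩
  · rintro _ ⟨⟨j, ε⟩, rfl⟩
    exact ⟨(Sum.inr j, ε), rfl⟩

end StarFreeness

end

/-! ### The proposition -/

theorem mainTheorem9 {A : Type u} [Ring A] [StarRing A] [Algebra ℂ A] [StarModule ℂ A]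
    (S : TrafficSpace A) {J : Type v} {K : Type w} (a : J → A) (b : K → A) :
    (∀ y : A, S.IsHaarUnitary y →
      S.TrafficFreePair (fun _ : Unit => y) (Sum.elim a b) →
        S.TrafficFreePair (conjFamily y a) b ∧ S.StarFreePair (conjFamily y a) b) ∧
    (S.TrafficFreePair a b →
      (TrafficSpace.FreelyUnitarilyInvariant.{u, v, x} S a ∨
        TrafficSpace.FreelyUnitarilyInvariant.{u, w, x} S b) →
      S.StarFreePair a b) := by
  refine ⟨fun y hy hT => ?_, fun hT h => ?_⟩
  · have hab := trafficFreePair_conjFamily hy hT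
    refine ⟨hab, starFreePair_of_centeredSparse ((trafficFreePair_iff S _ _).1 hab)
      (Or.inl (centeredSparse_adjoin_conjFamily hy
        (((trafficFreePair_iff S _ _).1 hT).mono subset_rfl ?_)))⟩
    rintro _ ⟨⟨j, ε⟩, rfl⟩
    exact ⟨(Sum.inl j, ε), rfl⟩
  · exact starFreePair_of_centeredSparse ((trafficFreePair_iff S a b).1 hT)
      (h.imp centeredSparse_of_freelyUnitarilyInvariant centeredSparse_of_freelyUnitarilyInvariant)
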